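/- **The classical limit of the multiple $q$-gamma function.** Write $\binom{x}{k}=x(x-1)\cdots(x-k+1)/k!$ for $x\in\mathbb C$, $k\ge 0$; let $B_r$ be the Bernoulli numbers ($B_1=-\tfrac12$), $B_m(t)$ the Bernoulli polynomials, $\overline B_m(t)=B_m(t-\lfloor t\rfloor)$, and let $\zeta$ be the Riemann zeta function. For $0<q<1$ put $G_0(z;q)=\dfrac{1-q^z}{1-q}$ and, for $n\ge 1$, $$G_n(z+1;q)=(1-q)^{-\binom zn}\prod_{k=1}^\infty\left\{\left(\frac{1-q^{z+k}}{1-q^k}\right)^{-\binom{-k}{n-1}}(1-q^k)^{\binom{z-k}{n-1}-\binom{-k}{n-1}}\right\}.$$ There is exactly one sequence $(G_n)_{n\ge0}$ of meromorphic functions on $\mathbb C$ (the Vignéras multiple gamma functions) such that, for all $n$: (1) $G_{n+1}(z+1)=G_n(z)G_{n+1}(z)$; (2) $G_n(1)=1$; (3) for real $x\ge0$, $G_n(x+1)$ is finite, real and positive and $\frac{d^{n+1}}{dx^{n+1}}\log G_n(x+1)\ge0$; (4) $G_0(z)=z$. They have the following properties. (a) For every $n\ge0$, as $q\to1-0$,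 $G_n(z+1;q)$ converges to $G_n(z+1)$ uniformly on every compact subset of $\mathbb C\setminus\mathbb Z_{<0}$. (b) Let $n\ge1$. On $\mathbb C\setminus(-\infty,-1]$ there is a holomorphic branch of $\log G_n(z+1)$ that vanishes at $z=0$, and for every $m>n$ and every $z\in\mathbb C\setminus(-\infty,-1]$ $$\begin{aligned}\log G_n(z+1)={}&\left\{\binom{z+1}{n}+\sum_{r=1}^n\frac{B_r}{r!}\left(-\frac{d}{dz}\right)^{r-1}\binom{z}{n-1}\right\}\log(z+1)\\&-\sum_{r=1}^n\left\{\left(-\frac{d}{dz}\right)^{r-1}\binom{z}{n-1}\right\}\frac{1}{r!\,r}\left\{(z+1)^r-1\right\}\\&-\sum_{j=0}^{n-1}G_{n,j}(z)\left\{\zeta'(-j)+\frac1{(j+1)^2}\right\}+\sum_{r=1}^m\frac{B_r}{r!}F_{n,r-1}(z)-R_{n,m}(z),\end{aligned}$$ where $\log$ on the right is the principal branch, the polynomials $G_{n,j}(z)$ are defined by $\binom{z-u}{n-1}=\sum_{j=0}^{n-1}G_{n,j}(z)u^j$, and $$F_{n,r-1}(z)=\left(\frac{d}{dt}\right)^{r-1}\left\{\binom{-t}{n-1}\log\frac{z+t}{z+1}\right\}\Bigg|_{t=1},$$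 $$R_{n,m}(z)=\frac{(-1)^{m-1}}{m!}\int_1^\infty\overline B_m(t)\left(\frac{d}{dt}\right)^m\left\{\binom{-t}{n-1}\log\frac{z+t}{z+1}\right\}dt,$$ the last integral being absolutely convergent. -/

import Mathlib

open Filter Topology MeasureTheory

noncomputable section

/-- The binomial coefficient `x (x - 1) ⋯ (x - k + 1) / k!` as a polynomial in `x`. -/
def binomPoly (k : ℕ) : Polynomial ℂ :=
  Polynomial.C ((k.factorial : ℂ)⁻¹) * descPochhammer ℂ k

/-- The binomial coefficient `binom(z, k)` for a complex number `z`. -/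
def cbinom (z : ℂ) (k : ℕ) : ℂ := (binomPoly k).eval z

/-- `(-d/dz)^s binom(z, k)`. -/
def negDerivBinom (s k : ℕ) (z : ℂ) : ℂ :=
  (-1) ^ s * (Polynomial.derivative^[s] (binomPoly k)).eval z

/-- The coefficient of `u ^ j` in `binom(z - u, n - 1)`, as a polynomial in `u` (for `1 ≤ n`). -/
def binomShiftCoeff (n j : ℕ) (z : ℂ) : ℂ :=
  ((binomPoly (n - 1)).comp (Polynomial.C z - Polynomial.X)).coeff j

/-- The multiple `q`-gamma function `G_n(w; q)` for `0 < q < 1`: `G_0(w; q) = [w]_q`, and, for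
`n ≥ 1` and `w = z + 1`,
`G_n(z+1; q) = (1-q)^{-binom(z,n)} ∏_{k ≥ 1} ((1-q^{z+k})/(1-q^k))^{-binom(-k,n-1)} (1-q^k)^{g_n(z,k)}`
with `g_n(z,k) = binom(z-k,n-1) - binom(-k,n-1)`. The exponent `-binom(-k,n-1)` is an integer,
and the other two powers have a positive base. The index `i` below is `k - 1`. -/
def qMultipleGamma : ℕ → ℝ → ℂ → ℂ
  | 0, q, w => (1 - (q : ℂ) ^ w) / (1 - (q : ℂ))
  | n + 1, q, w =>
      ((1 - q : ℝ) : ℂ) ^ (-cbinom (w - 1) (n + 1)) *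
        ∏' i : ℕ,
          (((1 - (q : ℂ) ^ ((w - 1) + ((i + 1 : ℕ) : ℂ))) / (1 - (q : ℂ) ^ (i + 1))) ^
              (-Ring.choose (-((i + 1 : ℕ) : ℤ)) n) *
            ((1 - q ^ (i + 1) : ℝ) : ℂ) ^
              (cbinom ((w - 1) - ((i + 1 : ℕ) : ℂ)) n - cbinom (-((i + 1 : ℕ) : ℂ)) n))

/-- The hierarchy of multiple gamma functions of Vignéras (the generalized Bohr–Mollerup
conditions). Each `G n` is a meromorphic function on `ℂ`; "normal form" only fixes its pointwise
values: it is analytic at every point that is not a pole, and takes the default value `0` at a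
pole. Accordingly the functional equation is an identity of meromorphic functions. The
condition on `log G_n(x + 1)`, `x ≥ 0`, refers to the real logarithm of a positive function. -/
structure IsVignerasHierarchy (G : ℕ → ℂ → ℂ) : Prop where
  meromorphic : ∀ n, MeromorphicNFOn (G n) Set.univ
  map_add_one : ∀ n, (fun z => G (n + 1) (z + 1)) =ᶠ[codiscrete ℂ] fun z => G n z * G (n + 1) z
  map_one : ∀ n, G n 1 = 1
  pos : ∀ n, ∀ x : ℝ, 0 ≤ x → ∃ y : ℝ, 0 < y ∧ G n ((x : ℂ) + 1) = (y : ℂ)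
  deriv_log_nonneg : ∀ n, ∀ x : ℝ, 0 ≤ x →
    0 ≤ iteratedDeriv (n + 1) (fun t : ℝ => Real.log (G n ((t : ℂ) + 1)).re) x
  zero_eq : ∀ z, G 0 z = z

/-- `ℂ ∖ ℤ_{<0}`. -/
def complNegInt : Set ℂ := {z | ∀ k : ℕ, z ≠ -((k : ℂ) + 1)}

/-- `ℂ ∖ (-∞, -1]`. -/
def cutPlane : Set ℂ := {z | z + 1 ∈ Complex.slitPlane}

/-- The function `t ↦ binom(-t, n - 1) log ((z + t) / (z + 1))` of a real variable. -/
def binomLog (n : ℕ) (z : ℂ) (t : ℝ) : ℂ :=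
  cbinom (-(t : ℂ)) (n - 1) * Complex.log ((z + (t : ℂ)) / (z + 1))

/-- `F_{n,s}(z) = (d/dt)^s { binom(-t, n - 1) log ((z + t) / (z + 1)) }` at `t = 1`. -/
def bernTerm (n s : ℕ) (z : ℂ) : ℂ := iteratedDeriv s (binomLog n z) 1

/-- `B̄_m(t) (d/dt)^m { binom(-t, n - 1) log ((z + t) / (z + 1)) }`, where
`B̄_m(t) = B_m(t - ⌊t⌋)`. -/
def remainderIntegrand (n m : ℕ) (z : ℂ) (t : ℝ) : ℂ :=
  (bernoulliFun m (Int.fract t) : ℂ) * iteratedDeriv m (binomLog n z) t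

/-- The remainder `R_{n,m}(z)`. -/
def remainderTerm (n m : ℕ) (z : ℂ) : ℂ :=
  (-1) ^ (m - 1) / (m.factorial : ℂ) * ∫ t in Set.Ioi (1 : ℝ), remainderIntegrand n m z t

end

noncomputable section

/-! ### Binomial polynomials and Newton interpolation at `x, x + 1, …, x + n` -/

/-! Everything rests on `newtonRem`, the error of Newton interpolation at consecutive nodes x, …, x
+ n. Let e be the identity or w ↦ [w]_q (`qNumber`), and let a_i = -binom(-(i+1), n). The i-th term
of the logarithm is a_i times the error, at i + 1 + z, of interpolating log e at i + 1, …, i + n +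
2. In both cases the derivative of log e is at most 1 / Re w on the right half plane (`LogLike`).
Cauchy-type estimates then make the error O(i^(-n-2)) with a constant that does not depend on e
(`exists_newtonRem_logLike_bound`). Since a_i = O(i^n), the series is dominated by C / i^2 uniformly
in q.

Limit. For e = [·]_q, summation by parts turns `mgProd` into the defining product of the q-gamma
function (`qMultipleGamma_eq_mgProd`). Since [w]_q → w, dominated convergence along moving points z
gives the limit `mgProd id` (`tendsto_mgProd`), and this is the function G_{n+1}(z+1).

Existence. The functional equation comes from telescoping with Pascal's rule for the a_i
(`mgLog_add_one`). The sign condition holds term by term: the (n+2)-nd derivative removes the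
interpolating polynomial, and the sign of the derivative of log agrees with that of a_i
(`iteratedDeriv_mgLog_re_nonneg`).

Uniqueness. Let g and v be the logarithms of a candidate and of the constructed function. On [0, ∞)
the difference g - v is 1-periodic and vanishes at the integers, so its interpolation error at
integer nodes starting at N is (g - v)(x) for every N. The errors of v tend to 0. Those of g have
the sign of ∏ (x - j), because the relevant derivative of g is nonnegative. That product has
opposite signs on (0,1) and (1,2), so periodicity forces g = v (`eq_of_iteratedDeriv_nonneg`). The
identity theorem then extends the equality to the plane.

Expansion. `gammaEM` combines ζ'(-j, z+1) - ζ'(-j), written by Euler–Maclaurin, with the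
coefficients of binom(z - u, n - 1). It satisfies the same difference equations as `mgLog`, vanishes
at 0, and its interpolation errors at N also tend to 0. A periodic function that vanishes at 0 and
has this property is zero, so the two agree (`gammaEM_eq_mgLog`). The constants are identified with
ζ'(-j) by continuing the Euler–Maclaurin form of ζ(s) to s = -j (`hurwitzDeriv_one`). The remaining
work is algebra with Bernoulli polynomials (`log_coefficient`, `gammaEM_eq`). -/

theorem cbinom_eq_choose (z : ℂ) (k : ℕ) : cbinom z k = Ring.choose z k := by
  have h := Ring.descPochhammer_eq_factorial_smul_choose z k
  have h2 : (descPochhammer ℤ k).smeval z = (descPochhammer ℂ k).eval z := by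
    rw [← descPochhammer_map (Int.castRingHom ℂ), Polynomial.eval_map,
      ← Polynomial.eval₂_smulOneHom_eq_smeval]
    congr 1
    ext
    simp
  rw [h2] at h
  simp only [cbinom, binomPoly, Polynomial.eval_mul, Polynomial.eval_C, h, nsmul_eq_mul]
  have : (k.factorial : ℂ) ≠ 0 := by exact_mod_cast k.factorial_ne_zero
  field_simp

@[simp] theorem cbinom_zero_right (z : ℂ) : cbinom z 0 = 1 := by
  simp [cbinom_eq_choose]

theorem cbinom_zero_left (k : ℕ) : cbinom 0 (k + 1) = 0 := by
  simp [cbinom_eq_choose, Ring.choose_zero_succ]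

theorem cbinom_add_one (z : ℂ) (k : ℕ) : cbinom (z + 1) (k + 1) = cbinom z k + cbinom z (k + 1) := by
  simp [cbinom_eq_choose, Ring.choose_succ_succ]

theorem cbinom_natCast (N k : ℕ) : cbinom (N : ℂ) k = (N.choose k : ℂ) := by
  simp [cbinom_eq_choose, Ring.choose_natCast]

theorem cbinom_intCast (m : ℤ) (k : ℕ) : cbinom (m : ℂ) k = ((Ring.choose m k : ℤ) : ℂ) := by
  rw [cbinom_eq_choose]
  exact (Ring.map_choose (Int.castRingHom ℂ) m k).symm

theorem cbinom_add (x y : ℂ) (k : ℕ) :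
    cbinom (x + y) k = ∑ i ∈ Finset.range (k + 1), cbinom x i * cbinom y (k - i) := by
  simp only [cbinom_eq_choose]
  rw [Ring.add_choose_eq k (Commute.all x y), Finset.Nat.sum_antidiagonal_eq_sum_range_succ_mk]

theorem natDegree_binomPoly_le (k : ℕ) : (binomPoly k).natDegree ≤ k := by
  unfold binomPoly
  refine (Polynomial.natDegree_C_mul_le _ _).trans ?_
  rw [descPochhammer_natDegree]

theorem continuous_cbinom (k : ℕ) : Continuous fun z => cbinom z k := (binomPoly k).continuous

theorem differentiable_cbinom (k : ℕ) : Differentiable ℂ fun z => cbinom z k :=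
  (binomPoly k).differentiable

/-- The error at `x + z` of the Newton interpolation of `h` at the nodes `x, x + 1, …, x + n`. -/
def newtonRem (n : ℕ) (h : ℂ → ℂ) (z x : ℂ) : ℂ :=
  h (x + z) - ∑ j ∈ Finset.range (n + 1), cbinom z j * (fwdDiff (1 : ℂ))^[j] h x

theorem newtonRem_natCast {n j : ℕ} (hj : j ≤ n) (h : ℂ → ℂ) (x : ℂ) :
    newtonRem n h j x = 0 := by
  have h1 := shift_eq_sum_fwdDiff_iter (1 : ℂ) h j x
  rw [newtonRem, sub_eq_zero]
  simp only [nsmul_eq_mul, mul_one] at h1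
  rw [h1]
  have : Finset.range (j + 1) ⊆ Finset.range (n + 1) := by
    intro i; simp; omega
  rw [← Finset.sum_subset this]
  · exact Finset.sum_congr rfl fun i _ => by rw [cbinom_natCast]
  · intro i _ hi
    rw [cbinom_natCast, Nat.choose_eq_zero_of_lt (by simpa using hi)]
    simp

theorem newtonRem_zero (n : ℕ) (h : ℂ → ℂ) (x : ℂ) : newtonRem n h 0 x = 0 := by
  simpa using newtonRem_natCast (Nat.zero_le n) h x

theorem newtonRem_add (n : ℕ) (g h : ℂ → ℂ) (z x : ℂ) :
    newtonRem n (fun w => g w + h w) z x = newtonRem n g z x + newtonRem n h z x := by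
  have : (fun w => g w + h w) = g + h := rfl
  simp only [newtonRem, this, fwdDiff_iter_add, Pi.add_apply, mul_add, Finset.sum_add_distrib]
  ring

theorem newtonRem_const_mul (n : ℕ) (c : ℂ) (h : ℂ → ℂ) (z x : ℂ) :
    newtonRem n (fun w => c * h w) z x = c * newtonRem n h z x := by
  have : (fun w => c * h w) = c • h := rfl
  simp only [newtonRem, this, fwdDiff_iter_const_smul, Pi.smul_apply, smul_eq_mul, mul_sub,
    Finset.mul_sum]
  congr 1
  exact Finset.sum_congr rfl fun i _ => by ring

theorem newtonRem_sub (n : ℕ) (g h : ℂ → ℂ) (z x : ℂ) :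
    newtonRem n (fun w => g w - h w) z x = newtonRem n g z x - newtonRem n h z x := by
  have h1 := newtonRem_add n g (fun w => (-1) * h w) z x
  rw [newtonRem_const_mul] at h1
  simp only [neg_mul, one_mul, ← sub_eq_add_neg] at h1
  exact h1

theorem newtonRem_sum {ι : Type*} (s : Finset ι) (n : ℕ) (h : ι → ℂ → ℂ) (z x : ℂ) :
    newtonRem n (fun w => ∑ i ∈ s, h i w) z x = ∑ i ∈ s, newtonRem n (h i) z x := by
  classical
  induction s using Finset.induction_on with
  | empty =>
    have := newtonRem_const_mul n 0 (fun _ => 0) z x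
    simpa using this
  | insert i s hi ih => simp only [Finset.sum_insert hi, newtonRem_add, ih]

/-- The `newtonRem` only depends on the values at the nodes and at the point. -/
theorem newtonRem_congr {n : ℕ} {g h : ℂ → ℂ} {z x : ℂ} (hz : g (x + z) = h (x + z))
    (hj : ∀ j : ℕ, j ≤ n → g (x + j) = h (x + j)) : newtonRem n g z x = newtonRem n h z x := by
  simp only [newtonRem, hz, fwdDiff_iter_eq_sum_shift]
  congr 1
  refine Finset.sum_congr rfl fun j hj' => ?_
  congr 1
  refine Finset.sum_congr rfl fun i hi => ?_
  rw [Finset.mem_range] at hj' hi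
  rw [nsmul_eq_mul, mul_one, hj i (by omega)]

theorem newtonRem_shift (n : ℕ) (h : ℂ → ℂ) (z x y : ℂ) :
    newtonRem n (fun w => h (y + w)) z x = newtonRem n h z (y + x) := by
  have : ∀ j, (fwdDiff (1 : ℂ))^[j] (fun w => h (y + w)) x = (fwdDiff (1 : ℂ))^[j] h (y + x) := by
    intro j
    have := fwdDiff_iter_comp_add (1 : ℂ) h y j x
    simpa [add_comm] using this
  simp only [newtonRem, this, add_assoc]

/-- As a function of z the error is itself a polynomial of degree at most n, and it has the n + 1
zeros 0, …, n. -/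
theorem newtonRem_poly {n : ℕ} {p : Polynomial ℂ} (hp : p.natDegree ≤ n) (z x : ℂ) :
    newtonRem n (fun w => p.eval w) z x = 0 := by
  set Q : Polynomial ℂ := p.comp (Polynomial.C x + Polynomial.X) -
    ∑ j ∈ Finset.range (n + 1),
      binomPoly j * Polynomial.C ((fwdDiff (1 : ℂ))^[j] (fun w => p.eval w) x) with hQ
  have hev : ∀ w, Q.eval w = newtonRem n (fun w => p.eval w) w x := by
    intro w
    simp [hQ, newtonRem, Polynomial.eval_finsetSum, cbinom]
  have hdeg : Q.natDegree < n + 1 := by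
    rw [Nat.lt_succ_iff]
    refine (Polynomial.natDegree_sub_le _ _).trans (max_le ?_ ?_)
    · refine Polynomial.natDegree_comp_le.trans ?_
      calc p.natDegree * (Polynomial.C x + Polynomial.X).natDegree ≤ n * 1 := by
            gcongr
            rw [add_comm, Polynomial.natDegree_X_add_C]
        _ = n := mul_one n
    · refine Polynomial.natDegree_sum_le_of_forall_le _ _ fun j hj => ?_
      refine (Polynomial.natDegree_mul_C_le _ _).trans ((natDegree_binomPoly_le j).trans ?_)
      simpa [Nat.lt_succ_iff] using hj
  have hQ0 : Q = 0 := by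
    refine Polynomial.eq_zero_of_natDegree_lt_card_of_eval_eq_zero' Q
      ((Finset.range (n + 1)).map ⟨fun j : ℕ => (j : ℂ), Nat.cast_injective⟩) ?_ ?_
    · intro w hw
      simp only [Finset.mem_map, Finset.mem_range, Function.Embedding.coeFn_mk] at hw
      obtain ⟨j, hj, rfl⟩ := hw
      rw [hev, newtonRem_natCast (by omega)]
    · simpa using hdeg
  rw [← hev, hQ0, Polynomial.eval_zero]

theorem newtonRem_const (n : ℕ) (c z x : ℂ) : newtonRem n (fun _ => c) z x = 0 := by
  simpa using newtonRem_poly (n := n) (p := Polynomial.C c) (by simp) z x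

theorem newtonRem_add_const (n : ℕ) (c : ℂ) (h : ℂ → ℂ) (z x : ℂ) :
    newtonRem n (fun w => h w + c) z x = newtonRem n h z x := by
  rw [newtonRem_add, newtonRem_const, add_zero]

/-- If the polynomial `p` interpolates `h` at the nodes, it computes the remainder. -/
theorem newtonRem_eq_of_interp {n : ℕ} {p : Polynomial ℂ} (hp : p.natDegree ≤ n) {h : ℂ → ℂ}
    {x : ℂ} (hj : ∀ j : ℕ, j ≤ n → h (x + j) = p.eval (x + j)) (z : ℂ) :
    newtonRem n h z x = h (x + z) - p.eval (x + z) := by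
  have h1 : newtonRem n (fun w => h w - p.eval w) z x = newtonRem n h z x := by
    rw [newtonRem_sub, newtonRem_poly hp, sub_zero]
  rw [← h1, newtonRem]
  simp only [fwdDiff_iter_eq_sum_shift]
  rw [sub_eq_self]
  refine Finset.sum_eq_zero fun j hj' => ?_
  rw [Finset.sum_eq_zero, mul_zero]
  intro i hi
  rw [Finset.mem_range] at hj' hi
  rw [nsmul_eq_mul, mul_one, hj i (by omega), sub_self, smul_zero]

/-- The forward difference in `z` lowers the order of the remainder. -/
theorem newtonRem_add_one_sub (n : ℕ) (h : ℂ → ℂ) (z x : ℂ) :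
    newtonRem (n + 1) h (z + 1) x - newtonRem (n + 1) h z x =
      newtonRem n h z (x + 1) - newtonRem n h z x := by
  have key : ∀ j, (fwdDiff (1 : ℂ))^[j + 1] h x =
      (fwdDiff (1 : ℂ))^[j] h (x + 1) - (fwdDiff (1 : ℂ))^[j] h x := by
    intro j
    rw [Function.iterate_succ_apply']
    rfl
  simp only [newtonRem]
  rw [Finset.sum_range_succ' _ (n + 1), Finset.sum_range_succ' _ (n + 1)]
  simp only [cbinom_add_one, key, cbinom_zero_right, Function.iterate_zero, id, add_mul, mul_sub,
    Finset.sum_add_distrib, Finset.sum_sub_distrib]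
  rw [show x + (z + 1) = x + 1 + z by ring]
  ring

/-! ### Bounds for the interpolation error -/

/-- Iterates the Schwarz lemma for the difference quotient at 0: each division by w costs a factor 2
/ R in the bound, and the constant r(0) that is split off becomes the next Taylor coefficient. -/
theorem exists_taylor_remainder {g : ℂ → ℂ} {R M : ℝ} (hR : 0 < R)
    (hg : DifferentiableOn ℂ g (Metric.ball 0 R)) (hM : ∀ w ∈ Metric.ball (0 : ℂ) R, ‖g w‖ ≤ M)
    (k : ℕ) : ∃ (p : Polynomial ℂ) (r : ℂ → ℂ), p.natDegree ≤ k - 1 ∧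
      DifferentiableOn ℂ r (Metric.ball 0 R) ∧
      (∀ w ∈ Metric.ball (0 : ℂ) R, ‖r w‖ ≤ M * (2 / R) ^ k) ∧
      ∀ w, g w = p.eval w + w ^ k * r w := by
  induction k with
  | zero => exact ⟨0, g, by simp, hg, by simpa using hM, by simp⟩
  | succ k ih =>
    obtain ⟨p, r, hp, hr, hrM, hgr⟩ := ih
    have h0 : (0 : ℂ) ∈ Metric.ball (0 : ℂ) R := by simpa using hR
    refine ⟨p + Polynomial.C (r 0) * Polynomial.X ^ k, dslope r 0, ?_, ?_, ?_, ?_⟩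
    · refine Polynomial.natDegree_add_le_of_degree_le (hp.trans (by omega)) ?_
      simpa using Polynomial.natDegree_C_mul_X_pow_le (r 0) k
    · exact (Complex.differentiableOn_dslope (Metric.ball_mem_nhds _ hR)).2 hr
    · intro w hw
      have hmaps : Set.MapsTo r (Metric.ball 0 R)
          (Metric.closedBall (r 0) (2 * (M * (2 / R) ^ k))) := by
        intro y hy
        rw [mem_closedBall_iff_norm]
        refine (norm_sub_le _ _).trans ?_
        have := hrM y hy
        have := hrM 0 h0
        linarith
      refine (Complex.norm_dslope_le_div_of_mapsTo_ball hr hmaps hw).trans (le_of_eq ?_)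
      rw [pow_succ]
      ring
    · intro w
      have h1 := sub_smul_dslope r 0 w
      simp only [sub_zero, smul_eq_mul] at h1
      rw [hgr, Polynomial.eval_add, Polynomial.eval_mul, Polynomial.eval_C, Polynomial.eval_pow,
        Polynomial.eval_X, pow_succ, mul_assoc (w ^ k), h1]
      ring

/-- The Taylor polynomial of degree n at x has zero error, so only w^(n+1) r(w) is interpolated. On
the disc of radius ρ this is at most (2ρ/R)^(n+1) M. The condition n ≤ ρ puts the nodes in that
disc. -/
theorem exists_newtonRem_bound (n : ℕ) (ρ : ℝ) (hn : (n : ℝ) ≤ ρ) :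
    ∃ C : ℝ, 0 ≤ C ∧ ∀ (g : ℂ → ℂ) (x z : ℂ) (R M : ℝ), ρ < R → ‖z‖ ≤ ρ →
      DifferentiableOn ℂ g (Metric.ball x R) → (∀ w ∈ Metric.ball x R, ‖g w‖ ≤ M) →
      ‖newtonRem n g z x‖ ≤ C * M / R ^ (n + 1) := by
  have hρ : 0 ≤ ρ := (Nat.cast_nonneg n).trans hn
  have hB : ∀ j, ∃ B : ℝ, 0 ≤ B ∧ ∀ z : ℂ, ‖z‖ ≤ ρ → ‖cbinom z j‖ ≤ B := by
    intro j
    obtain ⟨B, hB⟩ := (isCompact_closedBall (0 : ℂ) ρ).exists_bound_of_continuousOn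
      (continuous_cbinom j).continuousOn
    refine ⟨max B 0, le_max_right _ _, fun z hz => (hB z (by simpa using hz)).trans (le_max_left _ _)⟩
  choose B hB0 hB using hB
  refine ⟨(2 * ρ) ^ (n + 1) * (1 + ∑ j ∈ Finset.range (n + 1), B j * 2 ^ j), ?_, ?_⟩
  · exact mul_nonneg (by positivity) (add_nonneg zero_le_one
      (Finset.sum_nonneg fun j _ => mul_nonneg (hB0 j) (by positivity)))
  intro g x z R M hR hz hg hM
  have hRpos : 0 < R := hρ.trans_lt hR
  have hM0 : 0 ≤ M := (norm_nonneg _).trans (hM x (by simpa using hRpos))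
  have hmaps : Set.MapsTo (fun w => x + w) (Metric.ball 0 R) (Metric.ball x R) := by
    intro w hw
    simpa [dist_eq_norm] using hw
  obtain ⟨p, r, hp, -, hr, hgr⟩ := exists_taylor_remainder (g := fun w => g (x + w)) hRpos
    (hg.comp (by fun_prop) hmaps) (fun w hw => hM _ (hmaps hw)) (n + 1)
  set e : ℂ → ℂ := fun w => w ^ (n + 1) * r w
  have he : ∀ w : ℂ, ‖w‖ ≤ ρ → ‖e w‖ ≤ ρ ^ (n + 1) * (M * (2 / R) ^ (n + 1)) := by
    intro w hw
    simp only [e, norm_mul, norm_pow]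
    gcongr
    exact hr w (by simpa using hw.trans_lt hR)
  have h1 : newtonRem n g z x = newtonRem n e z 0 := by
    have := newtonRem_shift n g z 0 x
    rw [add_zero] at this
    rw [← this]
    have h2 : (fun w => g (x + w)) = fun w => p.eval w + e w := funext hgr
    rw [h2, newtonRem_add, newtonRem_poly (by simpa using hp), zero_add]
  set E := ρ ^ (n + 1) * (M * (2 / R) ^ (n + 1)) with hE
  have hE0 : 0 ≤ E := by positivity
  have hdiff : ∀ j ∈ Finset.range (n + 1), ‖(fwdDiff (1 : ℂ))^[j] e 0‖ ≤ 2 ^ j * E := by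
    intro j hj
    rw [fwdDiff_iter_eq_sum_shift]
    have hj' : j ≤ n := by simpa [Nat.lt_succ_iff] using hj
    calc _ ≤ ∑ k ∈ Finset.range (j + 1), (j.choose k : ℝ) * E := by
          refine norm_sum_le_of_le _ fun k hk => ?_
          rw [zsmul_eq_mul, norm_mul]
          have hk' : k ≤ j := by simpa [Nat.lt_succ_iff] using hk
          have h3 : ‖((((-1) ^ (j - k) * (j.choose k : ℤ) : ℤ)) : ℂ)‖ = (j.choose k : ℝ) := by
            push_cast
            rw [norm_mul, norm_pow, norm_neg, norm_one, one_pow, one_mul, Complex.norm_natCast]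
          rw [h3]
          gcongr
          refine he _ ?_
          simp only [nsmul_eq_mul, mul_one, zero_add, Complex.norm_natCast]
          exact (by exact_mod_cast hk'.trans hj' : (k : ℝ) ≤ n).trans hn
      _ = 2 ^ j * E := by
          rw [← Finset.sum_mul]
          congr 1
          exact_mod_cast Nat.sum_range_choose j
  calc ‖newtonRem n g z x‖ ≤ ‖e (0 + z)‖ +
        ∑ j ∈ Finset.range (n + 1), ‖cbinom z j * (fwdDiff (1 : ℂ))^[j] e 0‖ := by
        rw [h1, newtonRem]
        refine (norm_sub_le _ _).trans ?_
        gcongr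
        exact norm_sum_le _ _
    _ ≤ E + ∑ j ∈ Finset.range (n + 1), B j * (2 ^ j * E) := by
        gcongr with j hj
        · rw [zero_add]; exact he z hz
        · rw [norm_mul]
          exact mul_le_mul (hB j z hz) (hdiff j hj) (norm_nonneg _) (hB0 j)
    _ = E * (1 + ∑ j ∈ Finset.range (n + 1), B j * 2 ^ j) := by
        rw [mul_add, mul_one, Finset.mul_sum]
        congr 1
        exact Finset.sum_congr rfl fun j _ => by ring
    _ = _ := by
        rw [hE, mul_pow, div_pow]
        field_simp

/-- Functions on the right half plane whose derivative is bounded like that of the logarithm. -/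
def LogLike (h : ℂ → ℂ) : Prop :=
  ∀ w : ℂ, 0 < w.re → ∃ h', HasDerivAt h h' w ∧ ‖h'‖ ≤ 1 / w.re

theorem logLike_log : LogLike Complex.log := by
  intro w hw
  refine ⟨w⁻¹, Complex.hasDerivAt_log (Or.inl hw), ?_⟩
  rw [norm_inv, inv_eq_one_div]
  exact one_div_le_one_div_of_le hw (Complex.re_le_norm w)

theorem LogLike.differentiableAt {h : ℂ → ℂ} (hh : LogLike h) {w : ℂ} (hw : 0 < w.re) :
    DifferentiableAt ℂ h w := by
  obtain ⟨h', h1, -⟩ := hh w hw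
  exact h1.differentiableAt

/-- The error ignores constants, so h may be replaced by h - h(k). On the disc of radius k/2 about k
the derivative is at most 2/k, hence h - h(k) is at most 1 there. The constant depends on n and ρ
but not on h; this is the source of uniformity in q. -/
theorem exists_newtonRem_logLike_bound (n : ℕ) (ρ : ℝ) (hn : (n : ℝ) ≤ ρ) :
    ∃ C : ℝ, 0 ≤ C ∧ ∀ (h : ℂ → ℂ), LogLike h → ∀ (k : ℝ) (z : ℂ), 2 * ρ < k → ‖z‖ ≤ ρ →
      ‖newtonRem n h z k‖ ≤ C / k ^ (n + 1) := by
  obtain ⟨C, hC, hbound⟩ := exists_newtonRem_bound n ρ hn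
  refine ⟨C * 2 ^ (n + 1), by positivity, fun h hh k z hk hz => ?_⟩
  have hρ : 0 ≤ ρ := (Nat.cast_nonneg n).trans hn
  have hk0 : 0 < k := by linarith
  have hre : ∀ w ∈ Metric.ball (k : ℂ) (k / 2), k / 2 < w.re := by
    intro w hw
    have h1 : ‖w - k‖ < k / 2 := by simpa [dist_eq_norm] using hw
    have h2 := Complex.abs_re_le_norm (w - k)
    rw [Complex.sub_re, Complex.ofReal_re] at h2
    have := (abs_lt.1 (h2.trans_lt h1)).1
    linarith
  have hd : ∀ w ∈ Metric.ball (k : ℂ) (k / 2), ∃ h', HasDerivAt h h' w ∧ ‖h'‖ ≤ 2 / k := by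
    intro w hw
    have h0 := hre w hw
    obtain ⟨h', h1, h2⟩ := hh w (by linarith)
    refine ⟨h', h1, h2.trans ?_⟩
    rw [div_le_div_iff₀ (by linarith) hk0]
    linarith
  have hkmem : (k : ℂ) ∈ Metric.ball (k : ℂ) (k / 2) := by simp [hk0]
  have h1 : newtonRem n (fun w => h w - h k) z k = newtonRem n h z k := by
    have := newtonRem_add_const n (- h k) h z k
    simpa [sub_eq_add_neg] using this
  have h2 := hbound (fun w => h w - h k) k z (k / 2) 1 (by linarith) hz ?_ ?_
  · rw [h1] at h2
    refine h2.trans (le_of_eq ?_)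
    rw [div_pow]
    field_simp
  · intro w hw
    obtain ⟨h', h3, -⟩ := hd w hw
    exact (h3.differentiableAt.sub_const _).differentiableWithinAt
  · intro w hw
    have hder : ∀ y ∈ Metric.ball (k : ℂ) (k / 2), ‖deriv h y‖ ≤ 2 / k := by
      intro y hy
      obtain ⟨h', h3, h4⟩ := hd y hy
      rwa [h3.deriv]
    have h5 := (convex_ball (k : ℂ) (k / 2)).norm_image_sub_le_of_norm_deriv_le
      (fun y hy => (hd y hy).choose_spec.1.differentiableAt) hder hkmem hw
    refine h5.trans ?_
    have h6 : ‖w - k‖ ≤ k / 2 := by simpa [dist_eq_norm] using (Metric.mem_ball.1 hw).le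
    calc 2 / k * ‖w - k‖ ≤ 2 / k * (k / 2) := by gcongr
      _ = 1 := by field_simp

/-! ### The exponents -/

/-- The exponent of `(z + i + 1)` in the product for `G_{n+1}(z+1)`. -/
def mgExponent (n i : ℕ) : ℤ := -Ring.choose (-((i + 1 : ℕ) : ℤ)) n

theorem mgExponent_cast (n i : ℕ) : (mgExponent n i : ℂ) = -cbinom (-((i + 1 : ℕ) : ℂ)) n := by
  have := cbinom_intCast (-((i + 1 : ℕ) : ℤ)) n
  rw [mgExponent]
  push_cast at this ⊢
  rw [this]

theorem mgExponent_eq (n i : ℕ) : mgExponent n i = (-1) ^ (n + 1) * ((i + n).choose n : ℤ) := by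
  have h := Ring.choose_neg (((i + 1 : ℕ) : ℤ)) n
  rw [mgExponent]
  have h2 : (((i + 1 : ℕ) : ℤ) + n - 1) = ((i + n : ℕ) : ℤ) := by push_cast; ring
  rw [h, h2, Ring.choose_natCast, pow_succ]
  rcases Nat.even_or_odd n with hn | hn <;> simp [hn.neg_one_pow, Int.negOnePow_even, Int.negOnePow_odd, hn, Units.smul_def]

theorem norm_mgExponent_le (n i : ℕ) :
    ‖(mgExponent n i : ℂ)‖ ≤ ((n + 1 : ℕ) : ℝ) ^ n * ((i + 1 : ℕ) : ℝ) ^ n := by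
  have h1 : ‖(mgExponent n i : ℂ)‖ = ((i + n).choose n : ℝ) := by
    rw [mgExponent_eq]
    push_cast
    rw [norm_mul, norm_pow, norm_neg, norm_one, one_pow, one_mul, Complex.norm_natCast]
  rw [h1, ← mul_pow]
  have h2 : (i + n).choose n ≤ ((n + 1) * (i + 1)) ^ n :=
    (Nat.choose_le_pow _ _).trans (Nat.pow_le_pow_left (by nlinarith) n)
  exact_mod_cast h2

theorem mgExponent_zero_left (i : ℕ) : mgExponent 0 i = -1 := by
  simp [mgExponent]

theorem mgExponent_zero_right (n : ℕ) : mgExponent n 0 = (-1) ^ (n + 1) := by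
  simp [mgExponent_eq]

/-- Pascal's rule with signs. All telescoping below, both in the summation by parts and in the
functional equation, uses this relation. -/
theorem mgExponent_succ (n i : ℕ) :
    mgExponent (n + 1) i - mgExponent (n + 1) (i + 1) = mgExponent n (i + 1) := by
  rw [mgExponent_eq, mgExponent_eq, mgExponent_eq]
  have : (i + 1 + (n + 1)).choose (n + 1) = (i + 1 + n).choose n + (i + (n + 1)).choose (n + 1) := by
    rw [show i + (n + 1) = i + 1 + n by ring, ← Nat.choose_succ_succ]
    rfl
  rw [this]
  push_cast
  ring

/-! ### Convergence of the products -/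

/-- The interpolation error at `z` of `log ∘ e` at `i + 1, …, i + n + 2`, times the exponent. -/
def mgTerm (e : ℂ → ℂ) (n i : ℕ) (z : ℂ) : ℂ :=
  (mgExponent n i : ℂ) * newtonRem (n + 1) (fun w => Complex.log (e w)) z ((i + 1 : ℕ) : ℂ)

/-- The exponential of `mgTerm`, written as a meromorphic function of `z`. -/
def mgFactor (e : ℂ → ℂ) (n i : ℕ) (z : ℂ) : ℂ :=
  (e (z + ((i + 1 : ℕ) : ℂ)) / e ((i + 1 : ℕ) : ℂ)) ^ mgExponent n i *
    Complex.exp (-(mgExponent n i : ℂ) * ∑ j ∈ Finset.range (n + 1), cbinom z (j + 1) *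
      (fwdDiff (1 : ℂ))^[j + 1] (fun w => Complex.log (e w)) ((i + 1 : ℕ) : ℂ))

/-- For `e = id` this is the Vignéras function `G_{n+1}(z+1)`. -/
def mgProd (e : ℂ → ℂ) (n : ℕ) (z : ℂ) : ℂ := ∏' i, mgFactor e n i z

/-- The j = 0 term of the Newton sum is log e(i+1), which together with log e(z+i+1) forms the
quotient. Because the exponent is an integer, the exponential no longer depends on a branch of log
at z + i + 1 and makes sense across the cut. -/
theorem exp_mgTerm {e : ℂ → ℂ} {n i : ℕ} {z : ℂ} (h1 : e (z + ((i + 1 : ℕ) : ℂ)) ≠ 0)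
    (h2 : e ((i + 1 : ℕ) : ℂ) ≠ 0) : Complex.exp (mgTerm e n i z) = mgFactor e n i z := by
  rw [mgTerm, mgFactor, newtonRem, Finset.sum_range_succ']
  simp only [cbinom_zero_right, Function.iterate_zero, id, one_mul]
  set S := ∑ j ∈ Finset.range (n + 1), cbinom z (j + 1) *
      (fwdDiff (1 : ℂ))^[j + 1] (fun w => Complex.log (e w)) ((i + 1 : ℕ) : ℂ)
  rw [show (mgExponent n i : ℂ) * (Complex.log (e (((i + 1 : ℕ) : ℂ) + z)) -
      (S + Complex.log (e ((i + 1 : ℕ) : ℂ)))) =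
      (mgExponent n i : ℂ) * (Complex.log (e (z + ((i + 1 : ℕ) : ℂ))) -
        Complex.log (e ((i + 1 : ℕ) : ℂ))) + -(mgExponent n i : ℂ) * S by
    rw [add_comm z]; ring, Complex.exp_add, Complex.exp_int_mul, Complex.exp_sub,
    Complex.exp_log h1, Complex.exp_log h2]

/-- The exponent contributes k^n and the interpolation error k^(-n-2), where k = i + 1. The constant
is chosen before e, as dominated convergence in q requires. -/
theorem exists_mgTerm_bound (n : ℕ) (ρ : ℝ) (hn : ((n + 1 : ℕ) : ℝ) ≤ ρ) :
    ∃ C : ℝ, ∀ e : ℂ → ℂ, LogLike (fun w => Complex.log (e w)) → ∀ (i : ℕ) (z : ℂ),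
      2 * ρ < ((i + 1 : ℕ) : ℝ) → ‖z‖ ≤ ρ → ‖mgTerm e n i z‖ ≤ C * (1 / ((i + 1 : ℕ) : ℝ) ^ 2) := by
  obtain ⟨C, hC, hb⟩ := exists_newtonRem_logLike_bound (n + 1) ρ hn
  refine ⟨((n + 1 : ℕ) : ℝ) ^ n * C, fun e he i z hi hz => ?_⟩
  have h := hb _ he _ z hi hz
  have hpos : 0 < ((i + 1 : ℕ) : ℝ) := by positivity
  rw [Complex.ofReal_natCast] at h
  rw [mgTerm, norm_mul]
  calc _ ≤ (((n + 1 : ℕ) : ℝ) ^ n * ((i + 1 : ℕ) : ℝ) ^ n) * (C / ((i + 1 : ℕ) : ℝ) ^ (n + 1 + 1)) :=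
        mul_le_mul (norm_mgExponent_le n i) h (norm_nonneg _) (by positivity)
    _ = _ := by
        rw [show n + 1 + 1 = n + 2 by ring, pow_add]
        field_simp

theorem summable_inv_sq_shift (C : ℝ) (K : ℕ) :
    Summable fun i : ℕ => C * (1 / ((i + K + 1 : ℕ) : ℝ) ^ 2) := by
  have h := (summable_nat_add_iff (K + 1)).2 (Real.summable_one_div_nat_pow.2 one_lt_two)
  exact (h.congr fun i => by rw [add_assoc]).mul_left C

theorem summable_mgTerm {e : ℂ → ℂ} (he : LogLike (fun w => Complex.log (e w))) (n : ℕ) (z : ℂ) :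
    Summable fun i => mgTerm e n i z := by
  set ρ : ℝ := max ‖z‖ ((n + 1 : ℕ) : ℝ)
  obtain ⟨C, hC⟩ := exists_mgTerm_bound n ρ (le_max_right _ _)
  obtain ⟨K, hK⟩ := exists_nat_gt (2 * ρ)
  refine (summable_nat_add_iff K).1 (Summable.of_norm_bounded (summable_inv_sq_shift C K) fun i => ?_)
  refine hC e he (i + K) z (hK.trans_le ?_) (le_max_left _ _)
  exact_mod_cast (by omega : K ≤ i + K + 1)

theorem re_add_natCast_pos {ρ : ℝ} {z : ℂ} {K i : ℕ} (hz : ‖z‖ ≤ ρ) (hK : 2 * ρ < K) :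
    0 < (z + ((i + K + 1 : ℕ) : ℂ)).re := by
  have h1 := (abs_le.1 ((Complex.abs_re_le_norm z).trans hz)).1
  have h2 : 0 ≤ ρ := (norm_nonneg z).trans hz
  rw [Complex.add_re, Complex.natCast_re]
  push_cast
  have : (0 : ℝ) ≤ i := Nat.cast_nonneg i
  linarith

/-- Outside a finite product, the factors are exponentials. -/
theorem hasProd_mgFactor {e : ℂ → ℂ} (he : LogLike (fun w => Complex.log (e w)))
    (he0 : ∀ w : ℂ, 0 < w.re → e w ≠ 0) (n : ℕ) {ρ : ℝ} {z : ℂ} {K : ℕ} (hz : ‖z‖ ≤ ρ)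
    (hK : 2 * ρ < K) :
    HasProd (fun i => mgFactor e n i z)
      ((∏ i ∈ Finset.range K, mgFactor e n i z) *
        Complex.exp (∑' i, mgTerm e n (i + K) z)) := by
  refine HasProd.prod_range_mul ?_
  have h1 := ((summable_nat_add_iff K).2 (summable_mgTerm he n z)).hasSum.cexp
  refine h1.congr_fun ?_
  intro i
  refine (exp_mgTerm (he0 _ (re_add_natCast_pos hz hK)) (he0 _ ?_)).symm
  rw [Complex.natCast_re]
  positivity

theorem mgProd_eq {e : ℂ → ℂ} (he : LogLike (fun w => Complex.log (e w)))
    (he0 : ∀ w : ℂ, 0 < w.re → e w ≠ 0) (n : ℕ) {ρ : ℝ} {z : ℂ} {K : ℕ} (hz : ‖z‖ ≤ ρ)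
    (hK : 2 * ρ < K) :
    mgProd e n z = (∏ i ∈ Finset.range K, mgFactor e n i z) *
        Complex.exp (∑' i, mgTerm e n (i + K) z) :=
  (hasProd_mgFactor he he0 n hz hK).tprod_eq

theorem logLike_log_id : LogLike (fun w => Complex.log (id w)) := logLike_log

theorem id_ne_zero_of_re_pos (w : ℂ) (hw : 0 < w.re) : id w ≠ 0 := by
  rintro rfl
  simp at hw

/-! ### Limits of products -/

/-- The hypothesis `hlim` is continuous convergence of e_t to the identity. Evaluating at moving
points lets q and z vary together, which later yields locally uniform convergence. -/
theorem tendsto_log_comp {T : Type*} {l : Filter T} {e : T → ℂ → ℂ}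
    (hlim : ∀ (u : T → ℂ) (u₀ : ℂ), Tendsto u l (𝓝 u₀) → Tendsto (fun t => e t (u t)) l (𝓝 u₀))
    {u : T → ℂ} {u₀ : ℂ} (hu : Tendsto u l (𝓝 u₀)) (h0 : u₀ ∈ Complex.slitPlane) :
    Tendsto (fun t => Complex.log (e t (u t))) l (𝓝 (Complex.log u₀)) :=
  (hlim u u₀ hu).clog h0

theorem natCast_succ_add_mem_slitPlane (i j : ℕ) : ((i + 1 : ℕ) : ℂ) + j ∈ Complex.slitPlane := by
  left
  rw [Complex.add_re, Complex.natCast_re, Complex.natCast_re]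
  positivity

theorem tendsto_fwdDiff_log {T : Type*} {l : Filter T} {e : T → ℂ → ℂ}
    (hlim : ∀ (u : T → ℂ) (u₀ : ℂ), Tendsto u l (𝓝 u₀) → Tendsto (fun t => e t (u t)) l (𝓝 u₀))
    (i j : ℕ) :
    Tendsto (fun t => (fwdDiff (1 : ℂ))^[j] (fun w => Complex.log (e t w)) ((i + 1 : ℕ) : ℂ)) l
      (𝓝 ((fwdDiff (1 : ℂ))^[j] (fun w => Complex.log w) ((i + 1 : ℕ) : ℂ))) := by
  simp only [fwdDiff_iter_eq_sum_shift]
  refine tendsto_finsetSum _ fun k _ => Tendsto.const_smul ?_ _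
  rw [nsmul_eq_mul, mul_one]
  exact tendsto_log_comp hlim tendsto_const_nhds (natCast_succ_add_mem_slitPlane i k)

theorem tendsto_mgTerm {T : Type*} {l : Filter T} {e : T → ℂ → ℂ}
    (hlim : ∀ (u : T → ℂ) (u₀ : ℂ), Tendsto u l (𝓝 u₀) → Tendsto (fun t => e t (u t)) l (𝓝 u₀))
    {z : T → ℂ} {z₀ : ℂ} (hz : Tendsto z l (𝓝 z₀)) (n i : ℕ)
    (h0 : z₀ + ((i + 1 : ℕ) : ℂ) ∈ Complex.slitPlane) :
    Tendsto (fun t => mgTerm (e t) n i (z t)) l (𝓝 (mgTerm id n i z₀)) := by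
  unfold mgTerm newtonRem
  refine Tendsto.const_mul _ (Tendsto.sub ?_ (tendsto_finsetSum _ fun j _ => Tendsto.mul ?_ ?_))
  · rw [add_comm] at h0
    exact tendsto_log_comp hlim (tendsto_const_nhds.add hz) h0
  · exact ((continuous_cbinom j).tendsto z₀).comp hz
  · exact tendsto_fwdDiff_log hlim i j

theorem tendsto_mgFactor {T : Type*} {l : Filter T} {e : T → ℂ → ℂ}
    (hlim : ∀ (u : T → ℂ) (u₀ : ℂ), Tendsto u l (𝓝 u₀) → Tendsto (fun t => e t (u t)) l (𝓝 u₀))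
    {z : T → ℂ} {z₀ : ℂ} (hz : Tendsto z l (𝓝 z₀)) (n i : ℕ)
    (h0 : z₀ + ((i + 1 : ℕ) : ℂ) ≠ 0) :
    Tendsto (fun t => mgFactor (e t) n i (z t)) l (𝓝 (mgFactor id n i z₀)) := by
  have h1 : ((i + 1 : ℕ) : ℂ) ≠ 0 := by exact_mod_cast i.succ_ne_zero
  unfold mgFactor
  refine Tendsto.mul (Tendsto.zpow₀ (Tendsto.div ?_ ?_ h1) _ (Or.inl (div_ne_zero h0 h1)))
    (Tendsto.cexp (Tendsto.const_mul _ (tendsto_finsetSum _ fun j _ => Tendsto.mul ?_ ?_)))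
  · exact hlim _ _ (hz.add_const _)
  · exact hlim _ _ tendsto_const_nhds
  · exact ((continuous_cbinom _).tendsto z₀).comp hz
  · exact tendsto_fwdDiff_log hlim i _

/-- The first K factors are treated as meromorphic functions, since their logarithms may be singular
near the limit point. The other factors are evaluated in the right half plane, where the logarithms
form a dominated series. -/
theorem tendsto_mgProd {T : Type*} {l : Filter T} {e : T → ℂ → ℂ}
    (hlog : ∀ᶠ t in l, LogLike (fun w => Complex.log (e t w)))
    (hne : ∀ᶠ t in l, ∀ w : ℂ, 0 < w.re → e t w ≠ 0)
    (hlim : ∀ (u : T → ℂ) (u₀ : ℂ), Tendsto u l (𝓝 u₀) → Tendsto (fun t => e t (u t)) l (𝓝 u₀))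
    {z : T → ℂ} {z₀ : ℂ} (hz : Tendsto z l (𝓝 z₀)) (n : ℕ) (h0 : z₀ ∈ complNegInt) :
    Tendsto (fun t => mgProd (e t) n (z t)) l (𝓝 (mgProd id n z₀)) := by
  set ρ : ℝ := max (‖z₀‖ + 1) ((n + 1 : ℕ) : ℝ)
  have hρ0 : ‖z₀‖ < ρ := lt_max_of_lt_left (by linarith)
  obtain ⟨C, hC⟩ := exists_mgTerm_bound n ρ (le_max_right _ _)
  obtain ⟨K, hK⟩ := exists_nat_gt (2 * ρ)
  have hzρ : ∀ᶠ t in l, ‖z t‖ ≤ ρ := (hz.norm.eventually_lt_const hρ0).mono fun t ht => ht.le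
  rw [mgProd_eq logLike_log_id id_ne_zero_of_re_pos n hρ0.le hK]
  have hmain : Tendsto (fun t => (∏ i ∈ Finset.range K, mgFactor (e t) n i (z t)) *
        Complex.exp (∑' i, mgTerm (e t) n (i + K) (z t))) l
      (𝓝 ((∏ i ∈ Finset.range K, mgFactor id n i z₀) *
        Complex.exp (∑' i, mgTerm id n (i + K) z₀))) := by
    refine Tendsto.mul (tendsto_finsetProd _ fun i _ => tendsto_mgFactor hlim hz n i ?_)
      (Tendsto.cexp ?_)
    · intro h
      exact h0 i (by push_cast at h; linear_combination h)
    · refine tendsto_tsum_of_dominated_convergence (summable_inv_sq_shift C K) (fun i => ?_) ?_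
      · exact tendsto_mgTerm hlim hz n (i + K) (Or.inl (re_add_natCast_pos hρ0.le hK))
      · filter_upwards [hlog, hzρ] with t ht1 ht2 i
        refine hC (e t) ht1 (i + K) (z t) (hK.trans_le ?_) ht2
        exact_mod_cast (by omega : K ≤ i + K + 1)
  refine hmain.congr' ?_
  filter_upwards [hlog, hne, hzρ] with t ht1 ht2 ht3
  exact (mgProd_eq ht1 ht2 n ht3 hK).symm

/-! ### The classical functions -/

/-- The holomorphic branch of `log G_{n+1}(z+1)` on the cut plane. -/
def mgLog (n : ℕ) (z : ℂ) : ℂ := ∑' i, mgTerm id n i z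

theorem cutPlane_add_natCast {z : ℂ} (hz : z ∈ cutPlane) (i : ℕ) :
    z + ((i + 1 : ℕ) : ℂ) ∈ Complex.slitPlane := by
  have hz' : z + 1 ∈ Complex.slitPlane := hz
  rw [Complex.mem_slitPlane_iff] at hz' ⊢
  simp only [Complex.add_re, Complex.one_re, Complex.add_im, Complex.one_im, Complex.natCast_re,
    Complex.natCast_im, add_zero] at hz' ⊢
  refine hz'.imp (fun h => ?_) id
  push_cast
  have : (0 : ℝ) ≤ i := Nat.cast_nonneg i
  linarith

theorem isOpen_cutPlane : IsOpen cutPlane :=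
  Complex.isOpen_slitPlane.preimage (continuous_id.add continuous_const)

theorem exp_mgLog (n : ℕ) {z : ℂ} (hz : z ∈ cutPlane) :
    Complex.exp (mgLog n z) = mgProd id n z := by
  have h1 := (summable_mgTerm logLike_log_id n z).hasSum.cexp
  refine (HasProd.tprod_eq ?_).symm
  refine h1.congr_fun ?_
  intro i
  refine (exp_mgTerm (Complex.slitPlane_ne_zero (cutPlane_add_natCast hz i)) ?_).symm
  exact id_ne_zero_of_re_pos _ (by rw [Complex.natCast_re]; positivity)

theorem mgLog_zero (n : ℕ) : mgLog n 0 = 0 := by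
  simp [mgLog, mgTerm, newtonRem_zero]

theorem differentiableAt_mgTerm {n i : ℕ} {z : ℂ}
    (hz : z + ((i + 1 : ℕ) : ℂ) ∈ Complex.slitPlane) :
    DifferentiableAt ℂ (mgTerm id n i) z := by
  unfold mgTerm newtonRem
  refine DifferentiableAt.const_mul (DifferentiableAt.sub ?_ (DifferentiableAt.fun_sum
    fun j _ => ((differentiable_cbinom j) z).mul_const _)) _
  rw [add_comm] at hz
  exact DifferentiableAt.clog (by fun_prop) hz

theorem differentiableOn_tsum_mgTerm (n : ℕ) {ρ : ℝ} (hn : ((n + 1 : ℕ) : ℝ) ≤ ρ) {K : ℕ}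
    (hK : 2 * ρ < K) :
    DifferentiableOn ℂ (fun z => ∑' i, mgTerm id n (i + K) z) (Metric.ball 0 ρ) := by
  obtain ⟨C, hC⟩ := exists_mgTerm_bound n ρ hn
  refine Complex.differentiableOn_tsum_of_summable_norm (summable_inv_sq_shift C K) (fun i z hz => ?_)
    Metric.isOpen_ball fun i z hz => ?_
  · have hz' : ‖z‖ ≤ ρ := (mem_ball_zero_iff.1 hz).le
    exact (differentiableAt_mgTerm (Or.inl (re_add_natCast_pos hz' hK))).differentiableWithinAt
  · refine hC id logLike_log_id (i + K) z (hK.trans_le ?_) (mem_ball_zero_iff.1 hz).le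
    exact_mod_cast (by omega : K ≤ i + K + 1)

theorem differentiableOn_mgLog (n : ℕ) : DifferentiableOn ℂ (mgLog n) cutPlane := by
  intro z hz
  set ρ : ℝ := max (‖z‖ + 1) ((n + 1 : ℕ) : ℝ)
  have hρ0 : ‖z‖ < ρ := lt_max_of_lt_left (by linarith)
  obtain ⟨K, hK⟩ := exists_nat_gt (2 * ρ)
  have h1 : mgLog n = fun z => (∑ i ∈ Finset.range K, mgTerm id n i z) +
      ∑' i, mgTerm id n (i + K) z :=
    funext fun z => ((summable_mgTerm logLike_log_id n z).sum_add_tsum_nat_add K).symm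
  rw [h1]
  refine DifferentiableAt.differentiableWithinAt (DifferentiableAt.add
    (DifferentiableAt.fun_sum fun i _ => differentiableAt_mgTerm (cutPlane_add_natCast hz i)) ?_)
  exact (differentiableOn_tsum_mgTerm n (le_max_right _ _) hK).differentiableAt
    (Metric.isOpen_ball.mem_nhds (by simp))

/-- Near any point the product is a nonvanishing analytic function times finitely many integer
powers of z + i + 1. -/
theorem meromorphicNFAt_mgProd (n : ℕ) (z₀ : ℂ) : MeromorphicNFAt (mgProd id n) z₀ := by
  set ρ : ℝ := max (‖z₀‖ + 1) ((n + 1 : ℕ) : ℝ)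
  have hρ0 : ‖z₀‖ < ρ := lt_max_of_lt_left (by linarith)
  obtain ⟨K, hK⟩ := exists_nat_gt (2 * ρ)
  have hnhds : Metric.ball (0 : ℂ) ρ ∈ 𝓝 z₀ := Metric.isOpen_ball.mem_nhds (mem_ball_zero_iff.2 hρ0)
  set P : ℂ → ℂ := fun z => ∏ i ∈ Finset.range K, (z + ((i + 1 : ℕ) : ℂ)) ^ mgExponent n i
  set Q : ℂ → ℂ := fun z => (∏ i ∈ Finset.range K, ((((i + 1 : ℕ) : ℂ) ^ mgExponent n i)⁻¹ *
      Complex.exp (-(mgExponent n i : ℂ) * ∑ j ∈ Finset.range (n + 1), cbinom z (j + 1) *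
        (fwdDiff (1 : ℂ))^[j + 1] (fun w => Complex.log (id w)) ((i + 1 : ℕ) : ℂ)))) *
      Complex.exp (∑' i, mgTerm id n (i + K) z)
  have hPQ : mgProd id n =ᶠ[𝓝 z₀] Q * P := by
    filter_upwards [hnhds] with z hz
    rw [mgProd_eq logLike_log_id id_ne_zero_of_re_pos n (mem_ball_zero_iff.1 hz).le hK]
    have h1 : ∀ i, mgFactor id n i z = ((((i + 1 : ℕ) : ℂ) ^ mgExponent n i)⁻¹ *
        Complex.exp (-(mgExponent n i : ℂ) * ∑ j ∈ Finset.range (n + 1), cbinom z (j + 1) *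
        (fwdDiff (1 : ℂ))^[j + 1] (fun w => Complex.log (id w)) ((i + 1 : ℕ) : ℂ))) *
        (z + ((i + 1 : ℕ) : ℂ)) ^ mgExponent n i := by
      intro i
      rw [mgFactor, id, id, div_zpow, div_eq_mul_inv]
      ring
    simp only [h1, P, Q, Pi.mul_apply]
    rw [Finset.prod_mul_distrib]
    ring
  have hQd : AnalyticAt ℂ Q z₀ := by
    have hd : DifferentiableOn ℂ Q (Metric.ball 0 ρ) := by
      refine DifferentiableOn.mul (DifferentiableOn.fun_finsetProd fun i _ => ?_)
        (differentiableOn_tsum_mgTerm n (le_max_right _ _) hK).cexp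
      refine Differentiable.differentiableOn (Differentiable.const_mul (Differentiable.cexp
        (Differentiable.const_mul (Differentiable.fun_sum fun j _ =>
          (differentiable_cbinom (j + 1)).mul_const _) _)) _)
    exact hd.analyticAt hnhds
  have hQ0 : Q z₀ ≠ 0 := by
    refine mul_ne_zero (Finset.prod_ne_zero_iff.2 fun i _ => mul_ne_zero (inv_ne_zero
      (zpow_ne_zero _ ?_)) (Complex.exp_ne_zero _)) (Complex.exp_ne_zero _)
    exact_mod_cast i.succ_ne_zero
  rw [meromorphicNFAt_congr hPQ, meromorphicNFAt_mul_iff_right hQd hQ0]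
  refine meromorphicNFAt_fun_prod (fun i _ => ?_) ?_
  · refine MeromorphicNFAt.zpow (f := fun z => z + ((i + 1 : ℕ) : ℂ)) ?_
    exact AnalyticAt.meromorphicNFAt (by fun_prop)
  -- Normal form survives the product because two different linear factors cannot vanish at the same
  -- point.
  · rintro i ⟨-, hi⟩ j ⟨-, hj⟩
    have h1 := eq_zero_of_zpow_eq_zero hi
    have h2 := eq_zero_of_zpow_eq_zero hj
    have h3 : ((i + 1 : ℕ) : ℂ) = ((j + 1 : ℕ) : ℂ) := by linear_combination h1 - h2
    have := Nat.cast_injective h3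
    omega

/-! ### Summation by parts -/

theorem norm_fwdDiff_le_geometric {q C : ℝ} (hq0 : 0 < q) (hq1 : q < 1) {H : ℕ → ℂ}
    (hH : ∀ i, ‖H i‖ ≤ C * q ^ i) (i : ℕ) : ‖fwdDiff 1 H i‖ ≤ 2 * C * q ^ i := by
  have hC : 0 ≤ C := by simpa using (norm_nonneg _).trans (hH 0)
  refine (norm_sub_le _ _).trans ?_
  have h1 := hH (i + 1)
  have h2 := hH i
  have h3 : C * q ^ (i + 1) ≤ C * q ^ i := by
    gcongr 1
    exact pow_le_pow_of_le_one hq0.le hq1.le (Nat.le_succ i)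
  linarith

theorem summable_mgExponent_mul {q C : ℝ} (hq0 : 0 < q) (hq1 : q < 1) {H : ℕ → ℂ}
    (hH : ∀ i, ‖H i‖ ≤ C * q ^ i) (n : ℕ) : Summable fun i => (mgExponent n i : ℂ) * H i := by
  have h1 := (summable_nat_add_iff 1).2 (summable_pow_mul_geometric_of_norm_lt_one n
    (r := q) (by rwa [Real.norm_of_nonneg hq0.le]))
  refine Summable.of_norm_bounded (h1.mul_left (((n + 1 : ℕ) : ℝ) ^ n * (C / q))) fun i => ?_
  rw [norm_mul]
  calc _ ≤ (((n + 1 : ℕ) : ℝ) ^ n * ((i + 1 : ℕ) : ℝ) ^ n) * (C * q ^ i) :=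
        mul_le_mul (norm_mgExponent_le n i) (hH i) (norm_nonneg _) (by positivity)
    _ = _ := by
        rw [pow_succ]
        field_simp

theorem hasSum_succ_sub {u : ℕ → ℂ} (hu : Summable u) : HasSum (fun i => u (i + 1) - u i) (-u 0) := by
  have h1 := ((summable_nat_add_iff 1).2 hu).hasSum.sub hu.hasSum
  rw [hu.tsum_eq_zero_add] at h1
  simpa using h1

theorem mgExponent_succ_zero (n : ℕ) : mgExponent (n + 1) 0 + mgExponent n 0 = 0 := by
  rw [mgExponent_zero_right, mgExponent_zero_right]
  ring

/-- With a the exponents, the summand is u(i+1) - u(i) for u(i) = (a_{n+1,i} + a_{n,i}) H(i). The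
boundary term vanishes because a_{n+1,0} = -a_{n,0}, so each difference of H trades against lowering
n by one. -/
theorem hasSum_mgExponent_succ {q C : ℝ} (hq0 : 0 < q) (hq1 : q < 1) {H : ℕ → ℂ}
    (hH : ∀ i, ‖H i‖ ≤ C * q ^ i) (n : ℕ) :
    HasSum (fun i => (mgExponent (n + 1) i : ℂ) * fwdDiff 1 H i - (mgExponent n i : ℂ) * H i) 0 := by
  have h := hasSum_succ_sub (u := fun i => (mgExponent (n + 1) i : ℂ) * H i + (mgExponent n i : ℂ) * H i)
    ((summable_mgExponent_mul hq0 hq1 hH _).add (summable_mgExponent_mul hq0 hq1 hH _))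
  have h0 : ((mgExponent (n + 1) 0 : ℤ) : ℂ) + (mgExponent n 0 : ℤ) = 0 := by
    exact_mod_cast mgExponent_succ_zero n
  rw [← add_mul, h0, zero_mul, neg_zero] at h
  refine h.congr_fun ?_
  intro i
  have h1 : ((mgExponent (n + 1) i : ℤ) : ℂ) - (mgExponent (n + 1) (i + 1) : ℤ) =
      (mgExponent n (i + 1) : ℤ) := by exact_mod_cast mgExponent_succ n i
  rw [← h1, fwdDiff]
  ring

theorem hasSum_mgExponent_sub {q C : ℝ} (hq0 : 0 < q) (hq1 : q < 1) {H : ℕ → ℂ}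
    (hH : ∀ i, ‖H i‖ ≤ C * q ^ i) {n j : ℕ} (hj : j ≤ n) :
    HasSum (fun i => (mgExponent n i : ℂ) * (fwdDiff 1)^[j] H i -
      (mgExponent (n - j) i : ℂ) * H i) 0 := by
  induction j generalizing H C with
  | zero => simp
  | succ j ih =>
    have h1 := ih (norm_fwdDiff_le_geometric hq0 hq1 hH) (by omega)
    have h2 := hasSum_mgExponent_succ hq0 hq1 hH (n - (j + 1))
    rw [show n - (j + 1) + 1 = n - j by omega] at h2
    have h3 := h1.add h2
    rw [add_zero] at h3
    refine h3.congr_fun fun i => ?_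
    rw [Function.iterate_succ_apply]
    ring

/-- After n trades the exponents have become the constant -1. One more difference then telescopes
and leaves the only boundary term. -/
theorem hasSum_mgExponent_iterate_succ {q C : ℝ} (hq0 : 0 < q) (hq1 : q < 1) {H : ℕ → ℂ}
    (hH : ∀ i, ‖H i‖ ≤ C * q ^ i) (n : ℕ) :
    HasSum (fun i => (mgExponent n i : ℂ) * (fwdDiff 1)^[n + 1] H i) (H 0) := by
  have h1 := hasSum_mgExponent_sub hq0 hq1 (norm_fwdDiff_le_geometric hq0 hq1 hH) le_rfl (n := n)
  have hs : Summable H := by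
    refine Summable.of_norm_bounded ((summable_geometric_of_lt_one hq0.le hq1).mul_left C) hH
  have h2 := h1.sub (hasSum_succ_sub hs)
  rw [zero_sub, neg_neg] at h2
  refine h2.congr_fun fun i => ?_
  rw [Function.iterate_succ_apply, Nat.sub_self, mgExponent_zero_left, fwdDiff]
  push_cast
  ring

/-! ### The multiple `q`-gamma function as a product -/

/-- The `q`-number `[w]_q`. -/
def qNumber (q : ℝ) (w : ℂ) : ℂ := (1 - (q : ℂ) ^ w) / (1 - (q : ℂ))

section

variable {q : ℝ}

theorem one_sub_ofReal_pos_ne (hq1 : q < 1) : (1 : ℂ) - (q : ℂ) ≠ 0 := by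
  rw [sub_ne_zero]
  exact_mod_cast hq1.ne'

theorem norm_cpow_lt_one (hq0 : 0 < q) (hq1 : q < 1) {w : ℂ} (hw : 0 < w.re) :
    ‖(q : ℂ) ^ w‖ < 1 := by
  rw [Complex.norm_cpow_eq_rpow_re_of_pos hq0]
  exact Real.rpow_lt_one hq0.le hq1 hw

theorem qNumber_mem_slitPlane (hq0 : 0 < q) (hq1 : q < 1) {w : ℂ} (hw : 0 < w.re) :
    qNumber q w ∈ Complex.slitPlane := by
  have h1 := norm_cpow_lt_one hq0 hq1 hw
  have h2 := Complex.re_le_norm ((q : ℂ) ^ w)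
  left
  rw [qNumber, show (1 : ℂ) - (q : ℂ) = ((1 - q : ℝ) : ℂ) by push_cast; rfl, Complex.div_ofReal_re]
  refine div_pos ?_ (by linarith)
  rw [Complex.sub_re, Complex.one_re]
  linarith

theorem qNumber_ne_zero (hq0 : 0 < q) (hq1 : q < 1) (w : ℂ) (hw : 0 < w.re) : qNumber q w ≠ 0 :=
  Complex.slitPlane_ne_zero (qNumber_mem_slitPlane hq0 hq1 hw)

/-- With y = |q^w| = q^(Re w), the derivative is at most y (-log q) / (1 - y). The bound 1 / Re w
then reads -y log y ≤ 1 - y, which is log y ≥ 1 - 1/y. -/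
theorem logLike_qNumber (hq0 : 0 < q) (hq1 : q < 1) :
    LogLike (fun w => Complex.log (qNumber q w)) := by
  intro w hw
  have hqc : (q : ℂ) ≠ 0 := by exact_mod_cast hq0.ne'
  have h1 : HasDerivAt (fun w : ℂ => (q : ℂ) ^ w) ((q : ℂ) ^ w * Complex.log q * 1) w :=
    (hasDerivAt_id w).const_cpow (Or.inl hqc)
  have h2 := ((h1.const_sub 1).div_const (1 - (q : ℂ))).clog (qNumber_mem_slitPlane hq0 hq1 hw)
  refine ⟨_, h2, ?_⟩
  have hne := one_sub_ofReal_pos_ne hq1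
  have hlt := norm_cpow_lt_one hq0 hq1 hw
  set y := ‖(q : ℂ) ^ w‖ with hy
  have hy0 : 0 < y := by
    rw [hy, Complex.norm_cpow_eq_rpow_re_of_pos hq0]
    exact Real.rpow_pos_of_pos hq0 _
  have h3 : 1 - y ≤ ‖1 - (q : ℂ) ^ w‖ := by
    have := norm_sub_norm_le (1 : ℂ) ((q : ℂ) ^ w)
    rwa [norm_one] at this
  have h4 : Real.log y = w.re * Real.log q := by
    rw [hy, Complex.norm_cpow_eq_rpow_re_of_pos hq0, Real.log_rpow hq0]
  have hlogq : Real.log q < 0 := Real.log_neg hq0 hq1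
  have h5 : 1 - y⁻¹ ≤ Real.log y := Real.one_sub_inv_le_log_of_pos hy0
  have h6 : ‖Complex.log (q : ℂ)‖ = -Real.log q := by
    rw [← Complex.ofReal_log hq0.le, Complex.norm_real, Real.norm_of_nonpos hlogq.le]
  rw [mul_one, div_div_div_cancel_right₀ hne, norm_div, norm_neg, norm_mul, h6,
    div_le_div_iff₀ (by linarith) hw]
  have h7 : y * (1 - y⁻¹) ≤ y * (w.re * Real.log q) := by
    rw [← h4]; gcongr
  rw [mul_sub, mul_inv_cancel₀ hy0.ne'] at h7
  nlinarith

/-- Write [u]_q as (exp(u log q) - 1) / log q times log q / (q - 1). The second factor tends to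
log'(1) = 1. The first differs from u by at most |u|^2 |log q| once |u log q| ≤ 1. -/
theorem tendsto_qNumber {T : Type*} {l : Filter T} {q : T → ℝ} (hq : Tendsto q l (𝓝[<] (1 : ℝ)))
    (hq0 : ∀ᶠ t in l, 0 < q t) (u : T → ℂ) (u₀ : ℂ) (hu : Tendsto u l (𝓝 u₀)) :
    Tendsto (fun t => qNumber (q t) (u t)) l (𝓝 u₀) := by
  have hq1 : ∀ᶠ t in l, q t < 1 := hq.eventually self_mem_nhdsWithin
  have hqn : Tendsto q l (𝓝 1) := hq.mono_right nhdsWithin_le_nhds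
  have hs : Tendsto (fun t => Real.log (q t)) l (𝓝 0) := by
    have := (Real.continuousAt_log one_ne_zero).tendsto.comp hqn
    rwa [Real.log_one] at this
  have hA : Tendsto (fun t => (((q t - 1)⁻¹ * Real.log (q t) : ℝ) : ℂ)) l (𝓝 1) := by
    have h1 := (hasDerivAt_iff_tendsto_slope.1 (Real.hasDerivAt_log one_ne_zero))
    have h2 : Tendsto q l (𝓝[≠] (1 : ℝ)) :=
      hq.mono_right (nhdsWithin_mono _ fun x hx => ne_of_lt hx)
    have h3 := h1.comp h2
    rw [inv_one] at h3
    have h4 := (Complex.continuous_ofReal.tendsto 1).comp h3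
    rw [Complex.ofReal_one] at h4
    refine h4.congr fun t => ?_
    simp [slope_def_field, div_eq_inv_mul]
  have hB : Tendsto (fun t => (Complex.exp (u t * Real.log (q t)) - 1) / Real.log (q t)) l (𝓝 u₀) := by
    have hx : Tendsto (fun t => u t * (Real.log (q t) : ℂ)) l (𝓝 0) := by
      have := hu.mul ((Complex.continuous_ofReal.tendsto 0).comp hs)
      simpa using this
    have hb : Tendsto (fun t => ‖u t‖ ^ 2 * ‖(Real.log (q t) : ℂ)‖) l (𝓝 0) := by
      have := (hu.norm.pow 2).mul ((Complex.continuous_ofReal.tendsto 0).comp hs).norm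
      simpa using this
    have hd : Tendsto (fun t => (Complex.exp (u t * Real.log (q t)) - 1) / Real.log (q t) - u t) l
        (𝓝 0) := by
      refine squeeze_zero_norm' ?_ hb
      have hx1 : ∀ᶠ t in l, ‖u t * (Real.log (q t) : ℂ)‖ ≤ 1 := by
        have := hx.norm
        rw [norm_zero] at this
        exact (this.eventually_lt_const zero_lt_one).mono fun t ht => ht.le
      filter_upwards [hx1, hq0, hq1] with t h1 h2 h3
      have hl : (Real.log (q t) : ℂ) ≠ 0 := by exact_mod_cast (Real.log_neg h2 h3).ne
      have h4 := Complex.norm_exp_sub_one_sub_id_le h1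
      rw [show (Complex.exp (u t * Real.log (q t)) - 1) / Real.log (q t) - u t =
        (Complex.exp (u t * Real.log (q t)) - 1 - u t * Real.log (q t)) / Real.log (q t) by
          field_simp, norm_div, div_le_iff₀ (norm_pos_iff.2 hl)]
      refine h4.trans (le_of_eq ?_)
      rw [norm_mul]
      ring
    simpa using hd.add hu
  have hAB := hB.mul hA
  rw [mul_one] at hAB
  refine hAB.congr' ?_
  filter_upwards [hq0, hq1] with t h2 h3
  have hl : (Real.log (q t) : ℂ) ≠ 0 := by exact_mod_cast (Real.log_neg h2 h3).ne
  have hne := one_sub_ofReal_pos_ne h3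
  have hne' : (q t : ℂ) - 1 ≠ 0 := by
    rw [← neg_sub]; exact neg_ne_zero.2 hne
  rw [qNumber, Complex.cpow_def_of_ne_zero (by exact_mod_cast h2.ne'), ← Complex.ofReal_log h2.le,
    mul_comm (u t)]
  push_cast
  field_simp
  ring

theorem log_qNumber_natCast (hq0 : 0 < q) (hq1 : q < 1) (i : ℕ) :
    Complex.log (qNumber q ((i + 1 : ℕ) : ℂ)) =
      (Real.log (1 - q ^ (i + 1)) : ℂ) - Real.log (1 - q) := by
  have h1 : 0 < 1 - q ^ (i + 1) := sub_pos.2 (pow_lt_one₀ hq0.le hq1 i.succ_ne_zero)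
  have h2 : 0 < 1 - q := by linarith
  have h3 : qNumber q ((i + 1 : ℕ) : ℂ) = (((1 - q ^ (i + 1)) / (1 - q) : ℝ) : ℂ) := by
    rw [qNumber, Complex.cpow_natCast]
    push_cast
    rfl
  rw [h3, ← Complex.ofReal_log (by positivity), Real.log_div h1.ne' h2.ne']
  push_cast
  rfl

theorem fwdDiff_log_qNumber (hq0 : 0 < q) (hq1 : q < 1) (i j : ℕ) :
    (fwdDiff (1 : ℂ))^[j + 1] (fun w => Complex.log (qNumber q w)) ((i + 1 : ℕ) : ℂ) =
      (fwdDiff 1)^[j + 1] (fun i : ℕ => (Real.log (1 - q ^ (i + 1)) : ℂ)) i := by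
  have h1 : (fwdDiff (1 : ℂ))^[j + 1] (fun w => Complex.log (qNumber q w)) ((i + 1 : ℕ) : ℂ) =
      (fwdDiff 1)^[j + 1] (fun i : ℕ => (Real.log (1 - q ^ (i + 1)) : ℂ) - Real.log (1 - q)) i := by
    rw [fwdDiff_iter_eq_sum_shift, fwdDiff_iter_eq_sum_shift]
    refine Finset.sum_congr rfl fun k _ => ?_
    rw [← log_qNumber_natCast hq0 hq1]
    congr 4
    simp
    ring
  have h2 : fwdDiff 1 (fun i : ℕ => (Real.log (1 - q ^ (i + 1)) : ℂ) - Real.log (1 - q)) =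
      fwdDiff 1 (fun i : ℕ => (Real.log (1 - q ^ (i + 1)) : ℂ)) := by
    funext i
    simp [fwdDiff]
  rw [h1, Function.iterate_succ_apply, Function.iterate_succ_apply, h2]

theorem norm_log_one_sub_pow_le (hq0 : 0 < q) (hq1 : q < 1) (i : ℕ) :
    ‖(Real.log (1 - q ^ (i + 1)) : ℂ)‖ ≤ q / (1 - q) * q ^ i := by
  have h0 : q ^ (i + 1) ≤ q := by
    rw [pow_succ]
    exact mul_le_of_le_one_left hq0.le (pow_le_one₀ hq0.le hq1.le)
  have h1 : 0 < 1 - q ^ (i + 1) := by linarith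
  have hp : 0 < q ^ (i + 1) := pow_pos hq0 _
  have h2 := Real.one_sub_inv_le_log_of_pos h1
  have h3 : Real.log (1 - q ^ (i + 1)) ≤ 0 := Real.log_nonpos h1.le (by linarith)
  rw [Complex.norm_real, Real.norm_of_nonpos h3]
  have h4 : -(1 - (1 - q ^ (i + 1))⁻¹) = q ^ (i + 1) / (1 - q ^ (i + 1)) := by
    field_simp
    simp
  calc _ ≤ -(1 - (1 - q ^ (i + 1))⁻¹) := by linarith
    _ ≤ q ^ (i + 1) / (1 - q) := by
        rw [h4]
        gcongr
    _ = _ := by rw [pow_succ]; ring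

/-- Vandermonde's identity for binom(z + (-(i+1)), n), with the term binom(z, 0) cancelled. -/
theorem cbinom_sub_sub_cbinom (n i : ℕ) (z : ℂ) :
    cbinom (z - ((i + 1 : ℕ) : ℂ)) n - cbinom (-((i + 1 : ℕ) : ℂ)) n =
      -∑ j ∈ Finset.range n, cbinom z (j + 1) * (mgExponent (n - (j + 1)) i : ℂ) := by
  rw [sub_eq_add_neg z, cbinom_add, Finset.sum_range_succ']
  simp only [cbinom_zero_right, one_mul, Nat.sub_zero, add_sub_cancel_right, mgExponent_cast,
    mul_neg, Finset.sum_neg_distrib, neg_neg]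

theorem qMultipleGamma_eq_mgProd (hq0 : 0 < q) (hq1 : q < 1) (n : ℕ) (z : ℂ) :
    qMultipleGamma (n + 1) q (z + 1) = mgProd (qNumber q) n z := by
  set H : ℕ → ℂ := fun i => (Real.log (1 - q ^ (i + 1)) : ℂ)
  have hH : ∀ i, ‖H i‖ ≤ q / (1 - q) * q ^ i := norm_log_one_sub_pow_le hq0 hq1
  -- The logarithmic discrepancy between the factor in the definition and `mgFactor`. By summation
  -- by parts the differences of order at most n cancel against the Vandermonde terms, and order n +
  -- 1 leaves binom(z, n+1) log(1 - q), which cancels the prefactor.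
  set D : ℕ → ℂ := fun i => (cbinom (z - ((i + 1 : ℕ) : ℂ)) n - cbinom (-((i + 1 : ℕ) : ℂ)) n) * H i +
    (mgExponent n i : ℂ) * ∑ j ∈ Finset.range (n + 1), cbinom z (j + 1) * (fwdDiff 1)^[j + 1] H i
  have hD : HasSum D (cbinom z (n + 1) * H 0) := by
    have h1 : HasSum (fun i => ∑ j ∈ Finset.range n, cbinom z (j + 1) *
        ((mgExponent n i : ℂ) * (fwdDiff 1)^[j + 1] H i -
          (mgExponent (n - (j + 1)) i : ℂ) * H i)) 0 := by
      have := hasSum_sum (s := Finset.range n) (fun j hj => (hasSum_mgExponent_sub hq0 hq1 hH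
        (n := n) (j := j + 1) (by rw [Finset.mem_range] at hj; omega)).mul_left (cbinom z (j + 1)))
      simpa using this
    have h2 := h1.add ((hasSum_mgExponent_iterate_succ hq0 hq1 hH n).mul_left (cbinom z (n + 1)))
    rw [zero_add] at h2
    refine h2.congr_fun fun i => ?_
    simp only [D, cbinom_sub_sub_cbinom, Finset.sum_range_succ _ n, mul_sub, Finset.sum_sub_distrib,
      mul_add, neg_mul, Finset.sum_mul, Finset.mul_sum]
    have e1 : ∀ j, cbinom z (j + 1) * ((mgExponent n i : ℂ) * (fwdDiff 1)^[j + 1] H i) =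
      (mgExponent n i : ℂ) * (cbinom z (j + 1) * (fwdDiff 1)^[j + 1] H i) := fun j => by ring
    simp only [e1, mul_assoc]
    ring
  obtain ⟨K, hK⟩ := exists_nat_gt (2 * ‖z‖)
  have hprod := (hasProd_mgFactor (logLike_qNumber hq0 hq1) (qNumber_ne_zero hq0 hq1) n le_rfl
    hK).multipliable.hasProd.mul hD.cexp
  have hterm : ∀ i : ℕ, ((1 - (q : ℂ) ^ (((z + 1) - 1) + ((i + 1 : ℕ) : ℂ))) / (1 - (q : ℂ) ^ (i + 1))) ^
              (-Ring.choose (-((i + 1 : ℕ) : ℤ)) n) *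
            ((1 - q ^ (i + 1) : ℝ) : ℂ) ^
              (cbinom (((z + 1) - 1) - ((i + 1 : ℕ) : ℂ)) n - cbinom (-((i + 1 : ℕ) : ℂ)) n) =
      mgFactor (qNumber q) n i z * Complex.exp (D i) := by
    intro i
    have h1 : 0 < 1 - q ^ (i + 1) := sub_pos.2 (pow_lt_one₀ hq0.le hq1 i.succ_ne_zero)
    have h2 : qNumber q (z + ((i + 1 : ℕ) : ℂ)) / qNumber q ((i + 1 : ℕ) : ℂ) =
        (1 - (q : ℂ) ^ (z + ((i + 1 : ℕ) : ℂ))) / (1 - (q : ℂ) ^ (i + 1)) := by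
      rw [qNumber, qNumber, div_div_div_cancel_right₀ (one_sub_ofReal_pos_ne hq1),
        Complex.cpow_natCast]
    rw [add_sub_cancel_right, mgFactor, h2, mul_assoc, ← Complex.exp_add, ← mgExponent,
      Complex.cpow_def_of_ne_zero (x := ((1 - q ^ (i + 1) : ℝ) : ℂ)) (by exact_mod_cast h1.ne'),
      ← Complex.ofReal_log h1.le]
    simp only [fwdDiff_log_qNumber hq0 hq1]
    congr 2
    simp only [D, H]
    ring
  rw [qMultipleGamma]
  simp only [hterm]
  have h1 : 0 < 1 - q := by linarith
  rw [show (∏' i, mgFactor (qNumber q) n i z * Complex.exp (D i)) = _ from hprod.tprod_eq, mgProd, add_sub_cancel_right,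
    Complex.cpow_def_of_ne_zero (by exact_mod_cast h1.ne'), ← Complex.ofReal_log h1.le]
  have h3 : H 0 = (Real.log (1 - q) : ℂ) := by simp [H]
  rw [h3, mul_left_comm, ← Complex.exp_add]
  ring_nf
  simp

end

/-- The classical limit of the multiple `q`-gamma functions. -/
theorem tendstoUniformlyOn_qMultipleGamma (n : ℕ) {K : Set ℂ} (hK : IsCompact K)
    (hKs : K ⊆ complNegInt) :
    TendstoUniformlyOn (fun (q : ℝ) (z : ℂ) => qMultipleGamma (n + 1) q (z + 1))
      (fun z => mgProd id n z) (𝓝[<] (1 : ℝ)) K := by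
  rw [← tendstoLocallyUniformlyOn_iff_tendstoUniformlyOn_of_compact hK,
    tendstoLocallyUniformlyOn_iff_forall_tendsto]
  intro z₀ hz₀
  have hq : Tendsto (fun y : ℝ × ℂ => y.1) (𝓝[<] (1 : ℝ) ×ˢ 𝓝[K] z₀) (𝓝[<] (1 : ℝ)) := tendsto_fst
  have hz : Tendsto (fun y : ℝ × ℂ => y.2) (𝓝[<] (1 : ℝ) ×ˢ 𝓝[K] z₀) (𝓝 z₀) :=
    tendsto_snd.mono_right nhdsWithin_le_nhds
  have hq1 : ∀ᶠ y : ℝ × ℂ in 𝓝[<] (1 : ℝ) ×ˢ 𝓝[K] z₀, y.1 < 1 := hq.eventually self_mem_nhdsWithin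
  have hq0 : ∀ᶠ y : ℝ × ℂ in 𝓝[<] (1 : ℝ) ×ˢ 𝓝[K] z₀, 0 < y.1 :=
    hq.eventually (mem_nhdsWithin_of_mem_nhds (lt_mem_nhds zero_lt_one))
  have h1 : Tendsto (fun y : ℝ × ℂ => mgProd (qNumber y.1) n y.2) (𝓝[<] (1 : ℝ) ×ˢ 𝓝[K] z₀)
      (𝓝 (mgProd id n z₀)) := by
    refine tendsto_mgProd ?_ ?_ (tendsto_qNumber hq hq0) hz n (hKs hz₀)
    · filter_upwards [hq0, hq1] with y h0 h1 using logLike_qNumber h0 h1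
    · filter_upwards [hq0, hq1] with y h0 h1 using qNumber_ne_zero h0 h1
  have h2 : Tendsto (fun y : ℝ × ℂ => mgProd id n y.2) (𝓝[<] (1 : ℝ) ×ˢ 𝓝[K] z₀)
      (𝓝 (mgProd id n z₀)) :=
    tendsto_mgProd (e := fun _ => id) (Eventually.of_forall fun _ => logLike_log_id)
      (Eventually.of_forall fun _ => id_ne_zero_of_re_pos) (fun u u₀ hu => hu) hz n (hKs hz₀)
  have h3 : Tendsto (fun y : ℝ × ℂ => (mgProd id n y.2, qMultipleGamma (n + 1) y.1 (y.2 + 1)))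
      (𝓝[<] (1 : ℝ) ×ˢ 𝓝[K] z₀) (𝓝 (mgProd id n z₀, mgProd id n z₀)) := by
    refine h2.prodMk_nhds (h1.congr' ?_)
    filter_upwards [hq0, hq1] with y h0 h1 using (qMultipleGamma_eq_mgProd h0 h1 n y.2).symm
  exact h3.mono_right (nhds_le_uniformity _)

/-! ### The functional equation of the logarithms -/

theorem tsum_eq_neg_of_telescoping {v u : ℕ → ℂ} (hv : Summable v)
    (hu : ∀ i, v i = u (i + 1) - u i) (h0 : Tendsto u atTop (𝓝 0)) : ∑' i, v i = -u 0 := by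
  have h1 := hv.hasSum.tendsto_sum_nat
  have h2 : (fun N => ∑ i ∈ Finset.range N, v i) = fun N => u N - u 0 := by
    funext N
    simp only [hu]
    exact Finset.sum_range_sub u N
  rw [h2] at h1
  have h3 := h0.sub_const (u 0)
  rw [zero_sub] at h3
  exact tendsto_nhds_unique h1 h3

/-- Here the interpolation order is one less than in `mgTerm`, so these terms are only O(1/i). That
suffices for the boundary terms of the telescoping sums. -/
theorem tendsto_mgExponent_mul_newtonRem (n : ℕ) (z : ℂ) :
    Tendsto (fun i => (mgExponent n i : ℂ) * newtonRem n Complex.log z ((i + 1 : ℕ) : ℂ)) atTop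
      (𝓝 0) := by
  set ρ : ℝ := max ‖z‖ (n : ℝ)
  obtain ⟨C, hC, hb⟩ := exists_newtonRem_logLike_bound n ρ (le_max_right _ _)
  obtain ⟨K, hK⟩ := exists_nat_gt (2 * ρ)
  have h0 : Tendsto (fun i : ℕ => (((n + 1 : ℕ) : ℝ) ^ n * C) * (1 / ((i : ℝ) + 1))) atTop (𝓝 0) := by
    simpa using tendsto_one_div_add_atTop_nhds_zero_nat.const_mul (((n + 1 : ℕ) : ℝ) ^ n * C)
  refine squeeze_zero_norm' ?_ h0
  filter_upwards [eventually_ge_atTop K] with i hi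
  have hi' : 2 * ρ < ((i + 1 : ℕ) : ℝ) := hK.trans_le (by exact_mod_cast (by omega : K ≤ i + 1))
  have h := hb _ logLike_log ((i + 1 : ℕ) : ℝ) z hi' (le_max_left _ _)
  rw [Complex.ofReal_natCast] at h
  rw [norm_mul]
  calc _ ≤ (((n + 1 : ℕ) : ℝ) ^ n * ((i + 1 : ℕ) : ℝ) ^ n) * (C / ((i + 1 : ℕ) : ℝ) ^ (n + 1)) :=
        mul_le_mul (norm_mgExponent_le n i) h (norm_nonneg _) (by positivity)
    _ = _ := by
        rw [pow_succ]
        push_cast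
        field_simp

/-- A difference in z lowers the interpolation order and becomes a difference in the base point.
With the Pascal relation the summand telescopes; the boundary term at 0 vanishes since the two
exponents there are opposite. -/
theorem mgLog_add_one (n : ℕ) (z : ℂ) : mgLog (n + 1) (z + 1) - mgLog (n + 1) z = mgLog n z := by
  have s1 := summable_mgTerm logLike_log_id (n + 1) (z + 1)
  have s2 := summable_mgTerm logLike_log_id (n + 1) z
  have s3 := summable_mgTerm logLike_log_id n z
  rw [← sub_eq_zero, mgLog, mgLog, mgLog, ← s1.tsum_sub s2, ← (s1.sub s2).tsum_sub s3]
  have h0 : ((mgExponent (n + 1) 0 : ℤ) : ℂ) + (mgExponent n 0 : ℤ) = 0 := by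
    exact_mod_cast mgExponent_succ_zero n
  rw [tsum_eq_neg_of_telescoping ((s1.sub s2).sub s3)
    (u := fun i => (mgExponent (n + 1) i : ℂ) * newtonRem (n + 1) Complex.log z ((i + 1 : ℕ) : ℂ) +
      (mgExponent n i : ℂ) * newtonRem (n + 1) Complex.log z ((i + 1 : ℕ) : ℂ)) ?_ ?_]
  · rw [← add_mul, h0, zero_mul, neg_zero]
  · intro i
    have h1 : ((mgExponent (n + 1) i : ℤ) : ℂ) - (mgExponent (n + 1) (i + 1) : ℤ) =
      (mgExponent n (i + 1) : ℤ) := by exact_mod_cast mgExponent_succ n i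
    have h2 := newtonRem_add_one_sub (n + 1) Complex.log z ((i + 1 : ℕ) : ℂ)
    have h3 : (((i + 1 : ℕ) : ℂ) + 1) = ((i + 1 + 1 : ℕ) : ℂ) := by push_cast; ring
    rw [h3] at h2
    simp only [mgTerm, id]
    rw [← h1, ← mul_sub, h2]
    ring
  · have := (tendsto_mgExponent_mul_newtonRem (n + 1) z).add s3.tendsto_atTop_zero
    simpa [mgTerm] using this

theorem tendsto_log_add_sub_log (z : ℂ) :
    Tendsto (fun i : ℕ => Complex.log (((i + 1 : ℕ) : ℂ) + z) - Complex.log ((i + 1 : ℕ) : ℂ)) atTop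
      (𝓝 0) := by
  have := (tendsto_mgExponent_mul_newtonRem 0 z).neg
  simpa [newtonRem, mgExponent_zero_left] using this

theorem mgLog_zero_add_one (z : ℂ) : mgLog 0 (z + 1) - mgLog 0 z = Complex.log (z + 1) := by
  have s1 := summable_mgTerm logLike_log_id 0 (z + 1)
  have s2 := summable_mgTerm logLike_log_id 0 z
  rw [mgLog, mgLog, ← s1.tsum_sub s2]
  have h0 := (tendsto_log_add_sub_log z).neg
  rw [neg_zero] at h0
  rw [tsum_eq_neg_of_telescoping (s1.sub s2) ?_ h0]
  · simp [add_comm]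
  · intro i
    have h2 := newtonRem_add_one_sub 0 Complex.log z ((i + 1 : ℕ) : ℂ)
    have h3 : (((i + 1 : ℕ) : ℂ) + 1) = ((i + 1 + 1 : ℕ) : ℂ) := by push_cast; ring
    rw [h3] at h2
    simp only [mgTerm, id, mgExponent_zero_left]
    rw [← mul_sub, zero_add, h2]
    simp [newtonRem]
    ring

/-! ### The interpolation error of `mgLog` tends to zero -/

theorem newtonRem_tsum {T : ℕ → ℂ → ℂ} (hT : ∀ w, Summable fun i => T i w) (n : ℕ) (z x : ℂ) :
    newtonRem n (fun w => ∑' i, T i w) z x = ∑' i, newtonRem n (T i) z x := by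
  symm
  refine HasSum.tsum_eq ?_
  unfold newtonRem
  refine ((hT (x + z)).hasSum).sub (hasSum_sum fun j _ => HasSum.mul_left _ ?_)
  simp only [fwdDiff_iter_eq_sum_shift]
  exact hasSum_sum fun k _ => ((hT _).hasSum).const_smul _

/-- In its argument w the inner error is a translate of h minus a polynomial of degree at most n,
and that polynomial has no error. -/
theorem newtonRem_newtonRem (n : ℕ) (h : ℂ → ℂ) (z x y : ℂ) :
    newtonRem n (fun w => newtonRem n h w y) z x = newtonRem n h z (y + x) := by
  have h1 : (fun w => newtonRem n h w y) = fun w => h (y + w) -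
      (∑ j ∈ Finset.range (n + 1), binomPoly j *
        Polynomial.C ((fwdDiff (1 : ℂ))^[j] h y) : Polynomial ℂ).eval w := by
    funext w
    simp [newtonRem, Polynomial.eval_finsetSum, cbinom]
  rw [h1, newtonRem_sub, newtonRem_shift, newtonRem_poly, sub_zero]
  refine Polynomial.natDegree_sum_le_of_forall_le _ _ fun j hj => ?_
  refine (Polynomial.natDegree_mul_C_le _ _).trans ((natDegree_binomPoly_le j).trans ?_)
  simpa [Nat.lt_succ_iff] using hj

/-- Interpolating the series at N again shifts the base point of each term from i + 1 to N + i + 1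
while the exponent keeps its index i. Each term tends to 0 and the bound by C / (i+1)^2 persists.
This growth condition replaces convexity on the constructed side of the uniqueness argument. -/
theorem tendsto_newtonRem_mgLog (n : ℕ) (z : ℂ) :
    Tendsto (fun N : ℕ => newtonRem (n + 1) (mgLog n) z N) atTop (𝓝 0) := by
  set ρ : ℝ := max ‖z‖ ((n + 1 : ℕ) : ℝ)
  obtain ⟨C, hC, hb⟩ := exists_newtonRem_logLike_bound (n + 1) ρ (le_max_right _ _)
  obtain ⟨K, hK⟩ := exists_nat_gt (2 * ρ)
  have h1 : ∀ N : ℕ, newtonRem (n + 1) (mgLog n) z N =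
      ∑' i, (mgExponent n i : ℂ) * newtonRem (n + 1) Complex.log z ((N + i + 1 : ℕ) : ℂ) := by
    intro N
    have h2 := newtonRem_tsum (summable_mgTerm logLike_log_id n) (n + 1) z N
    refine h2.trans (tsum_congr fun i => ?_)
    unfold mgTerm
    rw [newtonRem_const_mul, newtonRem_newtonRem]
    congr 2
    push_cast
    ring
  simp only [h1]
  have hbd : ∀ N : ℕ, K ≤ N → ∀ i : ℕ,
      ‖newtonRem (n + 1) Complex.log z ((N + i + 1 : ℕ) : ℂ)‖ ≤ C / ((N + i + 1 : ℕ) : ℝ) ^ (n + 2) := by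
    intro N hN i
    have h := hb _ logLike_log ((N + i + 1 : ℕ) : ℝ) z (hK.trans_le
      (by exact_mod_cast (by omega : K ≤ N + i + 1))) (le_max_left _ _)
    rwa [Complex.ofReal_natCast] at h
  have hzero : (0 : ℂ) = ∑' _ : ℕ, (0 : ℂ) := by simp
  rw [hzero]
  refine tendsto_tsum_of_dominated_convergence (summable_inv_sq_shift (((n + 1 : ℕ) : ℝ) ^ n * C) 0)
    (fun i => ?_) ?_
  · have h2 : Tendsto (fun N : ℕ => C * (1 / ((N : ℝ) + 1))) atTop (𝓝 0) := by
      simpa using tendsto_one_div_add_atTop_nhds_zero_nat.const_mul C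
    have h3 : Tendsto (fun N : ℕ => newtonRem (n + 1) Complex.log z ((N + i + 1 : ℕ) : ℂ)) atTop
        (𝓝 0) := by
      refine squeeze_zero_norm' ?_ h2
      filter_upwards [eventually_ge_atTop K] with N hN
      refine (hbd N hN i).trans ?_
      rw [div_eq_mul_one_div]
      gcongr
      have h4 : (N : ℝ) + 1 ≤ ((N + i + 1 : ℕ) : ℝ) := by
        push_cast
        have : (0 : ℝ) ≤ i := Nat.cast_nonneg i
        linarith
      have h5 : (1 : ℝ) ≤ ((N + i + 1 : ℕ) : ℝ) := by
        exact_mod_cast (by omega : 1 ≤ N + i + 1)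
      exact h4.trans (le_self_pow₀ h5 (by omega))
    simpa using h3.const_mul (mgExponent n i : ℂ)
  · filter_upwards [eventually_ge_atTop K] with N hN i
    rw [norm_mul]
    calc _ ≤ (((n + 1 : ℕ) : ℝ) ^ n * ((i + 1 : ℕ) : ℝ) ^ n) *
          (C / ((i + 1 : ℕ) : ℝ) ^ (n + 2)) := by
          refine mul_le_mul (norm_mgExponent_le n i) ((hbd N hN i).trans ?_) (norm_nonneg _)
            (by positivity)
          gcongr
          omega
      _ = _ := by
          rw [pow_add, add_zero]
          field_simp

/-! ### Reality and positivity -/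

theorem cbinom_ofReal_im (x : ℝ) (k : ℕ) : (cbinom (x : ℂ) k).im = 0 := by
  rw [cbinom_eq_choose]
  have := Ring.map_choose Complex.ofRealHom x k
  simp only [Complex.ofRealHom_eq_coe] at this
  rw [← this, Complex.ofReal_im]

theorem newtonRem_im {n : ℕ} {h : ℂ → ℂ} {z : ℝ} {x : ℂ} (hz : (h (x + z)).im = 0)
    (hj : ∀ j : ℕ, j ≤ n → (h (x + j)).im = 0) : (newtonRem n h z x).im = 0 := by
  rw [newtonRem, Complex.sub_im, hz, Complex.im_sum, zero_sub, neg_eq_zero]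
  refine Finset.sum_eq_zero fun j hj' => ?_
  rw [Complex.mul_im, cbinom_ofReal_im, zero_mul, add_zero, fwdDiff_iter_eq_sum_shift,
    Complex.im_sum, Finset.sum_eq_zero, mul_zero]
  intro k hk
  rw [Finset.mem_range] at hj' hk
  rw [zsmul_eq_mul, nsmul_eq_mul, mul_one, Complex.mul_im, Complex.intCast_im, zero_mul, add_zero,
    hj k (by omega), mul_zero]

theorem mgLog_ofReal_im (n : ℕ) {x : ℝ} (hx : -1 < x) : (mgLog n x).im = 0 := by
  rw [mgLog, Complex.im_tsum (summable_mgTerm logLike_log_id n x)]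
  have : ∀ i, (mgTerm id n i (x : ℂ)).im = 0 := by
    intro i
    have hi : (0 : ℝ) ≤ i := Nat.cast_nonneg i
    have h1 : (newtonRem (n + 1) (fun w => Complex.log (id w)) x ((i + 1 : ℕ) : ℂ)).im = 0 := by
      refine newtonRem_im ?_ fun j _ => ?_
      · rw [id, show (((i + 1 : ℕ) : ℂ) + x) = (((i + 1 : ℕ) + x : ℝ) : ℂ) by push_cast; rfl,
          ← Complex.ofReal_log (by push_cast; linarith), Complex.ofReal_im]
      · rw [id, ← Nat.cast_add, ← Complex.natCast_log, Complex.ofReal_im]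
    rw [mgTerm, Complex.mul_im, h1, Complex.intCast_im, mul_zero, zero_mul, add_zero]
  simp [this]

theorem ofReal_mem_cutPlane {x : ℝ} (hx : -1 < x) : (x : ℂ) ∈ cutPlane := by
  left
  rw [Complex.add_re, Complex.ofReal_re, Complex.one_re]
  linarith

theorem mgProd_ofReal (n : ℕ) {x : ℝ} (hx : -1 < x) :
    mgProd id n x = (Real.exp (mgLog n x).re : ℂ) := by
  rw [← exp_mgLog n (ofReal_mem_cutPlane hx), Complex.ofReal_exp]
  congr 1
  exact Complex.ext (by simp) (by simp [mgLog_ofReal_im n hx])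

theorem iteratedDeriv_re_ofReal {f : ℂ → ℂ} {U : Set ℂ} (hU : IsOpen U)
    (hf : DifferentiableOn ℂ f U) (k : ℕ) : ∀ x : ℝ, (x : ℂ) ∈ U →
      iteratedDeriv k (fun t : ℝ => (f t).re) x = (iteratedDeriv k f x).re := by
  have ha : AnalyticOnNhd ℂ f U := hf.analyticOnNhd hU
  induction k with
  | zero => simp
  | succ k ih =>
    intro x hx
    have h1 : iteratedDeriv k (fun t : ℝ => (f t).re) =ᶠ[𝓝 x]
        fun t => (iteratedDeriv k f (t : ℂ)).re := by
      filter_upwards [Complex.continuous_ofReal.continuousAt.preimage_mem_nhds (hU.mem_nhds hx)]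
        with y hy using ih y hy
    have h2 : AnalyticAt ℂ (iteratedDeriv k f) x := by
      rw [iteratedDeriv_eq_iterate]
      exact ha.iterated_deriv k x hx
    rw [iteratedDeriv_succ, iteratedDeriv_succ, h1.deriv_eq]
    exact (h2.differentiableAt.hasDerivAt.real_of_complex).deriv

theorem iteratedDeriv_polynomial_eval {𝕜 : Type*} [NontriviallyNormedField 𝕜] (p : Polynomial 𝕜)
    (k : ℕ) :
    iteratedDeriv k (fun z => p.eval z) = fun z => (Polynomial.derivative^[k] p).eval z := by
  induction k with
  | zero => simp
  | succ k ih =>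
    rw [iteratedDeriv_succ, ih]
    funext z
    rw [Polynomial.deriv, Function.iterate_succ_apply']

/-- As a function of w the interpolating part is a polynomial of degree at most n, so n + 1
derivatives remove it. -/
theorem iteratedDeriv_newtonRem_log (n i : ℕ) {z : ℂ}
    (hz : z + ((i + 1 : ℕ) : ℂ) ∈ Complex.slitPlane) :
    iteratedDeriv (n + 1) (fun w => newtonRem n Complex.log w ((i + 1 : ℕ) : ℂ)) z =
      iteratedDeriv (n + 1) Complex.log (z + ((i + 1 : ℕ) : ℂ)) := by
  set p : Polynomial ℂ := ∑ j ∈ Finset.range (n + 1), binomPoly j *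
        Polynomial.C ((fwdDiff (1 : ℂ))^[j] Complex.log ((i + 1 : ℕ) : ℂ))
  have hp : p.natDegree ≤ n := by
    refine Polynomial.natDegree_sum_le_of_forall_le _ _ fun j hj => ?_
    refine (Polynomial.natDegree_mul_C_le _ _).trans ((natDegree_binomPoly_le j).trans ?_)
    simpa [Nat.lt_succ_iff] using hj
  have h1 : (fun w => newtonRem n Complex.log w ((i + 1 : ℕ) : ℂ)) =
      (fun w => Complex.log (w + ((i + 1 : ℕ) : ℂ))) - fun w => p.eval w := by
    funext w
    simp [newtonRem, Polynomial.eval_finsetSum, cbinom, p, add_comm]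
  have han : AnalyticAt ℂ (fun w : ℂ => Complex.log (w + ((i + 1 : ℕ) : ℂ))) z :=
    AnalyticAt.clog (by fun_prop) hz
  rw [h1, iteratedDeriv_sub han.contDiffAt (p.differentiable.analyticAt z).contDiffAt,
    iteratedDeriv_polynomial_eval, Polynomial.iterate_derivative_eq_zero (by omega),
    iteratedDeriv_comp_add_const]
  simp

theorem tendstoLocallyUniformlyOn_mgLog (n : ℕ) :
    TendstoLocallyUniformlyOn (fun N z => ∑ i ∈ Finset.range N, mgTerm id n i z) (mgLog n) atTop
      cutPlane := by
  rw [tendstoLocallyUniformlyOn_iff_forall_isCompact isOpen_cutPlane]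
  intro K _ hK
  obtain ⟨B, hB⟩ := hK.isBounded.exists_norm_le
  set ρ : ℝ := max B ((n + 1 : ℕ) : ℝ)
  obtain ⟨C, hC⟩ := exists_mgTerm_bound n ρ (le_max_right _ _)
  obtain ⟨M, hM⟩ := exists_nat_gt (2 * ρ)
  refine tendstoUniformlyOn_tsum_nat_eventually (summable_inv_sq_shift C 0) ?_
  filter_upwards [eventually_ge_atTop M] with i hi z hz
  refine hC id logLike_log_id i z (hM.trans_le ?_) ((hB z hz).trans (le_max_left _ _))
  exact_mod_cast (by omega : M ≤ i + 1)

theorem tendstoLocallyUniformlyOn_iteratedDeriv {F : ℕ → ℂ → ℂ} {f : ℂ → ℂ} {U : Set ℂ}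
    (hU : IsOpen U) (hF : ∀ N, DifferentiableOn ℂ (F N) U)
    (h : TendstoLocallyUniformlyOn F f atTop U) (k : ℕ) :
    TendstoLocallyUniformlyOn (fun N => iteratedDeriv k (F N)) (iteratedDeriv k f) atTop U := by
  induction k with
  | zero => simpa using h
  | succ k ih =>
    have h1 := ih.deriv (Eventually.of_forall fun N => ?_) hU
    · simp only [iteratedDeriv_succ]
      exact h1
    · rw [iteratedDeriv_eq_iterate]
      exact ((hF N).analyticOnNhd hU |>.iterated_deriv k).differentiableOn

/-- Differentiation is termwise by locally uniform convergence. The (n+2)-nd derivative of log on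
the positive axis has sign (-1)^(n+1), which is the sign of every exponent. -/
theorem iteratedDeriv_mgLog_re_nonneg (n : ℕ) {x : ℝ} (hx : -1 < x) :
    0 ≤ (iteratedDeriv (n + 2) (mgLog n) x).re := by
  have hxc := ofReal_mem_cutPlane hx
  have hterm : ∀ i, ∀ z ∈ cutPlane, DifferentiableAt ℂ (mgTerm id n i) z := fun i z hz =>
    differentiableAt_mgTerm (cutPlane_add_natCast hz i)
  have h1 := (tendstoLocallyUniformlyOn_iteratedDeriv isOpen_cutPlane
    (fun N => (DifferentiableOn.fun_sum fun i _ => fun z hz => (hterm i z hz).differentiableWithinAt))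
    (tendstoLocallyUniformlyOn_mgLog n) (n + 2)).tendsto_at hxc
  have h2 := (Complex.continuous_re.tendsto _).comp h1
  refine ge_of_tendsto' h2 fun N => ?_
  have hcd : ∀ i ∈ Finset.range N, ContDiffAt ℂ ((n + 2 : ℕ) : WithTop ℕ∞) (mgTerm id n i) x := by
    intro i _
    refine AnalyticAt.contDiffAt (DifferentiableOn.analyticAt (s := cutPlane) (fun z hz =>
      (hterm i z hz).differentiableWithinAt) (isOpen_cutPlane.mem_nhds hxc))
  rw [Function.comp_apply, iteratedDeriv_fun_sum hcd, Complex.re_sum]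
  refine Finset.sum_nonneg fun i hi => ?_
  have hs := cutPlane_add_natCast hxc i
  have h3 : iteratedDeriv (n + 2) (mgTerm id n i) x = (mgExponent n i : ℂ) *
      iteratedDeriv (n + 2) Complex.log (x + ((i + 1 : ℕ) : ℂ)) := by
    have h4 := iteratedDeriv_newtonRem_log (n + 1) i hs
    rw [← h4]
    refine iteratedDeriv_const_mul (n := n + 2) (mgExponent n i : ℂ)
      (f := fun w => newtonRem (n + 1) Complex.log w ((i + 1 : ℕ) : ℂ)) ?_
    refine AnalyticAt.contDiffAt (DifferentiableOn.analyticAt (s := cutPlane) (fun z hz => ?_)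
      (isOpen_cutPlane.mem_nhds hxc))
    unfold newtonRem
    refine (DifferentiableAt.sub ?_ (DifferentiableAt.fun_sum
      fun j _ => ((differentiable_cbinom j) z).mul_const _)).differentiableWithinAt
    have := cutPlane_add_natCast hz i
    rw [add_comm] at this
    exact DifferentiableAt.clog (by fun_prop) this
  rw [h3, iteratedDeriv_succ_log hs, mgExponent_eq]
  have h5 : ((((-1) ^ (n + 1) * ((i + n).choose n : ℤ) : ℤ)) : ℂ) *
      ((-1) ^ (n + 1) * ((n + 1).factorial : ℂ) * ((x : ℂ) + ((i + 1 : ℕ) : ℂ)) ^ (-(n + 1 : ℕ) - 1 : ℤ)) =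
      ((((i + n).choose n : ℝ) * (n + 1).factorial * (x + (i + 1 : ℕ)) ^ (-(n + 1 : ℕ) - 1 : ℤ) : ℝ) : ℂ) := by
    push_cast
    have : ((-1 : ℂ) ^ (n + 1)) * (-1) ^ (n + 1) = 1 := by
      rw [← mul_pow]; simp
    linear_combination (((i + n).choose n : ℂ) * ((n + 1).factorial * ((x : ℂ) + (i + 1)) ^ (-((n : ℤ) + 1) - 1))) * this
  have h6 : 0 < x + (i + 1 : ℕ) := by
    have hi : (0 : ℝ) ≤ i := Nat.cast_nonneg i
    push_cast
    linarith
  refine le_of_le_of_eq ?_ (congrArg Complex.re h5.symm |>.trans ?_)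
  · rw [Complex.ofReal_re]; positivity
  · push_cast; ring_nf

/-! ### The sign of the interpolation error -/

/-- Iterated Rolle theorem on `[0, ∞)`. -/
theorem exists_iteratedDeriv_eq_zero (k : ℕ) : ∀ (F : ℝ → ℝ), (∀ x, 0 ≤ x → AnalyticAt ℝ F x) →
    ∀ s : Finset ℝ, s.card = k + 1 → (∀ x ∈ s, 0 ≤ x ∧ F x = 0) →
      ∃ ξ, 0 ≤ ξ ∧ iteratedDeriv k F ξ = 0 := by
  induction k with
  | zero =>
    intro F _ s hs h
    obtain ⟨x, hx⟩ := Finset.card_pos.1 (by omega : 0 < s.card)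
    exact ⟨x, (h x hx).1, by simpa using (h x hx).2⟩
  | succ k ih =>
    intro F hF s hs h
    set y := s.orderEmbOfFin hs
    have hy : ∀ i, 0 ≤ y i ∧ F (y i) = 0 := fun i => h _ (s.orderEmbOfFin_mem hs i)
    have hc : ∀ i : Fin (k + 1), ∃ c ∈ Set.Ioo (y i.castSucc) (y i.succ), deriv F c = 0 := by
      intro i
      refine exists_deriv_eq_zero (y.strictMono (Fin.castSucc_lt_succ)) (fun x hx => ?_) ?_
      · exact (hF x ((hy _).1.trans hx.1)).continuousAt.continuousWithinAt
      · rw [(hy _).2, (hy _).2]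
    choose c hc hc0 using hc
    have hmono : StrictMono c := by
      intro i j hij
      refine ((hc i).2.trans_le (y.monotone ?_)).trans (hc j).1
      exact Fin.succ_le_castSucc_iff.2 hij
    obtain ⟨ξ, h1, h2⟩ := ih (deriv F) (fun x hx => (hF x hx).deriv)
      (Finset.univ.map ⟨c, hmono.injective⟩) (by simp) (by
        intro x hx
        simp only [Finset.mem_map, Finset.mem_univ, true_and, Function.Embedding.coeFn_mk] at hx
        obtain ⟨i, rfl⟩ := hx
        exact ⟨(hy _).1.trans (hc i).1.le, hc0 i⟩)
    exact ⟨ξ, h1, by rw [iteratedDeriv_succ']; exact h2⟩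

/-- The classical error formula: the error of the interpolant p equals ω(N+x) times a derivative
value of order m + 1 divided by (m+1)!, where ω is the nodal polynomial. -/
theorem exists_interp_sign {m : ℕ} {g : ℝ → ℝ} (hg : ∀ x, 0 ≤ x → AnalyticAt ℝ g x)
    (hpos : ∀ x, 0 ≤ x → 0 ≤ iteratedDeriv (m + 1) g x) (N : ℕ) {x : ℝ} (hx : 0 ≤ x)
    (hxj : ∀ j : ℕ, j ≤ m → x ≠ j) :
    ∃ p : Polynomial ℝ, p.natDegree ≤ m ∧ (∀ j : ℕ, j ≤ m → p.eval ((N : ℝ) + j) = g (N + j)) ∧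
      0 ≤ (∏ j ∈ Finset.range (m + 1), (x - j)) * (g (N + x) - p.eval ((N : ℝ) + x)) := by
  set v : ℕ → ℝ := fun j => (N : ℝ) + j
  have hv : Set.InjOn v (Finset.range (m + 1)) := by
    intro i _ j _ hij
    have : (i : ℝ) = j := by simpa [v] using hij
    exact_mod_cast this
  set p := Lagrange.interpolate (Finset.range (m + 1)) v (fun j => g (v j))
  set ω := Lagrange.nodal (Finset.range (m + 1)) v
  have hp : p.natDegree ≤ m := by
    have := Lagrange.degree_interpolate_lt (fun j => g (v j)) hv
    rw [Finset.card_range] at this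
    exact Polynomial.natDegree_le_iff_coeff_eq_zero.2 fun k hk =>
      (Polynomial.degree_lt_iff_coeff_zero _ _).1 this k hk
  have hpj : ∀ j : ℕ, j ≤ m → p.eval ((N : ℝ) + j) = g (N + j) := fun j hj =>
    Lagrange.eval_interpolate_at_node (fun j => g (v j)) hv (Finset.mem_range.2 (by omega))
  have hωx : ω.eval ((N : ℝ) + x) = ∏ j ∈ Finset.range (m + 1), (x - j) := by
    rw [Lagrange.eval_nodal]
    exact Finset.prod_congr rfl fun j _ => by simp [v]
  have hω0 : ω.eval ((N : ℝ) + x) ≠ 0 := by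
    rw [hωx]
    refine Finset.prod_ne_zero_iff.2 fun j hj => sub_ne_zero.2 (hxj j ?_)
    rw [Finset.mem_range] at hj
    omega
  refine ⟨p, hp, hpj, ?_⟩
  -- Chosen so that g - p - κω vanishes at N + x as well as at the m + 1 nodes. Rolle's theorem then
  -- gives ξ with g^(m+1)(ξ) = (m+1)! κ.
  set κ := (g (N + x) - p.eval ((N : ℝ) + x)) / ω.eval ((N : ℝ) + x) with hκ
  set P := p + Polynomial.C κ * ω
  have hPan : ∀ x, AnalyticAt ℝ (fun t => P.eval t) x := fun x => by
    simpa using (analyticAt_id (𝕜 := ℝ) (z := x)).aeval_polynomial P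
  obtain ⟨ξ, hξ, hξ0⟩ := exists_iteratedDeriv_eq_zero (m + 1) (g - fun t => P.eval t)
    (fun x hx => (hg x hx).sub (hPan x))
    (insert ((N : ℝ) + x) ((Finset.range (m + 1)).image v)) (by
      rw [Finset.card_insert_of_notMem, Finset.card_image_of_injOn hv, Finset.card_range]
      intro h
      simp only [Finset.mem_image, Finset.mem_range, v] at h
      obtain ⟨j, hj, h⟩ := h
      exact hxj j (by omega) (by linarith)) (by
      intro y hy
      simp only [Finset.mem_insert, Finset.mem_image, Finset.mem_range] at hy
      rcases hy with rfl | ⟨j, hj, rfl⟩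
      · refine ⟨by positivity, ?_⟩
        simp only [Pi.sub_apply, P, Polynomial.eval_add, Polynomial.eval_mul, Polynomial.eval_C, hκ]
        rw [div_mul_cancel₀ _ hω0]
        ring
      · refine ⟨by positivity, ?_⟩
        simp only [Pi.sub_apply, P, Polynomial.eval_add, Polynomial.eval_mul, Polynomial.eval_C, v]
        rw [hpj j (by omega), Lagrange.eval_nodal_at_node (v := v) (Finset.mem_range.2 hj)]
        ring)
  rw [iteratedDeriv_sub (hg ξ hξ).contDiffAt (hPan ξ).contDiffAt,
    iteratedDeriv_polynomial_eval] at hξ0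
  have hωm : ω.natDegree = m + 1 := by rw [Lagrange.natDegree_nodal, Finset.card_range]
  have hcoef : P.coeff (m + 1) = κ := by
    have h1 : ω.coeff (m + 1) = 1 := by
      have : ω.Monic := Lagrange.nodal_monic
      rw [← hωm]; exact this
    rw [Polynomial.coeff_add, Polynomial.coeff_C_mul, h1, Polynomial.coeff_eq_zero_of_natDegree_lt
      (by omega)]
    ring
  have hPdeg : P.natDegree ≤ m + 1 :=
    Polynomial.natDegree_add_le_of_degree_le (hp.trans (by omega))
      ((Polynomial.natDegree_C_mul_le _ _).trans hωm.le)
  have hder : (Polynomial.derivative^[m + 1] P).eval ξ = (m + 1).factorial * κ := by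
    have h1 : (Polynomial.derivative^[m + 1] P).natDegree = 0 := by
      have := Polynomial.natDegree_iterate_derivative P (m + 1)
      omega
    rw [Polynomial.eq_C_of_natDegree_eq_zero h1, Polynomial.eval_C,
      Polynomial.coeff_iterate_derivative, zero_add, hcoef, Nat.descFactorial_self, nsmul_eq_mul]
  beta_reduce at hξ0
  rw [hder] at hξ0
  have h2 := hpos ξ hξ
  have h3 : 0 ≤ κ := by
    have hf : (0 : ℝ) < (m + 1).factorial := by positivity
    by_contra hneg
    nlinarith [mul_neg_of_pos_of_neg hf (not_le.1 hneg)]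
  have h4 : g (N + x) - p.eval ((N : ℝ) + x) = κ * ω.eval ((N : ℝ) + x) := by
    rw [hκ, div_mul_cancel₀ _ hω0]
  rw [h4, ← hωx]
  nlinarith [mul_nonneg h3 (sq_nonneg (ω.eval ((N : ℝ) + x)))]

theorem newtonRem_sign {m : ℕ} {g : ℝ → ℝ} (hg : ∀ x, 0 ≤ x → AnalyticAt ℝ g x)
    (hpos : ∀ x, 0 ≤ x → 0 ≤ iteratedDeriv (m + 1) g x) (N : ℕ) {x : ℝ} (hx : 0 ≤ x)
    (hxj : ∀ j : ℕ, j ≤ m → x ≠ j) :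
    0 ≤ (∏ j ∈ Finset.range (m + 1), (x - j)) *
      (newtonRem m (fun w => (g w.re : ℂ)) x N).re := by
  obtain ⟨p, hp, hpj, hs⟩ := exists_interp_sign hg hpos N hx hxj
  have hev : ∀ t : ℝ, (p.map Complex.ofRealHom).eval (t : ℂ) = ((p.eval t : ℝ) : ℂ) := by
    intro t
    rw [Polynomial.eval_map, ← Complex.ofRealHom_eq_coe t, Polynomial.eval₂_hom]
    rfl
  have h1 := newtonRem_eq_of_interp (n := m) (p := p.map Complex.ofRealHom)
    (h := fun w => (g w.re : ℂ)) (x := N) (Polynomial.natDegree_map_le.trans hp) (by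
      intro j hj
      have h2 := hpj j hj
      rw [show ((N : ℂ) + j) = (((N : ℝ) + j : ℝ) : ℂ) by push_cast; rfl, hev, Complex.ofReal_re, h2])
    x
  rw [h1, show ((N : ℂ) + x) = (((N : ℝ) + x : ℝ) : ℂ) by push_cast; rfl, hev, Complex.ofReal_re,
    ← Complex.ofReal_sub, Complex.ofReal_re]
  exact hs

theorem prod_range_sub_sign_Ioo_zero_one (m : ℕ) {x : ℝ} (h0 : 0 < x) (h1 : x < 1) :
    0 < (-1) ^ m * ∏ j ∈ Finset.range (m + 1), (x - j) := by
  induction m with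
  | zero => simpa using h0
  | succ m ih =>
    rw [Finset.prod_range_succ, pow_succ]
    have h2 : 0 < ((m + 1 : ℕ) : ℝ) - x := by
      push_cast
      have : (0 : ℝ) ≤ m := Nat.cast_nonneg m
      linarith
    have := mul_pos ih h2
    linarith

theorem prod_range_sub_sign_Ioo_one_two (m : ℕ) {x : ℝ} (h0 : 1 < x) (h1 : x < 2) :
    0 < (-1) ^ m * ∏ j ∈ Finset.range (m + 2), (x - j) := by
  induction m with
  | zero =>
    rw [Finset.prod_range_succ, Finset.prod_range_succ]
    simp only [Finset.range_zero, Finset.prod_empty, pow_zero, one_mul, Nat.cast_zero, Nat.cast_one]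
    nlinarith
  | succ m ih =>
    rw [Finset.prod_range_succ, pow_succ]
    have h2 : 0 < ((m + 2 : ℕ) : ℝ) - x := by
      push_cast
      have : (0 : ℝ) ≤ m := Nat.cast_nonneg m
      linarith
    have := mul_pos ih h2
    linarith

/-- A Bohr–Mollerup type uniqueness statement. -/
theorem eq_of_iteratedDeriv_nonneg {m : ℕ} {g v : ℝ → ℝ} (hg : ∀ x, 0 ≤ x → AnalyticAt ℝ g x)
    (hpos : ∀ x, 0 ≤ x → 0 ≤ iteratedDeriv (m + 2) g x)
    (hv : ∀ x : ℝ, 0 ≤ x → Tendsto (fun N : ℕ => (newtonRem (m + 1) (fun w => (v w.re : ℂ)) x N).re)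
      atTop (𝓝 0))
    (hd : ∀ x, 0 ≤ x → g (x + 1) - v (x + 1) = g x - v x) (h0 : g 0 = v 0) {x : ℝ} (hx : 0 ≤ x) :
    g x = v x := by
  have hper : ∀ x, 0 ≤ x → ∀ N : ℕ, g (N + x) - v (N + x) = g x - v x := by
    intro x hx N
    induction N with
    | zero => simp
    | succ N ih =>
      rw [← ih, ← hd (N + x) (by positivity)]
      push_cast
      ring_nf
  -- The difference g - v vanishes at all integer nodes, so it is interpolated by 0 and its error is
  -- its value at N + x, which by periodicity is its value at x.
  have hrem : ∀ x : ℝ, 0 ≤ x → ∀ N : ℕ, (newtonRem (m + 1) (fun w => (g w.re : ℂ)) x N).re =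
      g x - v x + (newtonRem (m + 1) (fun w => (v w.re : ℂ)) x N).re := by
    intro x hx N
    have h1 := newtonRem_eq_of_interp (n := m + 1) (p := 0)
      (h := fun w => (g w.re : ℂ) - (v w.re : ℂ)) (x := N) (by simp) (by
        intro j _
        have h2 := hper 0 le_rfl (N + j)
        rw [add_zero, h0, sub_self] at h2
        have h3 : ((N : ℂ) + j).re = ((N + j : ℕ) : ℝ) := by simp
        rw [Polynomial.eval_zero, h3, ← Complex.ofReal_sub, h2, Complex.ofReal_zero]) x
    rw [newtonRem_sub, Polynomial.eval_zero, sub_zero] at h1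
    have h3 : ((N : ℂ) + x).re = N + x := by simp
    rw [h3, ← Complex.ofReal_sub, hper x hx N, sub_eq_iff_eq_add] at h1
    rw [h1, Complex.add_re, Complex.ofReal_re]
  -- The sign of the error of g passes to the limit N → ∞, where the error of v disappears.
  have hsign : ∀ x : ℝ, 0 ≤ x → (∀ j : ℕ, j ≤ m + 1 → x ≠ j) →
      0 ≤ (∏ j ∈ Finset.range (m + 2), (x - j)) * (g x - v x) := by
    intro x hx hxj
    have h1 : Tendsto (fun N : ℕ => (∏ j ∈ Finset.range (m + 2), (x - j)) *
        (newtonRem (m + 1) (fun w => (g w.re : ℂ)) x N).re) atTop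
        (𝓝 ((∏ j ∈ Finset.range (m + 2), (x - j)) * (g x - v x + 0))) := by
      simp only [hrem x hx]
      exact ((hv x hx).const_add _).const_mul _
    rw [add_zero] at h1
    exact ge_of_tendsto' h1 fun N => newtonRem_sign hg hpos N hx hxj
  have hne : ∀ {y : ℝ} {k : ℤ}, (k : ℝ) < y → y < k + 1 → ∀ j : ℕ, y ≠ j := by
    intro y k h1 h2 j hj
    rw [hj] at h1 h2
    have h3 : k < (j : ℤ) := by exact_mod_cast h1
    have h4 : (j : ℤ) < k + 1 := by exact_mod_cast h2
    omega
  have hzero : ∀ x, 0 < x → x < 1 → g x = v x := by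
    intro x hx0 hx1
    have h1 := hsign x hx0.le fun j _ => hne (k := 0) (by simpa using hx0) (by simpa using hx1) j
    have h2 := hsign (x + 1) (by linarith) fun j _ =>
      hne (k := 1) (by push_cast; linarith) (by push_cast; linarith) j
    rw [hd x hx0.le] at h2
    have h3 := prod_range_sub_sign_Ioo_zero_one (m + 1) hx0 hx1
    have h4 := prod_range_sub_sign_Ioo_one_two m (x := x + 1) (by linarith) (by linarith)
    rw [pow_succ] at h3
    -- The nodal product at x in (0,1) and at x + 1 in (1,2) has opposite signs, whereas g - v has
    -- the same value at both points.
    rcases neg_one_pow_eq_or ℝ m with he | he <;> rw [he] at h3 h4 <;>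
      rcases lt_trichotomy (g x - v x) 0 with h5 | h5 | h5 <;> nlinarith
  have hfr : g (Int.fract x) = v (Int.fract x) := by
    rcases (Int.fract_nonneg x).eq_or_lt with h | h
    · rw [← h, h0]
    · exact hzero _ h (Int.fract_lt_one x)
  have h1 := hper (Int.fract x) (Int.fract_nonneg x) ⌊x⌋₊
  rw [hfr, sub_self, natCast_floor_eq_intCast_floor hx, Int.floor_add_fract, sub_eq_zero] at h1
  exact h1

/-! ### The Vignéras hierarchy -/

/-- The multiple gamma functions of Vignéras. -/
def vigneras : ℕ → ℂ → ℂ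
  | 0, w => w
  | n + 1, w => mgProd id n (w - 1)

theorem vigneras_add_one (n : ℕ) (z : ℂ) : vigneras (n + 1) (z + 1) = mgProd id n z := by
  rw [vigneras, add_sub_cancel_right]

theorem meromorphicNFAt_vigneras (n : ℕ) (z : ℂ) : MeromorphicNFAt (vigneras n) z := by
  cases n with
  | zero => exact analyticAt_id.meromorphicNFAt
  | succ n =>
    exact (meromorphicNFAt_comp_sub_const_iff_meromorphicNFAt (f := mgProd id n) (c := 1)).2
      (meromorphicNFAt_mgProd n _)

/-- Identity theorem for meromorphic functions on the plane. -/
theorem eventuallyEq_nhdsNE_of_meromorphic {f g : ℂ → ℂ} (hf : ∀ z, MeromorphicAt f z)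
    (hg : ∀ z, MeromorphicAt g z) {x : ℂ} (h : ∃ᶠ z in 𝓝[≠] x, f z = g z) (y : ℂ) :
    f =ᶠ[𝓝[≠] y] g := by
  have hm : MeromorphicOn (f - g) Set.univ := fun z _ => (hf z).sub (hg z)
  have hx : meromorphicOrderAt (f - g) x = ⊤ := by
    rw [meromorphicOrderAt_eq_top_iff]
    filter_upwards [((hf x).frequently_eq_iff_eventuallyEq (hg x)).1 h] with z hz
    simp [hz]
  have hy : meromorphicOrderAt (f - g) y = ⊤ := by
    by_contra hne
    exact hm.meromorphicOrderAt_ne_top_of_isPreconnected isPreconnected_univ (Set.mem_univ y)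
      (Set.mem_univ x) hne hx
  rw [meromorphicOrderAt_eq_top_iff] at hy
  filter_upwards [hy] with z hz
  exact sub_eq_zero.1 hz

theorem eventuallyEq_codiscrete_iff {f g : ℂ → ℂ} :
    f =ᶠ[codiscrete ℂ] g ↔ ∀ y, f =ᶠ[𝓝[≠] y] g := by
  refine mem_codiscrete.trans (forall_congr' fun y => ?_)
  rw [disjoint_principal_right, compl_compl]
  rfl

/-- The functional equation is checked for Re z > 0, where both sides are exponentials of `mgLog`,
and spreads to the plane by the identity theorem. -/
theorem isVignerasHierarchy_vigneras : IsVignerasHierarchy vigneras where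
  meromorphic n z _ := meromorphicNFAt_vigneras n z
  map_add_one n := by
    rw [eventuallyEq_codiscrete_iff]
    have hshift : ∀ z, MeromorphicAt (fun z => vigneras (n + 1) (z + 1)) z := by
      intro z
      have : (fun z => vigneras (n + 1) (z + 1)) = mgProd id n := funext (vigneras_add_one n)
      rw [this]
      exact (meromorphicNFAt_mgProd n z).meromorphicAt
    refine eventuallyEq_nhdsNE_of_meromorphic hshift (fun z =>
      (meromorphicNFAt_vigneras n z).meromorphicAt.mul
        (meromorphicNFAt_vigneras (n + 1) z).meromorphicAt) (x := 1) (Eventually.frequently ?_)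
    have hU : {z : ℂ | 0 < z.re} ∈ 𝓝 (1 : ℂ) :=
      (isOpen_lt continuous_const Complex.continuous_re).mem_nhds (by simp)
    filter_upwards [mem_nhdsWithin_of_mem_nhds hU] with z hz
    have hz' : 0 < z.re := hz
    have hz1 : z - 1 ∈ cutPlane := by
      left; simpa using hz'
    have hz0 : z ∈ cutPlane := by
      left; simp only [Complex.add_re, Complex.one_re]; linarith
    have key : mgLog n z = (mgLog n z - mgLog n (z - 1)) + mgLog n (z - 1) := by ring
    rw [vigneras_add_one]
    change _ = vigneras n z * mgProd id n (z - 1)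
    rw [← exp_mgLog n hz0, ← exp_mgLog n hz1, key, Complex.exp_add]
    congr 1
    cases n with
    | zero =>
      have := mgLog_zero_add_one (z - 1)
      rw [sub_add_cancel] at this
      rw [this, Complex.exp_log (by rintro rfl; simp at hz')]
      rfl
    | succ n =>
      have := mgLog_add_one n (z - 1)
      rw [sub_add_cancel] at this
      rw [this, exp_mgLog n hz1]
      rfl
  map_one n := by
    cases n with
    | zero => rfl
    | succ n =>
      have := mgProd_ofReal n (x := 0) (by norm_num)
      rw [vigneras, sub_self]
      simpa [mgLog_zero] using this
  pos n x hx := by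
    cases n with
    | zero => exact ⟨x + 1, by linarith, by simp [vigneras]⟩
    | succ n =>
      exact ⟨_, Real.exp_pos _, (vigneras_add_one n x).trans (mgProd_ofReal n (by linarith))⟩
  deriv_log_nonneg n x hx := by
    cases n with
    | zero =>
      have h1 : (fun t : ℝ => Real.log (vigneras 0 ((t : ℂ) + 1)).re) = fun t => Real.log (t + 1) := by
        funext t
        simp [vigneras]
      rw [h1, zero_add, iteratedDeriv_one]
      have h2 : HasDerivAt (fun t : ℝ => Real.log (t + 1)) (1 / (x + 1)) x :=
        ((hasDerivAt_id x).add_const 1).log (by simp only [id]; linarith)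
      rw [h2.deriv]
      positivity
    | succ n =>
      have h1 : (fun t : ℝ => Real.log (vigneras (n + 1) ((t : ℂ) + 1)).re) =ᶠ[𝓝 x]
          fun t => (mgLog n t).re := by
        filter_upwards [lt_mem_nhds (show -1 < x by linarith)] with t ht
        rw [vigneras_add_one, mgProd_ofReal n ht, Complex.ofReal_re, Real.log_exp]
      rw [h1.iteratedDeriv_eq, iteratedDeriv_re_ofReal isOpen_cutPlane (differentiableOn_mgLog n) _ x
        (ofReal_mem_cutPlane (by linarith))]
      exact iteratedDeriv_mgLog_re_nonneg n (by linarith)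
  zero_eq z := rfl

/-- A function in normal form takes the value 0 at a pole, which positivity excludes. -/
theorem IsVignerasHierarchy.analyticAt {G : ℕ → ℂ → ℂ} (hG : IsVignerasHierarchy G) (n : ℕ) {x : ℝ}
    (hx : 0 ≤ x) : AnalyticAt ℂ (G n) ((x : ℂ) + 1) := by
  rcases meromorphicNFAt_iff_analyticAt_or.1 (hG.meromorphic n (Set.mem_univ ((x : ℂ) + 1))) with
    h | ⟨-, -, h⟩
  · exact h
  · obtain ⟨y, hy, hy'⟩ := hG.pos n x hx
    rw [h] at hy'
    exact absurd (by exact_mod_cast hy'.symm) hy.ne'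

/-- The equation is given only off a discrete set; analyticity at these points makes both sides
continuous, so it holds pointwise. -/
theorem IsVignerasHierarchy.map_add_one_ofReal {G : ℕ → ℂ → ℂ} (hG : IsVignerasHierarchy G) (n : ℕ)
    {x : ℝ} (hx : 0 ≤ x) :
    G (n + 1) ((x : ℂ) + 1 + 1) = G n ((x : ℂ) + 1) * G (n + 1) ((x : ℂ) + 1) := by
  have h1 := eventuallyEq_codiscrete_iff.1 (hG.map_add_one n) ((x : ℂ) + 1)
  have h2 : ContinuousAt (fun z => G (n + 1) (z + 1)) ((x : ℂ) + 1) := by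
    have h3 := (hG.analyticAt (n + 1) (x := x + 1) (by linarith)).continuousAt
    push_cast at h3
    exact ContinuousAt.comp (f := fun z : ℂ => z + 1) h3 (by fun_prop)
  have h4 : ContinuousAt (fun z => G n z * G (n + 1) z) ((x : ℂ) + 1) :=
    (hG.analyticAt n hx).continuousAt.mul (hG.analyticAt (n + 1) hx).continuousAt
  exact ((h2.eventuallyEq_nhds_iff_eventuallyEq_nhdsNE h4).1 h1).eq_of_nhds

/-- By induction the two hierarchies agree at level n on the half line. Hence the logarithms at
level n + 1 satisfy the same difference equation, and the Bohr–Mollerup argument applies to them. -/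
theorem IsVignerasHierarchy.eq_vigneras_ofReal {G : ℕ → ℂ → ℂ} (hG : IsVignerasHierarchy G) (n : ℕ) :
    ∀ x : ℝ, 0 ≤ x → G n ((x : ℂ) + 1) = vigneras n ((x : ℂ) + 1) := by
  induction n with
  | zero => intro x _; exact hG.zero_eq _
  | succ n ih =>
    have hV := isVignerasHierarchy_vigneras
    have hlog : ∀ {F : ℕ → ℂ → ℂ}, IsVignerasHierarchy F → ∀ x : ℝ, 0 ≤ x →
        Real.log (F (n + 1) (((x + 1 : ℝ) : ℂ) + 1)).re =
          Real.log (F n ((x : ℂ) + 1)).re + Real.log (F (n + 1) ((x : ℂ) + 1)).re := by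
      intro F hF x hx
      have h1 := hF.map_add_one_ofReal n hx
      obtain ⟨a, ha, ha'⟩ := hF.pos n x hx
      obtain ⟨b, hb, hb'⟩ := hF.pos (n + 1) x hx
      rw [ha', hb'] at h1 ⊢
      push_cast
      rw [h1, ← Complex.ofReal_mul, Complex.ofReal_re, Complex.ofReal_re, Complex.ofReal_re,
        Real.log_mul ha.ne' hb.ne']
    have hlogV : ∀ x : ℝ, 0 ≤ x → Real.log (vigneras (n + 1) ((x : ℂ) + 1)).re = (mgLog n x).re := by
      intro x hx
      rw [vigneras_add_one, mgProd_ofReal n (by linarith), Complex.ofReal_re, Real.log_exp]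
    have key : ∀ x : ℝ, 0 ≤ x → Real.log (G (n + 1) ((x : ℂ) + 1)).re =
        Real.log (vigneras (n + 1) ((x : ℂ) + 1)).re := by
      intro x hx
      refine eq_of_iteratedDeriv_nonneg (m := n) (g := fun t : ℝ => Real.log (G (n + 1) ((t : ℂ) + 1)).re)
        (v := fun t : ℝ => Real.log (vigneras (n + 1) ((t : ℂ) + 1)).re) ?_
        (hG.deriv_log_nonneg (n + 1)) ?_ ?_ ?_ hx
      · intro t ht
        have h1 : AnalyticAt ℂ (fun z => G (n + 1) (z + 1)) (t : ℂ) :=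
          AnalyticAt.fun_comp (f := fun z : ℂ => z + 1) (hG.analyticAt (n + 1) ht) (by fun_prop)
        refine h1.re_ofReal.log ?_
        obtain ⟨b, hb, hb'⟩ := hG.pos (n + 1) t ht
        rw [hb', Complex.ofReal_re]
        exact hb
      · intro t ht
        have h1 := (Complex.continuous_re.tendsto _).comp (tendsto_newtonRem_mgLog n t)
        rw [Complex.zero_re] at h1
        refine h1.congr fun N => ?_
        have h2 : ∀ y : ℝ, 0 ≤ y → mgLog n (y : ℂ) =
            ((Real.log (vigneras (n + 1) (((y : ℂ).re : ℂ) + 1)).re : ℝ) : ℂ) := by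
          intro y hy
          rw [Complex.ofReal_re, hlogV y hy]
          exact Complex.ext (by simp) (by simp [mgLog_ofReal_im n (show -1 < y by linarith)])
        rw [Function.comp_apply]
        congr 1
        refine newtonRem_congr ?_ fun j _ => ?_
        · have := h2 (N + t) (by positivity)
          push_cast at this ⊢
          exact this
        · have := h2 (N + j) (by positivity)
          push_cast at this ⊢
          exact this
      · intro t ht
        simp only [hlog hG t ht, hlog hV t ht, ih t ht]
        ring
      · simp [hG.map_one, hV.map_one]
    intro x hx
    obtain ⟨a, ha, ha'⟩ := hG.pos (n + 1) x hx
    obtain ⟨b, hb, hb'⟩ := hV.pos (n + 1) x hx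
    have h1 := key x hx
    rw [ha', hb'] at h1 ⊢
    rw [Complex.ofReal_re, Complex.ofReal_re] at h1
    rw [Real.log_injOn_pos ha hb h1]

/-- Agreement on the half line accumulates at 2, so the identity theorem applies. Normal form on
both sides then gives equality at every point, poles included. -/
theorem IsVignerasHierarchy.eq_vigneras {G : ℕ → ℂ → ℂ} (hG : IsVignerasHierarchy G) :
    G = vigneras := by
  funext n y
  have hf : ∃ᶠ z in 𝓝[≠] (2 : ℂ), G n z = vigneras n z := by
    have h1 : Tendsto (fun t : ℝ => (t : ℂ)) (𝓝[≠] (2 : ℝ)) (𝓝[≠] (2 : ℂ)) := by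
      refine tendsto_nhdsWithin_of_tendsto_nhds_of_eventually_within _ ?_ ?_
      · exact ((Complex.continuous_ofReal.tendsto 2).mono_left nhdsWithin_le_nhds)
      · filter_upwards [self_mem_nhdsWithin] with t ht
        intro h
        exact ht (Set.mem_singleton_iff.2 (by exact_mod_cast Set.mem_singleton_iff.1 h))
    refine h1.frequently (Eventually.frequently ?_)
    filter_upwards [mem_nhdsWithin_of_mem_nhds (lt_mem_nhds (show (1 : ℝ) < 2 by norm_num))] with t ht
    have := hG.eq_vigneras_ofReal n (t - 1) (by linarith)
    push_cast at this
    rwa [sub_add_cancel] at this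
  have h2 := eventuallyEq_nhdsNE_of_meromorphic
    (fun z => (hG.meromorphic n (Set.mem_univ z)).meromorphicAt)
    (fun z => (meromorphicNFAt_vigneras n z).meromorphicAt) hf y
  exact (((hG.meromorphic n (Set.mem_univ y)).eventuallyEq_nhdsNE_iff_eventuallyEq_nhds
    (meromorphicNFAt_vigneras n y)).1 h2).eq_of_nhds

/-! ### Euler–Maclaurin summation -/

theorem setIntegral_Ioi_comp_add_right (f : ℝ → ℂ) (a c : ℝ) :
    ∫ t in Set.Ioi a, f (t + c) = ∫ t in Set.Ioi (a + c), f t := by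
  have h := (measurePreserving_add_right (volume : Measure ℝ) c).setIntegral_preimage_emb
    (measurableEmbedding_addRight c) f (Set.Ioi (a + c))
  simpa using h

theorem integrableOn_Ioi_comp_add_right {f : ℝ → ℂ} {a c : ℝ} :
    IntegrableOn (fun t => f (t + c)) (Set.Ioi a) ↔ IntegrableOn f (Set.Ioi (a + c)) := by
  have h := (measurePreserving_add_right (volume : Measure ℝ) c).integrableOn_comp_preimage
    (measurableEmbedding_addRight c) (f := f) (s := Set.Ioi (a + c))
  simpa [Function.comp_def] using h

theorem eulerMaclaurin_unit {ψ : ℕ → ℝ → ℂ}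
    (hψ : ∀ r, ∀ t ∈ Set.Icc (0 : ℝ) 1, HasDerivAt (ψ r) (ψ (r + 1) t) t) (m : ℕ) :
    ψ 0 0 = (∫ t in (0 : ℝ)..1, ψ 0 t) +
      ∑ r ∈ Finset.Icc 1 (m + 1), (bernoulli r : ℂ) / (r.factorial : ℂ) * (ψ (r - 1) 1 - ψ (r - 1) 0) +
      (-1) ^ m / ((m + 1).factorial : ℂ) *
        ∫ t in (0 : ℝ)..1, (bernoulliFun (m + 1) t : ℂ) * ψ (m + 1) t := by
  have hu : Set.uIcc (0 : ℝ) 1 = Set.Icc 0 1 := Set.uIcc_of_le zero_le_one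
  have hcont : ∀ r, ContinuousOn (ψ r) (Set.uIcc 0 1) := by
    rw [hu]
    exact fun r t ht => (hψ r t ht).continuousAt.continuousWithinAt
  have hparts : ∀ k, ∫ t in (0 : ℝ)..1, (bernoulliFun (k + 1) t : ℂ) * ψ (k + 1) t =
      (bernoulliFun (k + 1) 1 : ℂ) * ψ k 1 - (bernoulliFun (k + 1) 0 : ℂ) * ψ k 0 -
        ((k + 1 : ℕ) : ℂ) * ∫ t in (0 : ℝ)..1, (bernoulliFun k t : ℂ) * ψ k t := by
    intro k
    rw [intervalIntegral.integral_mul_deriv_eq_deriv_mul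
      (u' := fun t => (((k + 1 : ℕ) : ℝ) * bernoulliFun k t : ℝ)) (v := ψ k), ←
      intervalIntegral.integral_const_mul]
    · congr 2
      funext t
      push_cast
      ring
    · intro t _
      exact (hasDerivAt_bernoulliFun (k + 1) t).ofReal_comp
    · rw [hu]; exact hψ k
    · exact (Complex.continuous_ofReal.comp (continuous_const.mul
        (continuous_bernoulliFun k))).intervalIntegrable _ _
    · exact (hcont (k + 1)).intervalIntegrable
  induction m with
  | zero =>
    rw [hparts 0]
    have h1 : (bernoulliFun 1 1 : ℝ) = 1 / 2 := by rw [bernoulliFun_one]; norm_num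
    have h0 : (bernoulliFun 1 0 : ℝ) = -1 / 2 := by rw [bernoulliFun_one]; norm_num
    simp only [zero_add, Finset.Icc_self, Finset.sum_singleton, h1, h0, bernoulliFun_zero,
      bernoulli_one, Nat.sub_self]
    push_cast
    simp only [one_mul, Nat.factorial_one, Nat.cast_one, pow_zero]
    ring
  | succ m ih =>
    have hne : ((m + 1 + 1 : ℕ) : ℂ) ≠ 0 := by exact_mod_cast (Nat.succ_ne_zero (m + 1))
    have hf : ((m + 1).factorial : ℂ) ≠ 0 := by exact_mod_cast (Nat.factorial_ne_zero (m + 1))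
    have hb1 : (bernoulliFun (m + 1 + 1) 1 : ℂ) = (bernoulli (m + 1 + 1) : ℂ) := by
      rw [bernoulliFun_endpoints_eq_of_ne_one (by omega), bernoulliFun_eval_zero]
      push_cast
      rfl
    have hb0 : (bernoulliFun (m + 1 + 1) 0 : ℂ) = (bernoulli (m + 1 + 1) : ℂ) := by
      rw [bernoulliFun_eval_zero]
      push_cast
      rfl
    rw [Finset.sum_Icc_succ_top (by omega), hparts (m + 1), hb1, hb0, Nat.factorial_succ (m + 1)]
    conv_lhs => rw [ih]
    rw [Nat.add_sub_cancel]
    -- Integration by parts produces the sign (-1)^m, which is invisible: for odd m the index m + 2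
    -- is odd and at least 3, so the Bernoulli number is 0.
    have hsign : (bernoulli (m + 1 + 1) : ℂ) * (-1) ^ m = (bernoulli (m + 1 + 1) : ℂ) := by
      rcases Nat.even_or_odd m with h | h
      · rw [h.neg_one_pow, mul_one]
      · rw [bernoulli_eq_zero_of_odd (by simpa [Nat.odd_add, parity_simps] using h) (by
          have := h.pos
          omega)]
        simp
    push_cast at hne ⊢
    field_simp
    rw [pow_succ]
    linear_combination (ψ (m + 1) 1 - ψ (m + 1) 0) * hsign

/-- `B̄_m(t)`. -/
def perBernoulli (m : ℕ) (t : ℝ) : ℂ := (bernoulliFun m (Int.fract t) : ℂ)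

theorem perBernoulli_add_one (m : ℕ) (t : ℝ) : perBernoulli m (t + 1) = perBernoulli m t := by
  rw [perBernoulli, perBernoulli, Int.fract_add_one]

theorem exists_norm_perBernoulli_le (m : ℕ) : ∃ C, 0 ≤ C ∧ ∀ t, ‖perBernoulli m t‖ ≤ C := by
  obtain ⟨C, hC⟩ := (isCompact_Icc (a := (0 : ℝ)) (b := 1)).exists_bound_of_continuousOn
    (continuous_bernoulliFun m).continuousOn
  refine ⟨C, (norm_nonneg _).trans (hC 0 (by simp)), fun t => ?_⟩
  rw [perBernoulli, Complex.norm_real]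
  exact hC _ ⟨Int.fract_nonneg t, (Int.fract_lt_one t).le⟩

theorem measurable_perBernoulli (m : ℕ) : Measurable (perBernoulli m) :=
  Complex.measurable_ofReal.comp ((continuous_bernoulliFun m).measurable.comp measurable_fract)

/-- The regularized value of `-∑_{k ≥ 0} φ₀(w + k)` given by the Euler–Maclaurin formula, for a
sequence `φ` of successive derivatives, with `A` a primitive of `φ₀`. -/
def emFun (m : ℕ) (A : ℂ → ℂ) (φ : ℕ → ℂ → ℂ) (w : ℂ) : ℂ :=
  A w + ∑ r ∈ Finset.Icc 1 m, (bernoulli r : ℂ) / (r.factorial : ℂ) * φ (r - 1) w -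
    (-1) ^ (m - 1) / (m.factorial : ℂ) * ∫ t in Set.Ioi (0 : ℝ), perBernoulli m t * φ m (w + t)

/-- By periodicity of B̄_m the integral for w + 1 is the integral for w restricted to (1, ∞). What
is left is the Euler–Maclaurin formula on one unit interval. -/
theorem emFun_add_one {m : ℕ} (hm : 1 ≤ m) {A : ℂ → ℂ} {φ : ℕ → ℂ → ℂ} {w : ℂ}
    (hA : ∀ t : ℝ, 0 ≤ t → HasDerivAt A (φ 0 (w + t)) (w + t))
    (hφ : ∀ r, ∀ t : ℝ, 0 ≤ t → HasDerivAt (φ r) (φ (r + 1) (w + t)) (w + t))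
    (hint : IntegrableOn (fun t : ℝ => perBernoulli m t * φ m (w + t)) (Set.Ioi 0)) :
    emFun m A φ (w + 1) - emFun m A φ w = φ 0 w := by
  obtain ⟨m, rfl⟩ : ∃ k, m = k + 1 := ⟨m - 1, by omega⟩
  have hline : ∀ {f : ℂ → ℂ} {f' : ℂ} {t : ℝ}, HasDerivAt f f' (w + t) →
      HasDerivAt (fun t : ℝ => f (w + t)) f' t := by
    intro f f' t h
    have h1 : HasDerivAt (fun z : ℂ => f (w + z)) f' (t : ℂ) := h.comp_const_add w (t : ℂ)
    exact h1.comp_ofReal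
  have hem := eulerMaclaurin_unit (ψ := fun r (t : ℝ) => φ r (w + t))
    (fun r t ht => hline (hφ r t ht.1)) m
  have hA1 : ∫ t in (0 : ℝ)..1, φ 0 (w + t) = A (w + 1) - A w := by
    have hcont : ContinuousOn (fun t : ℝ => φ 0 (w + t)) (Set.uIcc 0 1) := by
      rw [Set.uIcc_of_le zero_le_one]
      exact fun t ht => (hline (hφ 0 t ht.1)).continuousAt.continuousWithinAt
    rw [intervalIntegral.integral_eq_sub_of_hasDerivAt (f := fun t : ℝ => A (w + t)) ?_
      hcont.intervalIntegrable]
    · simp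
    · rw [Set.uIcc_of_le zero_le_one]
      exact fun t ht => hline (hA t ht.1)
  have hsplit := intervalIntegral.integral_interval_add_Ioi hint
    (hint.mono_set (Set.Ioi_subset_Ioi zero_le_one))
  have hshift : ∫ t in Set.Ioi (0 : ℝ), perBernoulli (m + 1) t * φ (m + 1) (w + 1 + t) =
      ∫ t in Set.Ioi (1 : ℝ), perBernoulli (m + 1) t * φ (m + 1) (w + t) := by
    have := setIntegral_Ioi_comp_add_right
      (fun t : ℝ => perBernoulli (m + 1) t * φ (m + 1) (w + t)) 0 1
    rw [zero_add] at this
    rw [← this]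
    congr 1
    funext t
    rw [perBernoulli_add_one]
    congr 2
    push_cast
    ring
  -- The fractional part differs from t only at the endpoint t = 1, a null set.
  have hunit : ∫ t in (0 : ℝ)..1, perBernoulli (m + 1) t * φ (m + 1) (w + t) =
      ∫ t in (0 : ℝ)..1, (bernoulliFun (m + 1) t : ℂ) * φ (m + 1) (w + t) := by
    refine intervalIntegral.integral_congr_ae ?_
    have h1 : ∀ᵐ t : ℝ, t ≠ 1 := by simp [ae_iff, measure_singleton]
    filter_upwards [h1] with t ht1 ht
    rw [Set.uIoc_of_le zero_le_one] at ht
    rw [perBernoulli, Int.fract_eq_self.2 ⟨ht.1.le, lt_of_le_of_ne ht.2 ht1⟩]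
  rw [hunit] at hsplit
  simp only [Complex.ofReal_zero, add_zero, Complex.ofReal_one] at hem
  rw [hA1] at hem
  simp only [emFun, hshift, ← hsplit, Nat.add_sub_cancel]
  conv_rhs => rw [hem]
  simp only [mul_sub, Finset.sum_sub_distrib]
  ring

/-! ### Integrals of powers -/

theorem slitPlane_add_ofReal {w : ℂ} (hw : w ∈ Complex.slitPlane) {t : ℝ} (ht : 0 ≤ t) :
    w + t ∈ Complex.slitPlane := by
  rw [Complex.mem_slitPlane_iff] at hw ⊢
  rw [Complex.add_re, Complex.ofReal_re, Complex.add_im, Complex.ofReal_im, add_zero]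
  exact hw.imp (fun h => by linarith) id

theorem norm_cpow_le_exp (u p : ℂ) : ‖u ^ p‖ ≤ Real.exp (Real.pi * |p.im|) * ‖u‖ ^ p.re := by
  refine (Complex.norm_cpow_le u p).trans ?_
  rw [div_eq_mul_inv, ← Real.exp_neg, mul_comm]
  gcongr
  have h1 := neg_abs_le (u.arg * p.im)
  rw [abs_mul] at h1
  have h2 := mul_le_mul_of_nonneg_right (Complex.abs_arg_le_pi u) (abs_nonneg p.im)
  linarith

theorem integrableOn_cpow {w p : ℂ} (hw : w ∈ Complex.slitPlane) (hp : p.re < -1) :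
    IntegrableOn (fun t : ℝ => (w + t) ^ p) (Set.Ioi 0) := by
  refine IntegrableOn.mono_set ?_ Set.Ioi_subset_Ici_self
  refine LocallyIntegrableOn.integrableOn_of_isBigO_atTop (g := fun t : ℝ => t ^ p.re) ?_ ?_
    ⟨Set.Ioi 1, Ioi_mem_atTop 1, integrableOn_Ioi_rpow_of_lt hp one_pos⟩
  · refine ContinuousOn.locallyIntegrableOn (fun t ht => ?_) measurableSet_Ici
    refine ContinuousAt.continuousWithinAt (ContinuousAt.comp (f := fun t : ℝ => w + (t : ℂ))
      (g := fun u => u ^ p) ?_ (by fun_prop))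
    exact continuousAt_cpow_const (slitPlane_add_ofReal hw ht)
  · refine Asymptotics.IsBigO.of_bound (Real.exp (Real.pi * |p.im|) * (1 / 2) ^ p.re) ?_
    filter_upwards [eventually_ge_atTop (2 * ‖w‖), eventually_gt_atTop 0] with t ht ht0
    refine (norm_cpow_le_exp _ _).trans ?_
    rw [Real.norm_of_nonneg (by positivity), mul_assoc, ← Real.mul_rpow (by norm_num) ht0.le]
    gcongr 1
    refine Real.rpow_le_rpow_of_nonpos (by positivity) ?_ (by linarith)
    have h1 := norm_sub_norm_le (t : ℂ) (-w)
    rw [norm_neg, Complex.norm_real, Real.norm_of_nonneg ht0.le, sub_neg_eq_add, add_comm] at h1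
    linarith

theorem integrableOn_perBernoulli_mul_cpow (m : ℕ) {w p : ℂ} (hw : w ∈ Complex.slitPlane)
    (hp : p.re < -1) :
    IntegrableOn (fun t : ℝ => perBernoulli m t * (w + t) ^ p) (Set.Ioi 0) := by
  obtain ⟨C, -, hC⟩ := exists_norm_perBernoulli_le m
  exact Integrable.bdd_mul (c := C) (integrableOn_cpow hw hp)
    (measurable_perBernoulli m).aestronglyMeasurable (Eventually.of_forall hC)

/-- Since |w + t| ≥ a + t and Re p is negative, the integrand is dominated by a multiple of (a +
t)^(Re p). The factor exp(π |Im p|) bounds the effect of the argument. -/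
theorem exists_norm_integral_perBernoulli_le (m : ℕ) {p : ℂ} (hp : p.re < -1) :
    ∃ C, 0 ≤ C ∧ ∀ (w : ℂ) (a : ℝ), 0 < a → a ≤ w.re →
      ‖∫ t in Set.Ioi (0 : ℝ), perBernoulli m t * (w + t) ^ p‖ ≤ C * a ^ (p.re + 1) := by
  obtain ⟨C, hC0, hC⟩ := exists_norm_perBernoulli_le m
  set D := C * Real.exp (Real.pi * |p.im|) with hD
  refine ⟨D * (-(p.re + 1))⁻¹, mul_nonneg (by positivity)
    (inv_nonneg.2 (by linarith)), fun w a ha haw => ?_⟩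
  have hw : w ∈ Complex.slitPlane := Or.inl (ha.trans_le haw)
  have hint : IntegrableOn (fun t : ℝ => (t + a) ^ p.re) (Set.Ioi 0) := by
    have h := (measurePreserving_add_right (volume : Measure ℝ) a).integrableOn_comp_preimage
      (measurableEmbedding_addRight a) (f := fun t : ℝ => t ^ p.re) (s := Set.Ioi a)
    have h2 := h.2 (integrableOn_Ioi_rpow_of_lt hp ha)
    simpa [Function.comp_def] using h2
  have hval : ∫ t in Set.Ioi (0 : ℝ), (t + a) ^ p.re = -a ^ (p.re + 1) / (p.re + 1) := by
    have h := (measurePreserving_add_right (volume : Measure ℝ) a).setIntegral_preimage_emb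
      (measurableEmbedding_addRight a) (fun t : ℝ => t ^ p.re) (Set.Ioi a)
    rw [integral_Ioi_rpow_of_lt hp ha] at h
    simpa using h
  calc _ ≤ ∫ t in Set.Ioi (0 : ℝ), D * (t + a) ^ p.re := by
        refine norm_integral_le_of_norm_le (hint.const_mul D) ?_
        filter_upwards [ae_restrict_mem measurableSet_Ioi] with t ht
        have ht0 : (0 : ℝ) < t := ht
        rw [norm_mul, hD, mul_assoc]
        refine mul_le_mul (hC t) ((norm_cpow_le_exp _ _).trans ?_) (norm_nonneg _) hC0
        gcongr 1
        refine Real.rpow_le_rpow_of_nonpos (by positivity) ?_ (by linarith)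
        refine le_trans ?_ (Complex.re_le_norm _)
        rw [Complex.add_re, Complex.ofReal_re]
        linarith
    _ = D * (-a ^ (p.re + 1) / (p.re + 1)) := by
        rw [integral_const_mul, hval]
    _ = _ := by
        rw [neg_div, ← div_neg, div_eq_mul_inv]
        ring

/-! ### Derivatives of powers -/

/-- The falling factorial `x (x - 1) ⋯ (x - r + 1)`. -/
def fallFac (r : ℕ) (x : ℂ) : ℂ := (descPochhammer ℂ r).eval x

/-- The derivative of the falling factorial. -/
def fallFacDeriv (r : ℕ) (x : ℂ) : ℂ := (Polynomial.derivative (descPochhammer ℂ r)).eval x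

@[simp] theorem fallFac_zero (x : ℂ) : fallFac 0 x = 1 := by simp [fallFac]

@[simp] theorem fallFacDeriv_zero (x : ℂ) : fallFacDeriv 0 x = 0 := by simp [fallFacDeriv]

theorem fallFac_succ (r : ℕ) (x : ℂ) : fallFac (r + 1) x = fallFac r x * (x - r) := by
  simp [fallFac, descPochhammer_succ_right]

theorem fallFacDeriv_succ (r : ℕ) (x : ℂ) :
    fallFacDeriv (r + 1) x = fallFacDeriv r x * (x - r) + fallFac r x := by
  simp [fallFac, fallFacDeriv, descPochhammer_succ_right]

theorem hasDerivAt_fallFac (r : ℕ) (x : ℂ) : HasDerivAt (fallFac r) (fallFacDeriv r x) x :=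
  (descPochhammer ℂ r).hasDerivAt x

theorem fallFac_natCast_eq_zero {j r : ℕ} (h : j < r) : fallFac r (j : ℂ) = 0 :=
  descPochhammer_eval_coe_nat_of_lt h

/-- The `r`-th derivative of `u ^ j`. -/
def powDer (j r : ℕ) (u : ℂ) : ℂ := fallFac r j * u ^ ((j : ℤ) - r)

/-- The `r`-th derivative of `u ^ j log u`. -/
def powLogDer (j r : ℕ) (u : ℂ) : ℂ := fallFacDeriv r j * u ^ ((j : ℤ) - r) + powDer j r u * Complex.log u

theorem hasDerivAt_zpow_sub (j r : ℕ) {u : ℂ} (hu : u ≠ 0) :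
    HasDerivAt (fun u : ℂ => u ^ ((j : ℤ) - r)) (((j : ℂ) - r) * u ^ ((j : ℤ) - (r + 1 : ℕ))) u := by
  have h := hasDerivAt_zpow ((j : ℤ) - r) u (Or.inl hu)
  push_cast at h ⊢
  rwa [sub_sub] at h

theorem hasDerivAt_powDer (j r : ℕ) {u : ℂ} (hu : u ≠ 0) :
    HasDerivAt (powDer j r) (powDer j (r + 1) u) u := by
  have h := (hasDerivAt_zpow_sub j r hu).const_mul (fallFac r j)
  rw [powDer, fallFac_succ, mul_assoc]
  exact h

theorem hasDerivAt_powLogDer (j r : ℕ) {u : ℂ} (hu : u ∈ Complex.slitPlane) :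
    HasDerivAt (powLogDer j r) (powLogDer j (r + 1) u) u := by
  have hu0 := Complex.slitPlane_ne_zero hu
  have h := ((hasDerivAt_zpow_sub j r hu0).const_mul (fallFacDeriv r j)).add
    ((hasDerivAt_powDer j r hu0).mul (Complex.hasDerivAt_log hu))
  refine h.congr_deriv ?_
  rw [powLogDer, fallFacDeriv_succ]
  have h1 : u ^ ((j : ℤ) - r) * u⁻¹ = u ^ ((j : ℤ) - (r + 1 : ℕ)) := by
    rw [← zpow_sub_one₀ hu0]
    congr 1
    push_cast
    ring
  simp only [powDer]
  rw [mul_assoc (fallFac r j), h1]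
  ring

/-- A primitive of `u ^ j log u`. -/
def powLogPrim (j : ℕ) (u : ℂ) : ℂ :=
  u ^ (j + 1) / (j + 1) * Complex.log u - u ^ (j + 1) / (j + 1) ^ 2

theorem hasDerivAt_powLogPrim (j : ℕ) {u : ℂ} (hu : u ∈ Complex.slitPlane) :
    HasDerivAt (powLogPrim j) (powLogDer j 0 u) u := by
  have hu0 := Complex.slitPlane_ne_zero hu
  have hj : ((j : ℂ) + 1) ≠ 0 := by exact_mod_cast j.succ_ne_zero
  have hp := hasDerivAt_pow (j + 1) u
  have h := ((hp.div_const ((j : ℂ) + 1)).mul (Complex.hasDerivAt_log hu)).sub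
    (hp.div_const (((j : ℂ) + 1) ^ 2))
  refine h.congr_deriv ?_
  simp only [powLogDer, powDer, fallFacDeriv_zero, fallFac_zero, Nat.cast_zero, sub_zero,
    zpow_natCast, Nat.add_sub_cancel]
  push_cast
  field_simp
  ring

/-- Once m exceeds j the logarithm has been differentiated away and a pure power remains. It is
written as a complex power to fit the integrability lemmas. -/
theorem powLogDer_of_lt {j m : ℕ} (h : j < m) (u : ℂ) :
    powLogDer j m u = fallFacDeriv m j * u ^ (((j : ℤ) - m : ℤ) : ℂ) := by
  rw [powLogDer, powDer, fallFac_natCast_eq_zero h, Complex.cpow_intCast]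
  ring

theorem integrableOn_powLogDer {j m : ℕ} (h : j + 2 ≤ m) {w : ℂ} (hw : w ∈ Complex.slitPlane) :
    IntegrableOn (fun t : ℝ => perBernoulli m t * powLogDer j m (w + t)) (Set.Ioi 0) := by
  have h1 : ((((j : ℤ) - m : ℤ) : ℂ)).re < -1 := by
    rw [Complex.intCast_re]
    exact_mod_cast (by omega : (j : ℤ) - m < -1)
  have h2 := (integrableOn_perBernoulli_mul_cpow m hw h1).const_mul (fallFacDeriv m j)
  refine h2.congr (Eventually.of_forall fun t => ?_)
  simp only [powLogDer_of_lt (show j < m by omega)]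
  ring

/-- The Euler–Maclaurin expression for `ζ'(-j, w)`, the derivative of the Hurwitz zeta function. -/
def hurwitzDeriv (m j : ℕ) (w : ℂ) : ℂ := emFun m (powLogPrim j) (powLogDer j) w

theorem hurwitzDeriv_add_one {j m : ℕ} (h : j + 2 ≤ m) {w : ℂ} (hw : w ∈ Complex.slitPlane) :
    hurwitzDeriv m j (w + 1) - hurwitzDeriv m j w = w ^ j * Complex.log w := by
  have := emFun_add_one (m := m) (by omega) (A := powLogPrim j) (φ := powLogDer j) (w := w)
    (fun t ht => hasDerivAt_powLogPrim j (slitPlane_add_ofReal hw ht))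
    (fun r t ht => hasDerivAt_powLogDer j r (slitPlane_add_ofReal hw ht))
    (integrableOn_powLogDer h hw)
  rw [hurwitzDeriv, hurwitzDeriv, this]
  simp [powLogDer, powDer]

/-! ### The Riemann zeta function -/

/-- The `r`-th derivative of `u ^ (-s)`. -/
def cpowDer (s : ℂ) (r : ℕ) (u : ℂ) : ℂ := fallFac r (-s) * u ^ (-s - r)

theorem hasDerivAt_cpowDer (s : ℂ) (r : ℕ) {u : ℂ} (hu : u ∈ Complex.slitPlane) :
    HasDerivAt (cpowDer s r) (cpowDer s (r + 1) u) u := by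
  have h := ((hasDerivAt_id u).cpow_const (c := -s - r) hu).const_mul (fallFac r (-s))
  refine h.congr_deriv ?_
  rw [cpowDer, fallFac_succ]
  simp only [id, mul_one]
  rw [show -s - ((r + 1 : ℕ) : ℂ) = -s - r - 1 by push_cast; ring]
  ring

theorem hasDerivAt_cpow_prim {s : ℂ} (hs : s ≠ 1) {u : ℂ} (hu : u ∈ Complex.slitPlane) :
    HasDerivAt (fun u : ℂ => u ^ (1 - s) / (1 - s)) (cpowDer s 0 u) u := by
  have hs' : 1 - s ≠ 0 := sub_ne_zero.2 hs.symm
  have h := ((hasDerivAt_id u).cpow_const (c := 1 - s) hu).div_const (1 - s)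
  refine h.congr_deriv ?_
  rw [cpowDer, fallFac_zero]
  simp only [id, mul_one, Nat.cast_zero, sub_zero, one_mul]
  rw [show 1 - s - 1 = -s by ring]
  field_simp

/-- The Euler–Maclaurin expression for `-ζ(s, w)`. -/
def zetaEM (m : ℕ) (s w : ℂ) : ℂ := emFun m (fun u : ℂ => u ^ (1 - s) / (1 - s)) (cpowDer s) w

theorem natCast_succ_mem_slitPlane (i : ℕ) : ((i + 1 : ℕ) : ℂ) ∈ Complex.slitPlane := by
  simpa using natCast_succ_add_mem_slitPlane i 0

theorem tendsto_natCast_cpow {p : ℂ} (hp : p.re < 0) :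
    Tendsto (fun i : ℕ => ((i + 1 : ℕ) : ℂ) ^ p) atTop (𝓝 0) := by
  have h1 : Tendsto (fun i : ℕ => ((i + 1 : ℕ) : ℝ) ^ p.re) atTop (𝓝 0) := by
    have h2 := (tendsto_rpow_neg_atTop (y := -p.re) (by linarith)).comp
      (tendsto_natCast_atTop_atTop.comp (tendsto_add_atTop_nat 1))
    simpa [Function.comp_def] using h2
  refine squeeze_zero_norm (fun i => le_of_eq ?_) h1
  have := Complex.norm_cpow_eq_rpow_re_of_pos (x := ((i + 1 : ℕ) : ℝ)) (by positivity) p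
  rwa [Complex.ofReal_natCast] at this

/-- The Dirichlet series telescopes through the values of `zetaEM` at i + 1, each part of which
tends to 0 when Re s > 1. -/
theorem riemannZeta_eq_zetaEM_of_one_lt {m : ℕ} (hm : 1 ≤ m) {s : ℂ} (hs : 1 < s.re) :
    riemannZeta s = -zetaEM m s 1 := by
  have hs1 : s ≠ 1 := by rintro rfl; simp at hs
  have hp : (-s - m).re < -1 := by
    have : (1 : ℝ) ≤ m := by exact_mod_cast hm
    rw [Complex.sub_re, Complex.neg_re, Complex.natCast_re]
    linarith
  have hsum : Summable fun n : ℕ => 1 / ((n : ℂ) + 1) ^ s := by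
    have h := (summable_nat_add_iff 1).2 (Complex.summable_one_div_nat_cpow.2 hs)
    simpa using h
  rw [zeta_eq_tsum_one_div_nat_add_one_cpow hs,
    tsum_eq_neg_of_telescoping hsum (u := fun i => zetaEM m s ((i + 1 : ℕ) : ℂ))]
  · simp
  · intro i
    have hi := natCast_succ_mem_slitPlane i
    have h := emFun_add_one hm (A := fun u : ℂ => u ^ (1 - s) / (1 - s)) (φ := cpowDer s)
      (w := ((i + 1 : ℕ) : ℂ))
      (fun t ht => hasDerivAt_cpow_prim hs1 (slitPlane_add_ofReal hi ht))
      (fun r t ht => hasDerivAt_cpowDer s r (slitPlane_add_ofReal hi ht)) (by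
        refine ((integrableOn_perBernoulli_mul_cpow m hi hp).const_mul (fallFac m (-s))).congr
          (Eventually.of_forall fun t => ?_)
        simp only [cpowDer]
        ring)
    simp only [zetaEM]
    rw [show ((i + 1 + 1 : ℕ) : ℂ) = ((i + 1 : ℕ) : ℂ) + 1 by push_cast; ring, h, cpowDer,
      fallFac_zero, one_mul, Nat.cast_zero, sub_zero, Complex.cpow_neg, one_div]
    push_cast
    rfl
  · obtain ⟨C, -, hC⟩ := exists_norm_integral_perBernoulli_le m hp
    have h1 : Tendsto (fun i : ℕ => ∫ t in Set.Ioi (0 : ℝ),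
        perBernoulli m t * cpowDer s m (((i + 1 : ℕ) : ℂ) + t)) atTop (𝓝 0) := by
      have h2 : ∀ i : ℕ, ∫ t in Set.Ioi (0 : ℝ),
          perBernoulli m t * cpowDer s m (((i + 1 : ℕ) : ℂ) + t) = fallFac m (-s) *
            ∫ t in Set.Ioi (0 : ℝ), perBernoulli m t * (((i + 1 : ℕ) : ℂ) + t) ^ (-s - m) := by
        intro i
        rw [← integral_const_mul]
        congr 1
        funext t
        rw [cpowDer]
        ring
      have h3 : Tendsto (fun i : ℕ => ∫ t in Set.Ioi (0 : ℝ),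
          perBernoulli m t * (((i + 1 : ℕ) : ℂ) + t) ^ (-s - m)) atTop (𝓝 0) := by
        have h4 : Tendsto (fun i : ℕ => C * ((i + 1 : ℕ) : ℝ) ^ ((-s - m).re + 1)) atTop (𝓝 0) := by
          have h5 := (tendsto_rpow_neg_atTop (y := -((-s - m).re + 1)) (by linarith)).comp
            (tendsto_natCast_atTop_atTop.comp (tendsto_add_atTop_nat 1))
          simp only [neg_neg] at h5
          simpa [Function.comp_def] using h5.const_mul C
        refine squeeze_zero_norm (fun i => hC _ _ (by positivity) ?_) h4
        rw [Complex.natCast_re]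
      simp only [h2]
      simpa using h3.const_mul (fallFac m (-s))
    have h6 : Tendsto (fun i : ℕ => ((i + 1 : ℕ) : ℂ) ^ (1 - s) / (1 - s)) atTop (𝓝 0) := by
      simpa using (tendsto_natCast_cpow (p := 1 - s) (by simpa using hs)).div_const (1 - s)
    have h7 : Tendsto (fun i : ℕ => ∑ r ∈ Finset.Icc 1 m, (bernoulli r : ℂ) / (r.factorial : ℂ) *
        cpowDer s (r - 1) ((i + 1 : ℕ) : ℂ)) atTop (𝓝 0) := by
      rw [show (0 : ℂ) = ∑ r ∈ Finset.Icc 1 m, (bernoulli r : ℂ) / (r.factorial : ℂ) *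
        (fallFac (r - 1) (-s) * 0) by simp]
      refine tendsto_finsetSum _ fun r _ => ((tendsto_natCast_cpow ?_).const_mul _).const_mul _
      rw [Complex.sub_re, Complex.neg_re, Complex.natCast_re]
      have : (0 : ℝ) ≤ (r - 1 : ℕ) := Nat.cast_nonneg _
      linarith
    have := (h6.add h7).sub (h1.const_mul ((-1) ^ (m - 1) / (m.factorial : ℂ)))
    simpa [zetaEM, emFun] using this

theorem zetaEM_one (m : ℕ) (s : ℂ) : zetaEM m s 1 = 1 / (1 - s) +
    ∑ r ∈ Finset.Icc 1 m, (bernoulli r : ℂ) / (r.factorial : ℂ) * fallFac (r - 1) (-s) -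
    (-1) ^ (m - 1) / (m.factorial : ℂ) * (fallFac m (-s) *
      ∫ t in Set.Ioi (0 : ℝ), perBernoulli m t * (1 + (t : ℂ)) ^ (-s - m)) := by
  have h : ∫ t in Set.Ioi (0 : ℝ), perBernoulli m t * cpowDer s m (1 + t) = fallFac m (-s) *
      ∫ t in Set.Ioi (0 : ℝ), perBernoulli m t * (1 + (t : ℂ)) ^ (-s - m) := by
    rw [← integral_const_mul]
    congr 1
    funext t
    rw [cpowDer]
    ring
  rw [zetaEM, emFun, Complex.one_cpow, h]
  simp only [cpowDer, Complex.one_cpow, mul_one]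

/-- After t ↦ t + 1 the integral is the Mellin transform of B̄_m restricted to (1, ∞), at 1 - s - m.
That function is bounded at infinity and vanishes near 0, so the transform is holomorphic where Re(1
- s - m) < 0. -/
theorem differentiableAt_integral_perBernoulli (m : ℕ) {s : ℂ} (hs : 1 - m < s.re) :
    DifferentiableAt ℂ
      (fun s : ℂ => ∫ t in Set.Ioi (0 : ℝ), perBernoulli m t * (1 + (t : ℂ)) ^ (-s - m)) s := by
  obtain ⟨C, hC0, hC⟩ := exists_norm_perBernoulli_le m
  set f : ℝ → ℂ := (Set.Ioi 1).indicator (perBernoulli m)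
  have hf : ∀ t, ‖f t‖ ≤ C := fun t => (norm_indicator_le_norm_self _ _).trans (hC t)
  have hmeas : Measurable f := (measurable_perBernoulli m).indicator measurableSet_Ioi
  have h1 : (fun s : ℂ => ∫ t in Set.Ioi (0 : ℝ), perBernoulli m t * (1 + (t : ℂ)) ^ (-s - m)) =
      fun s : ℂ => mellin f (1 - s - m) := by
    funext s
    have h2 := setIntegral_Ioi_comp_add_right
      (fun t : ℝ => perBernoulli m t * (t : ℂ) ^ (-s - m)) 0 1
    rw [zero_add] at h2
    have h3 : (fun t : ℝ => perBernoulli m (t + 1) * ((t + 1 : ℝ) : ℂ) ^ (-s - m)) =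
        fun t : ℝ => perBernoulli m t * (1 + (t : ℂ)) ^ (-s - m) := by
      funext t
      rw [perBernoulli_add_one, add_comm (1 : ℂ)]
      push_cast
      rfl
    rw [h3] at h2
    have h4 : (fun t : ℝ => (t : ℂ) ^ (1 - s - m - 1) • f t) =
        (Set.Ioi 1).indicator fun t : ℝ => perBernoulli m t * (t : ℂ) ^ (-s - m) := by
      funext t
      simp only [f, Set.indicator]
      split_ifs
      · rw [smul_eq_mul, mul_comm, show 1 - s - m - 1 = -s - (m : ℂ) by ring]
      · simp
    rw [h2, mellin, h4, setIntegral_indicator measurableSet_Ioi,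
      Set.inter_eq_right.2 (Set.Ioi_subset_Ioi zero_le_one)]
  rw [h1]
  have hmel : DifferentiableAt ℂ (mellin f) (1 - s - m) := by
    refine mellin_differentiableAt_of_isBigO_rpow (a := 0) (b := (1 - s - m).re - 1) ?_ ?_ ?_ ?_
      (by linarith)
    · refine LocallyIntegrable.locallyIntegrableOn ?_ _
      refine (locallyIntegrable_const C).mono hmeas.aestronglyMeasurable
        (Eventually.of_forall fun t => ?_)
      rw [Real.norm_of_nonneg hC0]
      exact hf t
    · refine Asymptotics.IsBigO.of_bound C (Eventually.of_forall fun t => ?_)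
      simpa using hf t
    · rw [Complex.sub_re, Complex.sub_re, Complex.one_re, Complex.natCast_re]
      linarith
    · refine Asymptotics.IsBigO.of_bound 0 ?_
      filter_upwards [mem_nhdsWithin_of_mem_nhds (gt_mem_nhds (show (0 : ℝ) < 1 by norm_num))]
        with t ht
      have : f t = 0 := Set.indicator_of_notMem (by simpa using le_of_lt ht) _
      simp [this]
  exact DifferentiableAt.comp (f := fun s : ℂ => 1 - s - m) s hmel (by fun_prop)

theorem differentiableAt_zetaEM (m : ℕ) {s : ℂ} (hs1 : s ≠ 1) (hs : 1 - m < s.re) :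
    DifferentiableAt ℂ (fun s => zetaEM m s 1) s := by
  have h1 : (fun s => zetaEM m s 1) = _ := funext (zetaEM_one m)
  rw [h1]
  have hf : ∀ r, DifferentiableAt ℂ (fun s => fallFac r (-s)) s := fun r =>
    DifferentiableAt.comp (f := fun s : ℂ => -s) s (hasDerivAt_fallFac r _).differentiableAt
      (by fun_prop)
  have hs' : 1 - s ≠ 0 := sub_ne_zero.2 hs1.symm
  refine DifferentiableAt.sub (DifferentiableAt.add ?_
    (DifferentiableAt.fun_sum fun r _ => (hf _).const_mul _))
    (((hf m).mul (differentiableAt_integral_perBernoulli m hs)).const_mul _)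
  exact DifferentiableAt.div (by fun_prop) (by fun_prop) hs'

theorem riemannZeta_eq_zetaEM {m : ℕ} (hm : 1 ≤ m) {s : ℂ} (hs1 : s.re < 1) (hs : 1 - m < s.re) :
    riemannZeta s = -zetaEM m s 1 := by
  have hm' : (1 : ℝ) ≤ m := by exact_mod_cast hm
  set U₁ : Set ℂ := {s | 1 < s.re}
  -- This piece joins the half plane of convergence to the strip left of Re s = 1 through the upper
  -- half plane, going around the pole at 1.
  set U₂ : Set ℂ := {s | 1 - m < s.re} ∩ {s | 0 < s.im}
  set U₃ : Set ℂ := {s | 1 - m < s.re} ∩ {s | s.re < 1}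
  set U := U₁ ∪ U₂ ∪ U₃ with hU
  have hpre : IsPreconnected U := by
    have h1 : IsPreconnected U₁ := (convex_halfSpace_re_gt 1).isPreconnected
    have h2 : IsPreconnected U₂ :=
      ((convex_halfSpace_re_gt _).inter (convex_halfSpace_im_gt _)).isPreconnected
    have h3 : IsPreconnected U₃ :=
      ((convex_halfSpace_re_gt _).inter (convex_halfSpace_re_lt _)).isPreconnected
    have h12 : IsPreconnected (U₁ ∪ U₂) := by
      refine h1.union (⟨2, 1⟩ : ℂ) ?_ ?_ h2
      · change (1 : ℝ) < 2; norm_num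
      · refine ⟨?_, ?_⟩
        · change 1 - (m : ℝ) < 2; linarith
        · change (0 : ℝ) < 1; norm_num
    refine h12.union (⟨s.re, 1⟩ : ℂ) (Or.inr ⟨hs, ?_⟩) ⟨hs, hs1⟩ h3
    change (0 : ℝ) < 1; norm_num
  have hopen : IsOpen U := by
    have hg : ∀ a : ℝ, IsOpen {s : ℂ | a < s.re} := fun a =>
      isOpen_lt continuous_const Complex.continuous_re
    exact ((hg 1).union ((hg _).inter (isOpen_lt continuous_const Complex.continuous_im))).union
      ((hg _).inter (isOpen_lt Complex.continuous_re continuous_const))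
  have hmem : ∀ z ∈ U, z ≠ 1 ∧ 1 - m < z.re := by
    rintro z ((h | h) | h)
    · have h' : 1 < z.re := h
      exact ⟨by rintro rfl; simp at h', by linarith⟩
    · refine ⟨?_, h.1⟩
      rintro rfl
      exact absurd h.2 (by simp)
    · refine ⟨?_, h.1⟩
      rintro rfl
      exact absurd h.2 (by simp)
  have hζ : AnalyticOnNhd ℂ riemannZeta U := DifferentiableOn.analyticOnNhd (fun z hz =>
    (differentiableAt_riemannZeta (hmem z hz).1).differentiableWithinAt) hopen
  have hE : AnalyticOnNhd ℂ (fun s => -zetaEM m s 1) U := DifferentiableOn.analyticOnNhd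
    (fun z hz => (differentiableAt_zetaEM m (hmem z hz).1 (hmem z hz).2).neg.differentiableWithinAt)
    hopen
  have h2 : (2 : ℂ) ∈ U₁ := by
    change 1 < (2 : ℂ).re; norm_num
  refine hζ.eqOn_of_preconnected_of_eventuallyEq hE hpre (Or.inl (Or.inl h2)) ?_
    (Or.inr ⟨hs, hs1⟩)
  filter_upwards [(isOpen_lt continuous_const Complex.continuous_re).mem_nhds h2] with z hz
  exact riemannZeta_eq_zetaEM_of_one_lt hm hz

/-- Differentiates the continued formula at s = -j, where d/ds of u^(-s) is -u^j log u. The point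
lies in the region of validity 1 - m < Re s because j + 2 ≤ m. -/
theorem hurwitzDeriv_one {j m : ℕ} (h : j + 2 ≤ m) :
    hurwitzDeriv m j 1 = deriv riemannZeta (-(j : ℂ)) := by
  have hre : (-(j : ℂ)).re = -j := by simp
  have hj0 : (0 : ℝ) ≤ j := Nat.cast_nonneg j
  have hmj : (j : ℝ) + 2 ≤ m := by exact_mod_cast h
  have heq : riemannZeta =ᶠ[𝓝 (-(j : ℂ))] fun s => -zetaEM m s 1 := by
    have h1 : ∀ᶠ s : ℂ in 𝓝 (-(j : ℂ)), s.re < 1 :=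
      (isOpen_lt Complex.continuous_re continuous_const).mem_nhds (by
        change (-(j : ℂ)).re < 1; rw [hre]; linarith)
    have h2 : ∀ᶠ s : ℂ in 𝓝 (-(j : ℂ)), 1 - m < s.re :=
      (isOpen_lt continuous_const Complex.continuous_re).mem_nhds (by
        change 1 - m < (-(j : ℂ)).re; rw [hre]; linarith)
    filter_upwards [h1, h2] with s hs1 hs2 using riemannZeta_eq_zetaEM (by omega) hs1 hs2
  rw [heq.deriv_eq]
  have hff : ∀ r, HasDerivAt (fun s => fallFac r (-s)) (-fallFacDeriv r j) (-(j : ℂ)) := by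
    intro r
    have h1 := hasDerivAt_fallFac r (- -(j : ℂ))
    have h2 := h1.comp (-(j : ℂ)) (hasDerivAt_neg (-(j : ℂ)))
    rw [neg_neg, mul_neg_one] at h2
    exact h2
  have hne : 1 - -(j : ℂ) ≠ 0 := by
    rw [sub_neg_eq_add]; exact_mod_cast (by omega : 1 + j ≠ 0)
  have hA : HasDerivAt (fun s : ℂ => 1 / (1 - s)) (1 / (1 - -(j : ℂ)) ^ 2) (-(j : ℂ)) := by
    have h1 := ((hasDerivAt_id (-(j : ℂ))).const_sub 1).fun_inv hne
    simp only [id, neg_neg] at h1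
    simpa [one_div] using h1
  have hI := (differentiableAt_integral_perBernoulli m (s := -(j : ℂ)) (by
    rw [hre]; linarith)).hasDerivAt
  have hE := ((hA.add (HasDerivAt.fun_sum (u := Finset.Icc 1 m) fun r _ =>
    (hff (r - 1)).const_mul ((bernoulli r : ℂ) / (r.factorial : ℂ)))).sub
    (((hff m).mul hI).const_mul ((-1) ^ (m - 1) / (m.factorial : ℂ)))).neg
  have h1 : (fun s => -zetaEM m s 1) = _ := funext fun s => congrArg Neg.neg (zetaEM_one m s)
  rw [h1]
  refine Eq.trans ?_ hE.deriv.symm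
  -- This zero removes the derivative of the integral with respect to s; only the derivative of the
  -- factor in front of it contributes.
  have hz : fallFac m (- -(j : ℂ)) = 0 := by
    rw [neg_neg]; exact fallFac_natCast_eq_zero (by omega)
  have hint : ∫ t in Set.Ioi (0 : ℝ), perBernoulli m t * powLogDer j m (1 + t) =
      fallFacDeriv m j * ∫ t in Set.Ioi (0 : ℝ), perBernoulli m t * (1 + (t : ℂ)) ^ (- -(j : ℂ) - m) := by
    rw [← integral_const_mul]
    congr 1
    funext t
    rw [powLogDer_of_lt (by omega), neg_neg]
    push_cast
    ring
  rw [hz, hurwitzDeriv, emFun, hint]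
  simp only [powLogPrim, powLogDer, Complex.log_one, mul_zero, one_zpow, one_pow, mul_one, add_zero,
    zero_sub, zero_mul, mul_neg, Finset.sum_neg_distrib]
  rw [sub_neg_eq_add, add_comm (1 : ℂ) (j : ℂ)]
  ring

/-! ### The coefficients of `binom(z - u, n)` -/

/-- The coefficient of `u ^ j` in `binom(z - u, k)`, as a polynomial in `z`. -/
def shiftPoly (k j : ℕ) : Polynomial ℂ :=
  Polynomial.C ((-1) ^ j) * Polynomial.hasseDeriv j (binomPoly k)

theorem eval_shiftPoly (k j : ℕ) (z : ℂ) : (shiftPoly k j).eval z = binomShiftCoeff (k + 1) j z := by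
  have h : (binomPoly k).comp (Polynomial.C z - Polynomial.X) =
      (Polynomial.taylor z (binomPoly k)).comp (Polynomial.C (-1) * Polynomial.X) := by
    rw [Polynomial.taylor_apply, Polynomial.comp_assoc]
    congr 1
    simp only [Polynomial.add_comp, Polynomial.X_comp, Polynomial.C_comp, map_neg, map_one]
    ring
  rw [binomShiftCoeff, Nat.add_sub_cancel, h, Polynomial.comp_C_mul_X_coeff, Polynomial.taylor_coeff,
    shiftPoly, Polynomial.eval_mul, Polynomial.eval_C, mul_comm]

theorem natDegree_shiftPoly_le (k j : ℕ) : (shiftPoly k j).natDegree ≤ k - j := by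
  refine (Polynomial.natDegree_C_mul_le _ _).trans ((Polynomial.natDegree_hasseDeriv_le _ _).trans ?_)
  exact Nat.sub_le_sub_right (natDegree_binomPoly_le k) j

theorem negDerivBinom_eq (j k : ℕ) (z : ℂ) :
    negDerivBinom j k z = (j.factorial : ℂ) * binomShiftCoeff (k + 1) j z := by
  have h : Polynomial.derivative^[j] (binomPoly k) =
      j.factorial • Polynomial.hasseDeriv j (binomPoly k) :=
    (congrFun (Polynomial.factorial_smul_hasseDeriv (R := ℂ) (k := j)) (binomPoly k)).symm
  rw [negDerivBinom, ← eval_shiftPoly, shiftPoly, h, Polynomial.eval_smul, Polynomial.eval_mul,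
    Polynomial.eval_C, nsmul_eq_mul]
  ring

theorem natDegree_binomPoly_comp_le (k : ℕ) (z : ℂ) :
    ((binomPoly k).comp (Polynomial.C z - Polynomial.X)).natDegree ≤ k := by
  refine Polynomial.natDegree_comp_le.trans ?_
  have h1 : (Polynomial.C z - Polynomial.X : Polynomial ℂ).natDegree ≤ 1 :=
    (Polynomial.natDegree_sub_le _ _).trans (by simp)
  calc _ ≤ k * 1 := Nat.mul_le_mul (natDegree_binomPoly_le k) h1
    _ = k := mul_one k

theorem cbinom_sub (k : ℕ) (z u : ℂ) :
    cbinom (z - u) k = ∑ j ∈ Finset.range (k + 1), binomShiftCoeff (k + 1) j z * u ^ j := by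
  have h := Polynomial.eval_eq_sum_range' (Nat.lt_succ_of_le (natDegree_binomPoly_comp_le k z)) u
  simpa [binomShiftCoeff, cbinom, Polynomial.eval_comp] using h

theorem binomShiftCoeff_eq_zero {k j : ℕ} (h : k < j) (z : ℂ) : binomShiftCoeff (k + 1) j z = 0 :=
  Polynomial.coeff_eq_zero_of_natDegree_lt ((natDegree_binomPoly_comp_le k z).trans_lt h)

theorem binomShiftCoeff_add_one (k j : ℕ) (z : ℂ) :
    binomShiftCoeff (k + 2) j (z + 1) =
      binomShiftCoeff (k + 1) j z + binomShiftCoeff (k + 2) j z := by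
  have h : (binomPoly (k + 1)).comp (Polynomial.C (z + 1) - Polynomial.X) =
      (binomPoly k).comp (Polynomial.C z - Polynomial.X) +
        (binomPoly (k + 1)).comp (Polynomial.C z - Polynomial.X) := by
    refine Polynomial.funext fun u => ?_
    have := cbinom_add_one (z - u) k
    simp only [cbinom] at this
    simp only [Polynomial.eval_comp, Polynomial.eval_add, Polynomial.eval_sub, Polynomial.eval_C,
      Polynomial.eval_X]
    rw [← this]
    congr 1
    ring
  simp only [binomShiftCoeff, Nat.add_sub_cancel, show k + 2 - 1 = k + 1 from rfl]
  rw [h, Polynomial.coeff_add]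

theorem binomShiftCoeff_one_zero (z : ℂ) : binomShiftCoeff 1 0 z = 1 := by
  have := cbinom_sub 0 z 0
  simpa [cbinom, binomPoly] using this.symm

/-! ### The Euler–Maclaurin expression for the logarithm of a multiple gamma function -/

/-- The Euler–Maclaurin expression for `log G_{k+1}(z+1)`. -/
def gammaEM (m k : ℕ) (z : ℂ) : ℂ :=
  ∑ j ∈ Finset.range (k + 1), binomShiftCoeff (k + 1) j z *
    (hurwitzDeriv m j (z + 1) - hurwitzDeriv m j 1)

theorem gammaEM_zero (m k : ℕ) : gammaEM m k 0 = 0 := by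
  simp [gammaEM]

theorem gammaEM_zero_add_one {m : ℕ} (hm : 2 ≤ m) {z : ℂ} (hz : z ∈ cutPlane) :
    gammaEM m 0 (z + 1) - gammaEM m 0 z = Complex.log (z + 1) := by
  have h := hurwitzDeriv_add_one (j := 0) (m := m) (by omega) hz
  simp only [pow_zero, one_mul] at h
  simp only [gammaEM, zero_add, Finset.sum_range_one, binomShiftCoeff_one_zero, one_mul]
  rw [← h]
  ring

/-- Passing to z + 1 adds (z+1)^j log(z+1) to each Hurwitz term. With the coefficients these sum to
binom((z+1) - (z+1), k+1) log(z+1) = 0, and Pascal's rule for the coefficients gives the rest. -/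
theorem gammaEM_add_one {m k : ℕ} (hm : k + 3 ≤ m) {z : ℂ} (hz : z ∈ cutPlane) :
    gammaEM m (k + 1) (z + 1) - gammaEM m (k + 1) z = gammaEM m k z := by
  have h1 : ∀ j ∈ Finset.range (k + 2), binomShiftCoeff (k + 2) j (z + 1) *
        (hurwitzDeriv m j (z + 1 + 1) - hurwitzDeriv m j 1) -
      binomShiftCoeff (k + 2) j z * (hurwitzDeriv m j (z + 1) - hurwitzDeriv m j 1) =
      binomShiftCoeff (k + 2) j (z + 1) * (z + 1) ^ j * Complex.log (z + 1) +
        binomShiftCoeff (k + 1) j z * (hurwitzDeriv m j (z + 1) - hurwitzDeriv m j 1) := by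
    intro j hj
    have hj' := Finset.mem_range.1 hj
    have h := hurwitzDeriv_add_one (j := j) (m := m) (by omega) hz
    rw [sub_eq_iff_eq_add] at h
    rw [h, binomShiftCoeff_add_one]
    ring
  have h2 := cbinom_sub (k + 1) (z + 1) (z + 1)
  rw [sub_self, cbinom_zero_left] at h2
  rw [gammaEM, gammaEM, ← Finset.sum_sub_distrib, Finset.sum_congr rfl h1, Finset.sum_add_distrib,
    ← Finset.sum_mul, ← h2, zero_mul, zero_add, Finset.sum_range_succ,
    binomShiftCoeff_eq_zero (Nat.lt_succ_self k), zero_mul, add_zero, gammaEM]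

/-! ### Decay of the interpolation errors -/

theorem exists_norm_eval_le {p : Polynomial ℂ} {d : ℕ} (hp : p.natDegree ≤ d) :
    ∃ C, 0 ≤ C ∧ ∀ (w : ℂ) (R : ℝ), 1 ≤ R → ‖w‖ ≤ R → ‖p.eval w‖ ≤ C * R ^ d := by
  refine ⟨∑ i ∈ Finset.range (d + 1), ‖p.coeff i‖, Finset.sum_nonneg fun _ _ => norm_nonneg _,
    fun w R hR hw => ?_⟩
  rw [Polynomial.eval_eq_sum_range' (Nat.lt_succ_of_le hp), Finset.sum_mul]
  refine norm_sum_le_of_le _ fun i hi => ?_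
  have hi' : i ≤ d := Nat.lt_succ_iff.1 (Finset.mem_range.1 hi)
  rw [norm_mul, norm_pow]
  gcongr
  exact (pow_le_pow_left₀ (norm_nonneg w) hw i).trans (pow_le_pow_right₀ hR hi')

theorem half_le_re_of_mem_ball {x : ℝ} {w : ℂ} (hw : w ∈ Metric.ball (x : ℂ) (x / 2)) :
    x / 2 ≤ w.re := by
  have h1 : ‖w - x‖ < x / 2 := by simpa [dist_eq_norm] using hw
  have h2 := Complex.abs_re_le_norm (w - x)
  rw [Complex.sub_re, Complex.ofReal_re] at h2
  have := (abs_lt.1 (h2.trans_lt h1)).1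
  linarith

theorem norm_le_of_mem_ball {x : ℝ} (hx : 0 ≤ x) {w : ℂ} (hw : w ∈ Metric.ball (x : ℂ) (x / 2)) :
    ‖w‖ ≤ 2 * x := by
  have h1 : ‖w - x‖ < x / 2 := by simpa [dist_eq_norm] using hw
  have h2 := norm_le_norm_add_norm_sub' w x
  rw [Complex.norm_real, Real.norm_of_nonneg hx] at h2
  linarith

/-- On discs of radius N/2 the error gains N^(-n-1), so growth of order N^n leaves O(1/N). The
function may depend on N, which permits subtracting a polynomial for each N. -/
theorem tendsto_newtonRem_of_norm_le (n : ℕ) (z : ℂ) {g : ℕ → ℂ → ℂ} {C : ℝ}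
    (hd : ∀ N : ℕ, 1 ≤ N → DifferentiableOn ℂ (g N) (Metric.ball (N : ℂ) (N / 2)))
    (hC : ∀ N : ℕ, 1 ≤ N → ∀ w ∈ Metric.ball (N : ℂ) (N / 2), ‖g N w‖ ≤ C * (N : ℝ) ^ n) :
    Tendsto (fun N : ℕ => newtonRem n (g N) z N) atTop (𝓝 0) := by
  set ρ : ℝ := max ‖z‖ n
  obtain ⟨B, hB0, hB⟩ := exists_newtonRem_bound n ρ (le_max_right _ _)
  obtain ⟨K, hK⟩ := exists_nat_gt (2 * ρ)
  have hlim : Tendsto (fun N : ℕ => B * C * 2 ^ (n + 1) * ((N : ℝ))⁻¹) atTop (𝓝 0) := by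
    simpa using (tendsto_inv_atTop_zero.comp tendsto_natCast_atTop_atTop).const_mul
      (B * C * 2 ^ (n + 1))
  refine squeeze_zero_norm' ?_ hlim
  filter_upwards [eventually_ge_atTop K, eventually_ge_atTop 1] with N hN hN1
  have hN' : (K : ℝ) ≤ N := by exact_mod_cast hN
  have hN0 : (0 : ℝ) < N := by exact_mod_cast hN1
  refine (hB (g N) N z (N / 2) (C * (N : ℝ) ^ n) (by linarith) (le_max_left _ _) (hd N hN1)
    (hC N hN1)).trans (le_of_eq ?_)
  rw [div_pow]
  field_simp
  ring

theorem tendsto_newtonRem_eval_mul_log {n : ℕ} {p : Polynomial ℂ} (hp : p.natDegree ≤ n) (z : ℂ) :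
    Tendsto (fun N : ℕ => newtonRem n (fun w => p.eval w * Complex.log (w + 1)) z N) atTop
      (𝓝 0) := by
  obtain ⟨A, hA0, hA⟩ := exists_norm_eval_le hp
  -- Since log(N+1) p has no error, log(w+1) may be replaced by log(w+1) - log(N+1), which is at
  -- most 1 on the disc; this saves the factor log N.
  have heq : ∀ N : ℕ, newtonRem n (fun w => p.eval w * Complex.log (w + 1)) z N =
      newtonRem n (fun w => p.eval w * (Complex.log (w + 1) - Complex.log (N + 1))) z N := by
    intro N
    have h1 := newtonRem_sub n (fun w => p.eval w * Complex.log (w + 1))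
      (fun w => Complex.log (N + 1) * p.eval w) z N
    rw [newtonRem_const_mul, newtonRem_poly hp, mul_zero, sub_zero] at h1
    rw [← h1]
    congr 1
    funext w
    ring
  simp only [heq]
  have hre : ∀ (N : ℕ), 1 ≤ N → ∀ w ∈ Metric.ball (N : ℂ) (N / 2), (N : ℝ) / 2 ≤ w.re :=
    fun N _ w hw => half_le_re_of_mem_ball (x := N) (by simpa using hw)
  refine tendsto_newtonRem_of_norm_le n z (C := A * 2 ^ n) (fun N hN w hw => ?_) fun N hN w hw => ?_
  · have hN0 : (0 : ℝ) < N := by exact_mod_cast hN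
    refine DifferentiableAt.differentiableWithinAt ?_
    refine p.differentiable.differentiableAt.mul
      (DifferentiableAt.sub_const (DifferentiableAt.clog (by fun_prop) (Or.inl ?_)) _)
    rw [Complex.add_re, Complex.one_re]
    linarith [hre N hN w hw]
  · have hN1 : (1 : ℝ) ≤ N := by exact_mod_cast hN
    have h1 := hA w (2 * N) (by linarith)
      (norm_le_of_mem_ball (x := N) (by linarith) (by simpa using hw))
    have h2 : ‖Complex.log (w + 1) - Complex.log (N + 1)‖ ≤ 1 := by
      have hder : ∀ y ∈ Metric.ball (N : ℂ) (N / 2),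
          HasDerivAt (fun y => Complex.log (y + 1)) (1 / (y + 1)) y := by
        intro y hy
        refine HasDerivAt.clog ((hasDerivAt_id y).add_const 1) (Or.inl ?_)
        rw [Complex.add_re, Complex.one_re]
        linarith [hre N hN y hy]
      have hb : ∀ y ∈ Metric.ball (N : ℂ) (N / 2),
          ‖deriv (fun y => Complex.log (y + 1)) y‖ ≤ 2 / N := by
        intro y hy
        rw [(hder y hy).deriv, norm_div, norm_one]
        rw [div_le_div_iff₀ (norm_pos_iff.2 ?_) (by linarith)]
        · have h3 := Complex.re_le_norm (y + 1)
          rw [Complex.add_re, Complex.one_re] at h3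
          linarith [hre N hN y hy]
        · intro h0
          have := congrArg Complex.re h0
          rw [Complex.add_re, Complex.one_re, Complex.zero_re] at this
          linarith [hre N hN y hy]
      have h5 := (convex_ball (N : ℂ) ((N : ℝ) / 2)).norm_image_sub_le_of_norm_deriv_le
        (fun y hy => (hder y hy).differentiableAt) hb
        (Metric.mem_ball_self (by linarith)) hw
      refine h5.trans ?_
      have h6 : ‖w - N‖ ≤ N / 2 := by simpa [dist_eq_norm] using (Metric.mem_ball.1 hw).le
      calc 2 / (N : ℝ) * ‖w - N‖ ≤ 2 / N * (N / 2) := by gcongr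
        _ = 1 := by field_simp
    calc _ = ‖p.eval w‖ * ‖Complex.log (w + 1) - Complex.log (N + 1)‖ := norm_mul _ _
      _ ≤ A * (2 * N) ^ n * 1 := by gcongr
      _ = _ := by ring

theorem norm_zpow_le_of_le {u : ℂ} {x : ℝ} (hx : 1 ≤ x) (h1 : x / 2 ≤ ‖u‖) (h2 : ‖u‖ ≤ 3 * x)
    (i : ℤ) : ‖u ^ i‖ ≤ 3 ^ i.natAbs * x ^ i := by
  rw [norm_zpow]
  have hx0 : 0 < x := by linarith
  have hu0 : 0 < ‖u‖ := by linarith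
  obtain ⟨k, rfl | rfl⟩ := Int.eq_nat_or_neg i
  · simp only [zpow_natCast, Int.natAbs_natCast]
    rw [← mul_pow]
    gcongr
  · simp only [zpow_neg, zpow_natCast, Int.natAbs_neg, Int.natAbs_natCast]
    rw [← inv_pow, ← inv_pow, ← mul_pow]
    gcongr
    rw [← div_eq_mul_inv, inv_eq_one_div, div_le_div_iff₀ hu0 hx0]
    linarith

theorem tendsto_newtonRem_eval_mul_zpow {n d : ℕ} {i : ℤ} {p : Polynomial ℂ}
    (hp : p.natDegree ≤ d) (hi : (d : ℤ) + i ≤ n) (z : ℂ) :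
    Tendsto (fun N : ℕ => newtonRem n (fun w => p.eval w * (w + 1) ^ i) z N) atTop (𝓝 0) := by
  obtain ⟨A, hA0, hA⟩ := exists_norm_eval_le hp
  have hre : ∀ (N : ℕ), 1 ≤ N → ∀ w ∈ Metric.ball (N : ℂ) (N / 2), (N : ℝ) / 2 ≤ (w + 1).re := by
    intro N _ w hw
    have := half_le_re_of_mem_ball (x := N) (by simpa using hw)
    rw [Complex.add_re, Complex.one_re]
    linarith
  refine tendsto_newtonRem_of_norm_le n z (C := A * 2 ^ d * 3 ^ i.natAbs) (fun N hN w hw => ?_)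
    fun N hN w hw => ?_
  · have hN0 : (0 : ℝ) < N := by exact_mod_cast hN
    refine DifferentiableAt.differentiableWithinAt ?_
    refine p.differentiable.differentiableAt.mul (DifferentiableAt.zpow (by fun_prop) (Or.inl ?_))
    intro h0
    have := hre N hN w hw
    rw [h0, Complex.zero_re] at this
    linarith
  · have hN1 : (1 : ℝ) ≤ N := by exact_mod_cast hN
    have hN0 : (0 : ℝ) < N := by linarith
    have hnorm := norm_le_of_mem_ball (x := N) hN0.le (by simpa using hw)
    have h1 := hA w (2 * N) (by linarith) hnorm
    have h2 := norm_zpow_le_of_le hN1 ((hre N hN w hw).trans (Complex.re_le_norm _))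
      ((norm_add_le w 1).trans (by rw [norm_one]; linarith)) i
    calc _ = ‖p.eval w‖ * ‖(w + 1) ^ i‖ := norm_mul _ _
      _ ≤ A * (2 * N) ^ d * (3 ^ i.natAbs * (N : ℝ) ^ i) := by gcongr
      _ = A * 2 ^ d * 3 ^ i.natAbs * ((N : ℝ) ^ d * (N : ℝ) ^ i) := by ring
      _ ≤ _ := by
        gcongr
        rw [← zpow_natCast (N : ℝ) d, ← zpow_add₀ hN0.ne', ← zpow_natCast (N : ℝ) n]
        exact zpow_le_zpow_right₀ hN1 hi

theorem tendsto_newtonRem_of_tendsto {n : ℕ} {z : ℂ} {f : ℂ → ℂ}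
    (h : ∀ y, Tendsto (fun N : ℕ => f (N + y)) atTop (𝓝 0)) :
    Tendsto (fun N : ℕ => newtonRem n f z N) atTop (𝓝 0) := by
  simp only [newtonRem, fwdDiff_iter_eq_sum_shift]
  have h1 := (h z).sub (tendsto_finsetSum (Finset.range (n + 1)) fun j _ =>
    (tendsto_finsetSum (Finset.range (j + 1)) fun k _ =>
      (h (k • (1 : ℂ))).const_smul ((-1) ^ (j - k) * (j.choose k : ℤ))).const_mul (cbinom z j))
  simpa using h1

theorem tendsto_newtonRem_finset_sum {ι : Type*} (s : Finset ι) {n : ℕ} {f : ι → ℂ → ℂ} {z : ℂ}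
    (h : ∀ i ∈ s, Tendsto (fun N : ℕ => newtonRem n (f i) z N) atTop (𝓝 0)) :
    Tendsto (fun N : ℕ => newtonRem n (fun w => ∑ i ∈ s, f i w) z N) atTop (𝓝 0) := by
  simp only [newtonRem_sum]
  simpa using tendsto_finsetSum s h

theorem tendsto_newtonRem_add {n : ℕ} {f g : ℂ → ℂ} {z : ℂ}
    (hf : Tendsto (fun N : ℕ => newtonRem n f z N) atTop (𝓝 0))
    (hg : Tendsto (fun N : ℕ => newtonRem n g z N) atTop (𝓝 0)) :
    Tendsto (fun N : ℕ => newtonRem n (fun w => f w + g w) z N) atTop (𝓝 0) := by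
  simp only [newtonRem_add]
  simpa using hf.add hg

theorem tendsto_newtonRem_sub {n : ℕ} {f g : ℂ → ℂ} {z : ℂ}
    (hf : Tendsto (fun N : ℕ => newtonRem n f z N) atTop (𝓝 0))
    (hg : Tendsto (fun N : ℕ => newtonRem n g z N) atTop (𝓝 0)) :
    Tendsto (fun N : ℕ => newtonRem n (fun w => f w - g w) z N) atTop (𝓝 0) := by
  simp only [newtonRem_sub]
  simpa using hf.sub hg

theorem tendsto_newtonRem_const_mul {n : ℕ} {f : ℂ → ℂ} {z : ℂ} (c : ℂ)
    (hf : Tendsto (fun N : ℕ => newtonRem n f z N) atTop (𝓝 0)) :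
    Tendsto (fun N : ℕ => newtonRem n (fun w => c * f w) z N) atTop (𝓝 0) := by
  simp only [newtonRem_const_mul]
  simpa using hf.const_mul c

theorem tendsto_newtonRem_eval_mul_pow_mul_log {n d i : ℕ} {p : Polynomial ℂ}
    (hp : p.natDegree ≤ d) (hi : d + i ≤ n) (z : ℂ) :
    Tendsto (fun N : ℕ => newtonRem n
      (fun w => p.eval w * (w + 1) ^ i * Complex.log (w + 1)) z N) atTop (𝓝 0) := by
  have hq : (p * (Polynomial.X + Polynomial.C 1) ^ i).natDegree ≤ n := by
    refine (Polynomial.natDegree_mul_le_of_le hp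
      (Polynomial.natDegree_pow_le_of_le i (Polynomial.natDegree_X_add_C 1).le)).trans ?_
    omega
  have := tendsto_newtonRem_eval_mul_log hq z
  simpa using this

/-- The coefficient is O(N^(k-j)) and the integral O(N^(j-m+1)). The product is O(N^(k+1-m)), hence
O(1/N) for m ≥ k + 2. -/
theorem tendsto_shiftPoly_mul_integral {m k j : ℕ} (hj : j ≤ k) (hm : k + 2 ≤ m) (y : ℂ) :
    Tendsto (fun N : ℕ => (shiftPoly k j).eval (N + y) *
      ∫ t in Set.Ioi (0 : ℝ), perBernoulli m t * powLogDer j m (N + y + 1 + t)) atTop (𝓝 0) := by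
  obtain ⟨A, hA0, hA⟩ := exists_norm_eval_le (natDegree_shiftPoly_le k j)
  have hp : ((((j : ℤ) - m : ℤ) : ℂ)).re < -1 := by
    rw [Complex.intCast_re]
    exact_mod_cast (by omega : (j : ℤ) - m < -1)
  obtain ⟨C, hC0, hC⟩ := exists_norm_integral_perBernoulli_le m hp
  rw [Complex.intCast_re] at hC
  have hint : ∀ w : ℂ, ∫ t in Set.Ioi (0 : ℝ), perBernoulli m t * powLogDer j m (w + t) =
      fallFacDeriv m j * ∫ t in Set.Ioi (0 : ℝ),
        perBernoulli m t * (w + t) ^ (((j : ℤ) - m : ℤ) : ℂ) := by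
    intro w
    rw [← integral_const_mul]
    congr 1
    funext t
    rw [powLogDer_of_lt (by omega)]
    ring
  set D := A * ‖fallFacDeriv m j‖ * C * 2 ^ (k - j) * (2 ^ (m - j - 1)) with hD
  obtain ⟨K, hK⟩ := exists_nat_gt (2 * ‖y‖ + 1)
  have hlim : Tendsto (fun N : ℕ => D * ((N : ℝ))⁻¹) atTop (𝓝 0) := by
    simpa using (tendsto_inv_atTop_zero.comp tendsto_natCast_atTop_atTop).const_mul D
  refine squeeze_zero_norm' ?_ hlim
  filter_upwards [eventually_ge_atTop K] with N hN
  have hN' : (K : ℝ) ≤ N := by exact_mod_cast hN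
  have hy0 := norm_nonneg y
  have hN1 : (1 : ℝ) ≤ N := by linarith
  have hN0 : (0 : ℝ) < N := by linarith
  have h1 := hA (N + y) (2 * N) (by linarith) (by
    refine (norm_add_le _ _).trans ?_
    rw [Complex.norm_natCast]
    linarith)
  have h2 := hC (N + y + 1) (N / 2) (by linarith) (by
    have := neg_abs_le y.re
    have := Complex.abs_re_le_norm y
    simp only [Complex.add_re, Complex.natCast_re, Complex.one_re]
    linarith)
  have h3 : ((N : ℝ) / 2) ^ ((((j : ℤ) - m : ℤ) : ℝ) + 1) = 2 ^ (m - j - 1) * (N : ℝ)⁻¹ ^ (m - j - 1) := by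
    have : ((((j : ℤ) - m : ℤ) : ℝ) + 1) = -((m - j - 1 : ℕ) : ℝ) := by
      have : ((m - j - 1 : ℕ) : ℤ) = m - j - 1 := by omega
      have : ((m - j - 1 : ℕ) : ℝ) = m - j - 1 := by exact_mod_cast this
      rw [this]
      push_cast
      ring
    rw [this, Real.rpow_neg (by positivity), Real.rpow_natCast, ← inv_pow, ← mul_pow, inv_div,
      div_eq_mul_inv]
  have h4 : (N : ℝ) ^ (k - j) * (N : ℝ)⁻¹ ^ (m - j - 1) ≤ (N : ℝ)⁻¹ := by
    have h5 : m - j - 1 = (k - j) + (m - k - 2) + 1 := by omega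
    rw [h5, pow_succ, pow_add, ← mul_assoc, ← mul_assoc, ← mul_pow, mul_inv_cancel₀ hN0.ne', one_pow,
      one_mul]
    exact mul_le_of_le_one_left (by positivity) (pow_le_one₀ (by positivity) (inv_le_one_of_one_le₀ hN1))
  rw [hint, norm_mul, norm_mul]
  calc _ ≤ A * (2 * N) ^ (k - j) * (‖fallFacDeriv m j‖ *
        (C * (2 ^ (m - j - 1) * (N : ℝ)⁻¹ ^ (m - j - 1)))) := by
        rw [h3] at h2
        gcongr
    _ = D * ((N : ℝ) ^ (k - j) * (N : ℝ)⁻¹ ^ (m - j - 1)) := by rw [hD]; ring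
    _ ≤ _ := by gcongr

/-- In each summand the coefficient has degree at most k - j and the power of w + 1 is at most j +
1, so the growth is within order k + 1, up to logarithms. The integral term itself tends to 0. -/
theorem tendsto_newtonRem_gammaEM {m k : ℕ} (hm : k + 2 ≤ m) (z : ℂ) :
    Tendsto (fun N : ℕ => newtonRem (k + 1) (gammaEM m k) z N) atTop (𝓝 0) := by
  have h0 : gammaEM m k = fun w => ∑ j ∈ Finset.range (k + 1),
      ((((j : ℂ) + 1)⁻¹ * ((shiftPoly k j).eval w * (w + 1) ^ (j + 1) * Complex.log (w + 1)) -
        (((j : ℂ) + 1) ^ 2)⁻¹ * ((shiftPoly k j).eval w * (w + 1) ^ ((j + 1 : ℕ) : ℤ)) +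
        ∑ r ∈ Finset.Icc 1 m, (bernoulli r : ℂ) / (r.factorial : ℂ) *
          (fallFacDeriv (r - 1) j * ((shiftPoly k j).eval w * (w + 1) ^ ((j : ℤ) - (r - 1 : ℕ))) +
            (shiftPoly k j).eval w * powDer j (r - 1) (w + 1) * Complex.log (w + 1)) -
        (-1) ^ (m - 1) / (m.factorial : ℂ) * ((shiftPoly k j).eval w *
          ∫ t in Set.Ioi (0 : ℝ), perBernoulli m t * powLogDer j m (w + 1 + t))) -
        hurwitzDeriv m j 1 * (shiftPoly k j).eval w) := by
    funext w
    rw [gammaEM]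
    refine Finset.sum_congr rfl fun j _ => ?_
    rw [← eval_shiftPoly, hurwitzDeriv, emFun]
    simp only [powLogPrim]
    have : ∑ r ∈ Finset.Icc 1 m, (bernoulli r : ℂ) / (r.factorial : ℂ) *
          (fallFacDeriv (r - 1) j * ((shiftPoly k j).eval w * (w + 1) ^ ((j : ℤ) - (r - 1 : ℕ))) +
            (shiftPoly k j).eval w * powDer j (r - 1) (w + 1) * Complex.log (w + 1)) =
        (shiftPoly k j).eval w * ∑ r ∈ Finset.Icc 1 m, (bernoulli r : ℂ) / (r.factorial : ℂ) *
          powLogDer j (r - 1) (w + 1) := by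
      rw [Finset.mul_sum]
      refine Finset.sum_congr rfl fun r _ => ?_
      rw [powLogDer]
      ring
    rw [this, zpow_natCast]
    simp only [div_eq_mul_inv]
    ring
  rw [h0]
  refine tendsto_newtonRem_finset_sum _ fun j hj => ?_
  have hjk : j ≤ k := Nat.lt_succ_iff.1 (Finset.mem_range.1 hj)
  have hdeg := natDegree_shiftPoly_le k j
  refine tendsto_newtonRem_sub (tendsto_newtonRem_sub (tendsto_newtonRem_add (tendsto_newtonRem_sub
    (tendsto_newtonRem_const_mul _ ?_) (tendsto_newtonRem_const_mul _ ?_))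
    (tendsto_newtonRem_finset_sum _ fun r _ => tendsto_newtonRem_const_mul _
      (tendsto_newtonRem_add (tendsto_newtonRem_const_mul _ ?_) ?_)))
    (tendsto_newtonRem_const_mul _ (tendsto_newtonRem_of_tendsto fun y =>
      tendsto_shiftPoly_mul_integral hjk hm y))) (tendsto_newtonRem_const_mul _ ?_)
  · exact tendsto_newtonRem_eval_mul_pow_mul_log hdeg (by omega) z
  · exact tendsto_newtonRem_eval_mul_zpow hdeg (by omega) z
  · exact tendsto_newtonRem_eval_mul_zpow hdeg (by omega) z
  -- Negative powers never occur next to the logarithm: the falling factorial vanishes when r - 1 >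
  -- j.
  · rcases lt_or_ge j (r - 1) with h | h
    · simp only [powDer, fallFac_natCast_eq_zero h, zero_mul, mul_zero]
      simpa using tendsto_const_nhds.congr fun N : ℕ => (newtonRem_const (k + 1) 0 z N).symm
    · have h1 := tendsto_newtonRem_const_mul (fallFac (r - 1) j)
        (tendsto_newtonRem_eval_mul_pow_mul_log (n := k + 1) (i := j - (r - 1)) hdeg (by omega) z)
      refine h1.congr fun N => congrArg (fun f => newtonRem (k + 1) f z N) (funext fun w => ?_)
      rw [powDer, ← zpow_natCast, Nat.cast_sub h]
      ring
  · simp only [newtonRem_poly (show (shiftPoly k j).natDegree ≤ k + 1 by omega)]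
    exact tendsto_const_nhds

theorem add_natCast_mem_cutPlane {z : ℂ} (hz : z ∈ cutPlane) (N : ℕ) : z + N ∈ cutPlane := by
  have := slitPlane_add_ofReal hz N.cast_nonneg
  change z + N + 1 ∈ Complex.slitPlane
  rw [Complex.ofReal_natCast] at this
  rwa [add_right_comm]

theorem zero_mem_cutPlane : (0 : ℂ) ∈ cutPlane := by
  simp [cutPlane]

/-- The function vanishes at all integer nodes, so its interpolation error at N is d(z + N) = d(z),
a constant sequence. No regularity of d is needed. -/
theorem eq_zero_of_periodic_of_tendsto_newtonRem {d : ℂ → ℂ} (h0 : d 0 = 0)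
    (hd : ∀ z ∈ cutPlane, d (z + 1) = d z) {n : ℕ} {z : ℂ} (hz : z ∈ cutPlane)
    (h : Tendsto (fun N : ℕ => newtonRem n d z N) atTop (𝓝 0)) : d z = 0 := by
  have hper : ∀ w ∈ cutPlane, ∀ N : ℕ, d (w + N) = d w := by
    intro w hw N
    induction N with
    | zero => simp
    | succ N ih =>
      rw [← ih, ← hd _ (add_natCast_mem_cutPlane hw N)]
      push_cast
      rw [add_assoc]
  have h1 : ∀ N : ℕ, newtonRem n d z N = d z := by
    intro N
    rw [newtonRem_eq_of_interp (p := 0) (by simp) (fun j _ => ?_), Polynomial.eval_zero, sub_zero,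
      add_comm, hper z hz]
    have := hper 0 zero_mem_cutPlane (N + j)
    rw [zero_add, h0] at this
    rw [Polynomial.eval_zero, ← this]
    push_cast
    rfl
  simp only [h1] at h
  exact tendsto_nhds_unique tendsto_const_nhds h

theorem gammaEM_eq_mgLog {m k : ℕ} (hm : k + 2 ≤ m) {z : ℂ} (hz : z ∈ cutPlane) :
    gammaEM m k z = mgLog k z := by
  have hlim : ∀ k, k + 2 ≤ m → ∀ z, Tendsto (fun N : ℕ =>
      newtonRem (k + 1) (fun w => gammaEM m k w - mgLog k w) z N) atTop (𝓝 0) := fun k hk z =>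
    tendsto_newtonRem_sub (tendsto_newtonRem_gammaEM hk z) (tendsto_newtonRem_mgLog k z)
  induction k generalizing z with
  | zero =>
    refine sub_eq_zero.1 (eq_zero_of_periodic_of_tendsto_newtonRem
      (d := fun w => gammaEM m 0 w - mgLog 0 w) (by simp [gammaEM_zero, mgLog_zero])
      (fun w hw => ?_) hz (hlim 0 hm z))
    linear_combination gammaEM_zero_add_one hm hw - mgLog_zero_add_one w
  | succ k ih =>
    refine sub_eq_zero.1 (eq_zero_of_periodic_of_tendsto_newtonRem
      (d := fun w => gammaEM m (k + 1) w - mgLog (k + 1) w) (by simp [gammaEM_zero, mgLog_zero])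
      (fun w hw => ?_) hz (hlim (k + 1) hm z))
    linear_combination gammaEM_add_one hm hw - mgLog_add_one k w + ih (by omega) hw

/-! ### The coefficient of the logarithm -/

theorem sum_Icc_one_eq_sum_range {M : Type*} [AddCommMonoid M] (f : ℕ → M) (n : ℕ) :
    ∑ r ∈ Finset.Icc 1 n, f r = ∑ i ∈ Finset.range n, f (i + 1) := by
  induction n with
  | zero => simp
  | succ n ih => rw [Finset.sum_Icc_succ_top (by omega), ih, Finset.sum_range_succ]

theorem eval_bernoulli_map (j : ℕ) (u : ℂ) :
    ((Polynomial.bernoulli (j + 1)).map (algebraMap ℚ ℂ)).eval u =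
      u ^ (j + 1) + ∑ i ∈ Finset.range (j + 1),
        (bernoulli (i + 1) : ℂ) * ((j + 1).choose (i + 1) : ℂ) * u ^ (j - i) := by
  rw [Polynomial.bernoulli, Polynomial.map_sum, Polynomial.eval_finsetSum,
    Finset.sum_range_succ', add_comm]
  simp [Polynomial.eval_monomial]

/-- This is the expansion of the Bernoulli polynomial B_{j+1}(u) / (j+1) without its constant term
in u, plus that constant from r = j + 1; larger r contribute 0. -/
theorem sum_bernoulli_powDer {j m : ℕ} (h : j < m) (u : ℂ) :
    u ^ (j + 1) / (j + 1) +
      ∑ r ∈ Finset.Icc 1 m, (bernoulli r : ℂ) / (r.factorial : ℂ) * powDer j (r - 1) u =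
      ((Polynomial.bernoulli (j + 1)).map (algebraMap ℚ ℂ)).eval u / (j + 1) := by
  have hj : ((j : ℂ) + 1) ≠ 0 := by exact_mod_cast j.succ_ne_zero
  rw [eval_bernoulli_map, add_div, sum_Icc_one_eq_sum_range, Finset.sum_div]
  congr 1
  have hsub : Finset.range (j + 1) ⊆ Finset.range m := Finset.range_subset_range.2 h
  rw [← Finset.sum_subset hsub]
  · refine Finset.sum_congr rfl fun i hi => ?_
    have hij : i ≤ j := Nat.lt_succ_iff.1 (Finset.mem_range.1 hi)
    have h1 : ((j : ℂ) + 1) * (j.descFactorial i : ℂ) =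
        ((i + 1).factorial : ℂ) * ((j + 1).choose (i + 1) : ℂ) := by
      have := Nat.succ_descFactorial_succ j i
      rw [Nat.descFactorial_eq_factorial_mul_choose] at this
      exact_mod_cast this.symm
    have h2 : ((i + 1).factorial : ℂ) ≠ 0 := by exact_mod_cast (i + 1).factorial_ne_zero
    rw [Nat.add_sub_cancel, powDer, fallFac, descPochhammer_eval_eq_descFactorial, ← Nat.cast_sub hij,
      zpow_natCast, eq_div_iff hj, div_mul_eq_mul_div, div_mul_eq_mul_div, div_eq_iff h2]
    linear_combination (bernoulli (i + 1) : ℂ) * u ^ (j - i) * h1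
  · intro i _ hi
    have hij : j < i := by simpa [Nat.lt_succ_iff] using hi
    rw [Nat.add_sub_cancel, powDer, fallFac_natCast_eq_zero hij, zero_mul, mul_zero]

theorem eval_bernoulli_natCast_sub (j N : ℕ) :
    (((Polynomial.bernoulli (j + 1)).map (algebraMap ℚ ℂ)).eval (N : ℂ) - (bernoulli (j + 1) : ℂ)) /
      (j + 1) = ∑ i ∈ Finset.range N, (i : ℂ) ^ j := by
  have hj : ((j : ℂ) + 1) ≠ 0 := by exact_mod_cast j.succ_ne_zero
  have h := congrArg (algebraMap ℚ ℂ) (Polynomial.sum_range_pow_eq_bernoulli_sub N j)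
  have h2 : ((Polynomial.bernoulli (j + 1)).map (algebraMap ℚ ℂ)).eval (N : ℂ) =
      algebraMap ℚ ℂ ((Polynomial.bernoulli (j + 1)).eval (N : ℚ)) := by
    rw [← Polynomial.eval_natCast_map]
  rw [div_eq_iff hj, h2]
  simp only [map_mul, map_add, map_sum, map_pow, map_natCast, map_one, map_sub,
    Nat.succ_eq_add_one] at h
  rw [mul_comm, h]
  rfl

/-- Both sides are polynomials in z. At z = N, Faulhaber's formula turns the left side into the sum
of binom(N - i, k) over i ≤ N, and the hockey-stick identity evaluates it. -/
theorem sum_shift_bernoulli (k : ℕ) (z : ℂ) :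
    ∑ j ∈ Finset.range (k + 1), binomShiftCoeff (k + 1) j z *
      ((((Polynomial.bernoulli (j + 1)).map (algebraMap ℚ ℂ)).eval (z + 1) -
        (bernoulli (j + 1) : ℂ)) / (j + 1)) = cbinom (z + 1) (k + 1) := by
  set P : Polynomial ℂ := ∑ j ∈ Finset.range (k + 1), shiftPoly k j *
    ((((Polynomial.bernoulli (j + 1)).map (algebraMap ℚ ℂ)).comp (Polynomial.X + Polynomial.C 1) -
      Polynomial.C (bernoulli (j + 1) : ℂ)) * Polynomial.C (((j : ℂ) + 1)⁻¹)) with hP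
  have hev : ∀ w, P.eval w = ∑ j ∈ Finset.range (k + 1), binomShiftCoeff (k + 1) j w *
      ((((Polynomial.bernoulli (j + 1)).map (algebraMap ℚ ℂ)).eval (w + 1) -
        (bernoulli (j + 1) : ℂ)) / (j + 1)) := by
    intro w
    rw [hP, Polynomial.eval_finsetSum]
    refine Finset.sum_congr rfl fun j _ => ?_
    simp only [Polynomial.eval_mul, Polynomial.eval_sub, Polynomial.eval_comp, Polynomial.eval_add,
      Polynomial.eval_X, Polynomial.eval_C, eval_shiftPoly, div_eq_mul_inv]
  have heq : P = (binomPoly (k + 1)).comp (Polynomial.X + Polynomial.C 1) := by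
    refine Polynomial.eq_of_infinite_eval_eq _ _ ((Set.infinite_range_of_injective
      (Nat.cast_injective (R := ℂ))).mono ?_)
    rintro _ ⟨N, rfl⟩
    have h1 : ∀ i ∈ Finset.range (N + 1),
        cbinom ((N : ℂ) - i) k = ((N - i).choose k : ℂ) := by
      intro i hi
      rw [← Nat.cast_sub (Nat.lt_succ_iff.1 (Finset.mem_range.1 hi)), cbinom_natCast]
    have h2 : ∑ i ∈ Finset.range (N + 1), cbinom ((N : ℂ) - i) k = cbinom ((N : ℂ) + 1) (k + 1) := by
      have h3 : ∀ M : ℕ, ∑ i ∈ Finset.range M, i.choose k = M.choose (k + 1) := by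
        intro M
        induction M with
        | zero => simp
        | succ M ih => rw [Finset.sum_range_succ, ih, Nat.choose_succ_succ, add_comm]
      have h4 := Finset.sum_range_reflect (fun i => i.choose k) (N + 1)
      simp only [Nat.add_sub_cancel] at h4
      rw [Finset.sum_congr rfl h1, ← Nat.cast_succ, cbinom_natCast, ← h3, ← h4, Nat.cast_sum]
    change P.eval (N : ℂ) = _
    rw [hev, Polynomial.eval_comp]
    simp only [Polynomial.eval_add, Polynomial.eval_X, Polynomial.eval_C]
    rw [← cbinom, ← h2]
    simp only [cbinom_sub]
    rw [Finset.sum_comm]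
    refine Finset.sum_congr rfl fun j _ => ?_
    rw [← Finset.mul_sum, ← eval_bernoulli_natCast_sub]
    push_cast
    rfl
  rw [← hev, heq, Polynomial.eval_comp, cbinom]
  simp

/-- The Bernoulli numbers subtracted in `sum_shift_bernoulli` are restored by the derivative terms,
since (-d/dz)^j binom(z, k) is j! times the j-th coefficient. -/
theorem log_coefficient {m k : ℕ} (hm : k < m) (z : ℂ) :
    cbinom (z + 1) (k + 1) + ∑ r ∈ Finset.Icc 1 (k + 1),
        (bernoulli r : ℂ) / (r.factorial : ℂ) * negDerivBinom (r - 1) k z =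
      ∑ j ∈ Finset.range (k + 1), binomShiftCoeff (k + 1) j z * ((z + 1) ^ (j + 1) / (j + 1) +
        ∑ r ∈ Finset.Icc 1 m, (bernoulli r : ℂ) / (r.factorial : ℂ) * powDer j (r - 1) (z + 1)) := by
  rw [← sum_shift_bernoulli, sum_Icc_one_eq_sum_range, ← Finset.sum_add_distrib]
  refine Finset.sum_congr rfl fun j hj => ?_
  have hjk := Finset.mem_range.1 hj
  have hj : ((j : ℂ) + 1) ≠ 0 := by exact_mod_cast j.succ_ne_zero
  have hf : (j.factorial : ℂ) ≠ 0 := by exact_mod_cast j.factorial_ne_zero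
  rw [sum_bernoulli_powDer (by omega), Nat.add_sub_cancel, negDerivBinom_eq, Nat.factorial_succ]
  push_cast
  field_simp
  ring

/-! ### The terms of the expansion -/

/-- Equal imaginary parts put both arguments in [0, π) or both in (-π, 0), so their difference stays
in (-π, π) and no multiple of 2πi appears. -/
theorem Complex.log_div_of_im_eq {u v : ℂ} (hu : u ∈ Complex.slitPlane)
    (hv : v ∈ Complex.slitPlane) (h : u.im = v.im) :
    Complex.log (v / u) = Complex.log v - Complex.log u := by
  have hu' := (Complex.mem_slitPlane_iff_arg.1 hu).1
  have hv' := (Complex.mem_slitPlane_iff_arg.1 hv).1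
  have hpu := lt_of_le_of_ne (Complex.arg_le_pi u) hu'
  have hpv := lt_of_le_of_ne (Complex.arg_le_pi v) hv'
  rw [div_eq_mul_inv, (Complex.log_mul_eq_add_log_iff (Complex.slitPlane_ne_zero hv)
    (inv_ne_zero (Complex.slitPlane_ne_zero hu))).2, Complex.log_inv u hu', sub_eq_add_neg]
  rw [Complex.arg_inv, if_neg hu', ← sub_eq_add_neg]
  rcases le_or_gt 0 u.im with h0 | h0
  · have h1 := Complex.arg_nonneg_iff.2 h0
    have h2 := Complex.arg_nonneg_iff.2 (h ▸ h0 : 0 ≤ v.im)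
    constructor <;> linarith
  · have h1 := Complex.arg_neg_iff.2 h0
    have h2 := Complex.arg_neg_iff.2 (h ▸ h0 : v.im < 0)
    have h3 := Complex.neg_pi_lt_arg u
    have h4 := Complex.neg_pi_lt_arg v
    constructor <;> linarith

/-- The `s`-th derivative of `t ↦ binom(-t, k) log ((z + t) / (z + 1))`. -/
def binomLogDer (k s : ℕ) (z : ℂ) (t : ℝ) : ℂ :=
  ∑ j ∈ Finset.range (k + 1), binomShiftCoeff (k + 1) j z *
    (powLogDer j s (z + t) - Complex.log (z + 1) * powDer j s (z + t))

/-- Writing -t = z - (z + t) expands the binomial in powers of z + t, so that all t-derivatives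
reduce to those of u^j and u^j log u. -/
theorem binomLog_eq (k : ℕ) {z : ℂ} (hz : z ∈ cutPlane) {t : ℝ} (ht : z + t ∈ Complex.slitPlane) :
    binomLog (k + 1) z t = binomLogDer k 0 z t := by
  rw [binomLog, Complex.log_div_of_im_eq hz ht (by simp), binomLogDer, Nat.add_sub_cancel,
    show -(t : ℂ) = z - (z + t) by ring, cbinom_sub, Finset.sum_mul]
  refine Finset.sum_congr rfl fun j _ => ?_
  simp only [powLogDer, powDer, fallFacDeriv_zero, fallFac_zero, Nat.cast_zero, sub_zero,
    zpow_natCast]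
  ring

theorem iteratedDeriv_binomLog (k s : ℕ) {z : ℂ} (hz : z ∈ cutPlane) {t : ℝ}
    (ht : z + t ∈ Complex.slitPlane) :
    iteratedDeriv s (binomLog (k + 1) z) t = binomLogDer k s z t := by
  have hopen : IsOpen {t : ℝ | z + t ∈ Complex.slitPlane} :=
    Complex.isOpen_slitPlane.preimage (by fun_prop)
  induction s generalizing t with
  | zero => rw [iteratedDeriv_zero, binomLog_eq k hz ht]
  | succ s ih =>
    have h1 : iteratedDeriv s (binomLog (k + 1) z) =ᶠ[𝓝 t] binomLogDer k s z := by
      filter_upwards [hopen.mem_nhds ht] with x hx using ih hx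
    rw [iteratedDeriv_succ, h1.deriv_eq]
    refine HasDerivAt.deriv (HasDerivAt.fun_sum fun j _ => HasDerivAt.const_mul _ ?_)
    have hline : HasDerivAt (fun t : ℝ => z + (t : ℂ)) 1 t := by
      simpa using (Complex.ofRealCLM.hasDerivAt (x := t)).const_add z
    have h2 := (hasDerivAt_powLogDer j s ht).comp t hline
    have h3 := (hasDerivAt_powDer j s (Complex.slitPlane_ne_zero ht)).comp t hline
    simp only [mul_one] at h2 h3
    exact h2.sub (h3.const_mul _)

theorem bernTerm_eq (k s : ℕ) {z : ℂ} (hz : z ∈ cutPlane) :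
    bernTerm (k + 1) s z = ∑ j ∈ Finset.range (k + 1), binomShiftCoeff (k + 1) j z *
      (powLogDer j s (z + 1) - Complex.log (z + 1) * powDer j s (z + 1)) := by
  rw [bernTerm, iteratedDeriv_binomLog k s hz (by
    rw [Complex.ofReal_one]; exact hz), binomLogDer]
  simp

/-- For m > k the m-th derivatives of the powers u^j vanish, so log(z+1) drops out and the
Euler–Maclaurin integrand remains. -/
theorem remainderIntegrand_add_one {m k : ℕ} (hm : k < m) {z : ℂ} (hz : z ∈ cutPlane) {t : ℝ}
    (ht : 0 < t) : remainderIntegrand (k + 1) m z (t + 1) =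
      ∑ j ∈ Finset.range (k + 1), binomShiftCoeff (k + 1) j z *
        (perBernoulli m t * powLogDer j m (z + 1 + t)) := by
  have h1 : z + ((t + 1 : ℝ) : ℂ) = z + 1 + t := by push_cast; ring
  have h2 := slitPlane_add_ofReal hz ht.le
  rw [remainderIntegrand, iteratedDeriv_binomLog k m hz (by rwa [h1]), ← perBernoulli,
    perBernoulli_add_one, binomLogDer, Finset.mul_sum, h1]
  refine Finset.sum_congr rfl fun j hj => ?_
  have hjk := Finset.mem_range.1 hj
  rw [powDer, fallFac_natCast_eq_zero (by omega : j < m)]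
  ring

theorem integrableOn_remainderIntegrand {m k : ℕ} (hm : k + 2 ≤ m) {z : ℂ} (hz : z ∈ cutPlane) :
    IntegrableOn (remainderIntegrand (k + 1) m z) (Set.Ioi 1) := by
  have h : IntegrableOn (fun t => remainderIntegrand (k + 1) m z (t + 1)) (Set.Ioi 0) := by
    refine IntegrableOn.congr_fun (f := fun t : ℝ => ∑ j ∈ Finset.range (k + 1),
      binomShiftCoeff (k + 1) j z * (perBernoulli m t * powLogDer j m (z + 1 + t))) ?_
      (fun t ht => (remainderIntegrand_add_one (by omega) hz ht).symm) measurableSet_Ioi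
    refine integrable_finsetSum _ fun j hj => Integrable.const_mul ?_ _
    have hjk := Finset.mem_range.1 hj
    exact integrableOn_powLogDer (by omega) hz
  rwa [integrableOn_Ioi_comp_add_right, zero_add] at h

theorem remainderTerm_eq {m k : ℕ} (hm : k + 2 ≤ m) {z : ℂ} (hz : z ∈ cutPlane) :
    remainderTerm (k + 1) m z = ∑ j ∈ Finset.range (k + 1), binomShiftCoeff (k + 1) j z *
      ((-1) ^ (m - 1) / (m.factorial : ℂ) *
        ∫ t in Set.Ioi (0 : ℝ), perBernoulli m t * powLogDer j m (z + 1 + t)) := by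
  have h := setIntegral_Ioi_comp_add_right (remainderIntegrand (k + 1) m z) 0 1
  rw [zero_add] at h
  rw [remainderTerm, ← h, setIntegral_congr_fun measurableSet_Ioi
    (fun t ht => remainderIntegrand_add_one (by omega) hz ht), integral_finsetSum]
  · rw [Finset.mul_sum]
    refine Finset.sum_congr rfl fun j _ => ?_
    rw [integral_const_mul]
    ring
  · intro j hj
    have hjk := Finset.mem_range.1 hj
    exact Integrable.const_mul (integrableOn_powLogDer (by omega) hz) _

/-- Compared for each j separately: the logarithmic parts of the F-terms cancel against the
coefficient of log(z+1), and the subtracted 1 in (z+1)^r - 1 accounts for 1/(j+1)^2 beside ζ'(-j).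
-/
theorem gammaEM_eq {m k : ℕ} (hm : k + 2 ≤ m) {z : ℂ} (hz : z ∈ cutPlane) :
    gammaEM m k z =
      (cbinom (z + 1) (k + 1) + ∑ r ∈ Finset.Icc 1 (k + 1),
          (bernoulli r : ℂ) / (r.factorial : ℂ) * negDerivBinom (r - 1) k z) *
        Complex.log (z + 1)
      - ∑ r ∈ Finset.Icc 1 (k + 1), negDerivBinom (r - 1) k z *
          (1 / ((r.factorial : ℂ) * (r : ℂ)) * ((z + 1) ^ r - 1))
      - ∑ j ∈ Finset.range (k + 1), binomShiftCoeff (k + 1) j z *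
          (deriv riemannZeta (-(j : ℂ)) + 1 / ((j : ℂ) + 1) ^ 2)
      + ∑ r ∈ Finset.Icc 1 m, (bernoulli r : ℂ) / (r.factorial : ℂ) * bernTerm (k + 1) (r - 1) z
      - remainderTerm (k + 1) m z := by
  have h1 : ∑ r ∈ Finset.Icc 1 m,
      (bernoulli r : ℂ) / (r.factorial : ℂ) * bernTerm (k + 1) (r - 1) z =
      ∑ j ∈ Finset.range (k + 1), binomShiftCoeff (k + 1) j z *
        (∑ r ∈ Finset.Icc 1 m, (bernoulli r : ℂ) / (r.factorial : ℂ) * powLogDer j (r - 1) (z + 1) -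
          (∑ r ∈ Finset.Icc 1 m, (bernoulli r : ℂ) / (r.factorial : ℂ) * powDer j (r - 1) (z + 1)) *
            Complex.log (z + 1)) := by
    simp only [bernTerm_eq k _ hz, Finset.mul_sum, Finset.sum_mul, ← Finset.sum_sub_distrib]
    rw [Finset.sum_comm]
    refine Finset.sum_congr rfl fun j _ => Finset.sum_congr rfl fun r _ => ?_
    ring
  rw [log_coefficient (m := m) (by omega), remainderTerm_eq hm hz, h1, sum_Icc_one_eq_sum_range,
    Finset.sum_mul, ← Finset.sum_sub_distrib, ← Finset.sum_sub_distrib, ← Finset.sum_add_distrib,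
    ← Finset.sum_sub_distrib, gammaEM]
  refine Finset.sum_congr rfl fun j hj => ?_
  have hjk := Finset.mem_range.1 hj
  have hj : ((j : ℂ) + 1) ≠ 0 := by exact_mod_cast j.succ_ne_zero
  have hf : (j.factorial : ℂ) ≠ 0 := by exact_mod_cast j.factorial_ne_zero
  have h2 : negDerivBinom j k z * (1 / (((j + 1).factorial : ℂ) * ((j + 1 : ℕ) : ℂ)) *
      ((z + 1) ^ (j + 1) - 1)) =
      binomShiftCoeff (k + 1) j z * ((z + 1) ^ (j + 1) / (j + 1) ^ 2 - 1 / ((j : ℂ) + 1) ^ 2) := by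
    rw [negDerivBinom_eq, Nat.factorial_succ]
    push_cast
    field_simp
  rw [Nat.add_sub_cancel, h2, hurwitzDeriv_one (by omega), hurwitzDeriv, emFun, powLogPrim]
  ring

end

/-! ### The limit for n = 0 and the main theorem -/

theorem tendstoUniformlyOn_qMultipleGamma_zero {K : Set ℂ} (hK : IsCompact K) :
    TendstoUniformlyOn (fun (q : ℝ) (z : ℂ) => qMultipleGamma 0 q (z + 1)) (fun z => z + 1)
      (𝓝[<] (1 : ℝ)) K := by
  rw [← tendstoLocallyUniformlyOn_iff_tendstoUniformlyOn_of_compact hK,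
    tendstoLocallyUniformlyOn_iff_forall_tendsto]
  intro z₀ hz₀
  have hq : Tendsto (fun y : ℝ × ℂ => y.1) (𝓝[<] (1 : ℝ) ×ˢ 𝓝[K] z₀) (𝓝[<] (1 : ℝ)) := tendsto_fst
  have hz : Tendsto (fun y : ℝ × ℂ => y.2 + 1) (𝓝[<] (1 : ℝ) ×ˢ 𝓝[K] z₀) (𝓝 (z₀ + 1)) :=
    (tendsto_snd.mono_right nhdsWithin_le_nhds).add_const 1
  have hq0 : ∀ᶠ y : ℝ × ℂ in 𝓝[<] (1 : ℝ) ×ˢ 𝓝[K] z₀, 0 < y.1 :=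
    hq.eventually (mem_nhdsWithin_of_mem_nhds (lt_mem_nhds zero_lt_one))
  exact (hz.prodMk_nhds (tendsto_qNumber hq hq0 _ _ hz)).mono_right (nhds_le_uniformity _)

theorem theorem4p4 :
    (∃! G : ℕ → ℂ → ℂ, IsVignerasHierarchy G) ∧
    ∀ G : ℕ → ℂ → ℂ, IsVignerasHierarchy G →
      (∀ (n : ℕ) (K : Set ℂ), IsCompact K → K ⊆ complNegInt →
        TendstoUniformlyOn (fun (q : ℝ) (z : ℂ) => qMultipleGamma n q (z + 1))
          (fun z => G n (z + 1)) (𝓝[<] (1 : ℝ)) K) ∧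
      ∀ n : ℕ, 1 ≤ n →
        -- `L` is the holomorphic branch of `log G_n(z+1)` with `L 0 = log G_n(1) = 0`
        ∃ L : ℂ → ℂ, DifferentiableOn ℂ L cutPlane ∧ L 0 = 0 ∧
          (∀ z ∈ cutPlane, Complex.exp (L z) = G n (z + 1)) ∧
          ∀ m : ℕ, n < m → ∀ z ∈ cutPlane,
            IntegrableOn (remainderIntegrand n m z) (Set.Ioi (1 : ℝ)) ∧
            L z =
              (cbinom (z + 1) n +
                  ∑ r ∈ Finset.Icc 1 n,
                    (bernoulli r : ℂ) / (r.factorial : ℂ) * negDerivBinom (r - 1) (n - 1) z) *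
                Complex.log (z + 1)
              - ∑ r ∈ Finset.Icc 1 n,
                  negDerivBinom (r - 1) (n - 1) z *
                    (1 / ((r.factorial : ℂ) * (r : ℂ)) * ((z + 1) ^ r - 1))
              - ∑ j ∈ Finset.range n,
                  binomShiftCoeff n j z *
                    (deriv riemannZeta (-(j : ℂ)) + 1 / ((j : ℂ) + 1) ^ 2)
              + ∑ r ∈ Finset.Icc 1 m,
                  (bernoulli r : ℂ) / (r.factorial : ℂ) * bernTerm n (r - 1) z
              - remainderTerm n m z := by
  refine ⟨⟨vigneras, isVignerasHierarchy_vigneras, fun G hG => hG.eq_vigneras⟩, fun G hG => ?_⟩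
  obtain rfl := hG.eq_vigneras
  refine ⟨fun n K hK hKs => ?_, fun n hn => ?_⟩
  · cases n with
    | zero => exact tendstoUniformlyOn_qMultipleGamma_zero hK
    | succ n => simpa only [vigneras_add_one] using tendstoUniformlyOn_qMultipleGamma n hK hKs
  · obtain ⟨k, rfl⟩ := Nat.exists_eq_add_of_le' hn
    -- With n = k + 1 the condition n < m unfolds to k + 2 ≤ m, which makes u^(j-m) integrable at
    -- infinity for every j ≤ k.
    refine ⟨mgLog k, differentiableOn_mgLog k, mgLog_zero k, fun z hz => ?_, fun m hm z hz =>
      ⟨integrableOn_remainderIntegrand hm hz, ?_⟩⟩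
    · rw [exp_mgLog k hz, vigneras_add_one]
    · rw [← gammaEM_eq_mgLog hm hz]
      exact gammaEM_eq hm hz
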